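/- **Setting.** Let $d\ge 0$, let $\mathcal D$ be a Borel probability distribution on $\mathbb R^d$ with compact support $\mathsf{FeatSp}$, and let $c>0$. A *multi-rooted featured graph* (MRFG) is a triple $\mathbb G=(G,\bar v,\chi)$ of a finite simple graph $G$, a tuple $\bar v=(v_1,\dots,v_m)$ of vertices (its roots, $m\ge 0$) and a map $\chi:V(G)\to\mathbb R^d$; $\mathbb G[v]$ is $\mathbb G$ with $v$ appended to the roots. For $r\ge0$, $\mathrm B_r(v)$ is the featured graph induced by $\mathbb G$ on the vertices at distance at most $r$ from $v$, with $v$ as its only root. $N(v)$ is the set of neighbours of $v$. A coupling of two distributions is a joint distribution having them as marginals; a coupling with a finite non-empty set means with the uniform distribution on it. $\mathcal G_{\mathcal D}(n,c/n)$ is the random featured graph (without roots) on $n$ vertices in which each pair of vertices is an edge independently with probability $c/n$ (for $n\geq c$) and, independently, the features of the vertices are i.i.d. with distribution $\mathcal D$. $\mathrm{FBP}$ is the rooted random featured tree in which the vertices have independent $\mathrm{Poisson}(c)$ numbers of children and, independently, i.i.d. features with distribution $\mathcal D$; $\mathrm{FBP}|_r$ is the tree formed by the vertices at distance at most $r$ from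 its root. A property holds asymptotically almost surely (a.a.s.) if its probability tends to $1$ as $n\to\infty$. **Similarity.** For MRFGs $\mathbb G=(G,\bar v,\chi)$, $\mathbb H=(H,\bar u,\nu)$ with the same number of roots, $\mathbb G\sim_{0,\epsilon,\eta}\mathbb H$ if $v_i\mapsto u_i$ is a partial isomorphism (it preserves and reflects equality and adjacency) and $\lVert\chi(v_i)-\nu(u_i)\rVert_\infty\le\epsilon$ for all $i$. For $k\ge1$, $\mathbb G\sim_{k,\epsilon,\eta}\mathbb H$ if (1) for every $p\in V(G)$ there is $q\in V(H)$, and for every $q\in V(H)$ there is $p\in V(G)$, with $\mathbb G[p]\sim_{k-1,\epsilon,\eta}\mathbb H[q]$; and (2) for every $i$, $v_i$ is isolated iff $u_i$ is, and if neither is isolated there is a coupling $\Pi$ of $N(v_i)$ and $N(u_i)$ with $\Pr_{(v,u)\sim\Pi}(\mathbb G[v]\sim_{k-1,\epsilon,\eta}\mathbb H[u])\ge1-\eta$. **Axioms.** Let $\mathbb G$ be an MRFG. * $\mathbb G$ is *$(k,\epsilon,\eta,r)$-rich* if for every $r'\le r$ and every finite rooted featured tree $\mathbb T$ with features in $\mathsf{FeatSp}$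 and height at most $r'$ there are $v_1,\dots,v_k\in V(G)$ such that $\mathrm B_{r'}(v_i)\sim_{k,\epsilon,\eta}\mathbb T$ for all $i$; the distance between $v_i$ and $v_j$ is greater than $2r+1$ for all $i\ne j$; and the distance from each $v_i$ to every root of $\mathbb G$ and to every cycle of length at most $2r+1$ is greater than $2r+1$. * $\mathbb G$ is *$(k,\epsilon,\eta,r)$-similar to $\mathrm{FBP}$* if for every $r'\le r$ there is a coupling $\Pi$ of $V(G)$ and $\mathrm{FBP}|_{r'}$ with $\Pr_{(v,\mathbb T)\sim\Pi}(\mathrm B_{r'}(v)\sim_{k,\epsilon,\eta}\mathbb T)\ge1-\eta$. * $\mathbb G$ is *$(k,\eta,r)$-homogeneous* if $\dfrac{(k+\mathrm{Cycle}_r(G))\,\Delta(G)^r}{|V(G)|}\le\eta$, where $\mathrm{Cycle}_r(G)$ is the number of vertices of $G$ lying on a cycle of length at most $2r+1$ and $\Delta(G)$ is the maximum degree of $G$. **Theorem.** Let $k,r\ge0$ be integers and $\epsilon,\eta>0$. Then a.a.s. $\mathcal G_{\mathcal D}(n,c/n)$ is (I) $(k,\epsilon,\eta,r)$-rich, (II)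 $(k,\epsilon,\eta,r)$-similar to $\mathrm{FBP}$, and (III) $(k,\eta,r)$-homogeneous. -/

import Mathlib

open MeasureTheory ProbabilityTheory Filter Topology

noncomputable section

/-- A coupling of two distributions `μ` and `ν`: a joint distribution with marginals `μ`, `ν`. -/
def IsCoupling {α β : Type*} [MeasurableSpace α] [MeasurableSpace β]
    (γ : Measure (α × β)) (μ : Measure α) (ν : Measure β) : Prop :=
  γ.map Prod.fst = μ ∧ γ.map Prod.snd = ν

/-- A (finite) multi-rooted featured graph with `m` roots and features in `ℝ^d`. The norm on
`Fin d → ℝ` is the sup norm. -/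
structure MRFG (d m : ℕ) where
  V : Type
  [finite : Finite V]
  graph : SimpleGraph V
  root : Fin m → V
  feat : V → Fin d → ℝ

namespace MRFG

variable {d m : ℕ}

instance (G : MRFG d m) : Finite G.V := G.finite

/-- Vertex sets are finite and carry the discrete σ-algebra. -/
instance (G : MRFG d m) : MeasurableSpace G.V := ⊤

/-- `𝔾[v]`: the vertex `v` is appended to the list of roots. -/
def addRoot (G : MRFG d m) (v : G.V) : MRFG d (m + 1) where
  V := G.V
  graph := G.graph
  root := Fin.snoc (α := fun _ => G.V) G.root v
  feat := G.feat

/-- The vertices at distance at most `r` from `v` (in the extended graph distance). -/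
def ballSet (G : MRFG d m) (r : ℕ) (v : G.V) : Set G.V := {w | G.graph.edist v w ≤ r}

lemma mem_ballSet_self (G : MRFG d m) (r : ℕ) (v : G.V) : v ∈ G.ballSet r v := by
  simp [ballSet]

/-- The `r`-neighbourhood of `v`: the subgraph induced on the vertices at distance at most `r`
from `v`, with the inherited features and with `v` as its only root. -/
def ball (G : MRFG d m) (r : ℕ) (v : G.V) : MRFG d 1 where
  V := G.ballSet r v
  graph := G.graph.induce (G.ballSet r v)
  root := fun _ => ⟨v, G.mem_ballSet_self r v⟩
  feat := fun w => G.feat w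

/-- Matching the roots of `G` with those of `H` is a partial isomorphism. -/
def RootsPartialIso (G H : MRFG d m) : Prop :=
  ∀ i j : Fin m, (G.root i = G.root j ↔ H.root i = H.root j) ∧
    (G.graph.Adj (G.root i) (G.root j) ↔ H.graph.Adj (H.root i) (H.root j))

/-- The similarity relation `G ∼_{k,ε,η} H`. -/
def Sim (ε η : ℝ) : (k : ℕ) → {m : ℕ} → MRFG d m → MRFG d m → Prop
  | 0, _, G, H =>
      G.RootsPartialIso H ∧ ∀ i, ‖G.feat (G.root i) - H.feat (H.root i)‖ ≤ ε
  | k + 1, m, G, H =>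
      ((∀ p : G.V, ∃ q : H.V, Sim ε η k (G.addRoot p) (H.addRoot q)) ∧
        (∀ q : H.V, ∃ p : G.V, Sim ε η k (G.addRoot p) (H.addRoot q))) ∧
      ∀ i : Fin m,
        (G.graph.IsIsolated (G.root i) ↔ H.graph.IsIsolated (H.root i)) ∧
        (¬ G.graph.IsIsolated (G.root i) → ¬ H.graph.IsIsolated (H.root i) →
          ∃ γ : Measure (G.V × H.V),
            IsCoupling γ (uniformOn (G.graph.neighborSet (G.root i)))
              (uniformOn (H.graph.neighborSet (H.root i))) ∧
            ENNReal.ofReal (1 - η) ≤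
              γ {x | Sim ε η k (G.addRoot x.1) (H.addRoot x.2)})

/-- A rooted featured tree (a tree with one root). -/
def IsRootedTree (T : MRFG d 1) : Prop := T.graph.IsTree

/-- A rooted tree has height at most `h`. -/
def HeightLE (T : MRFG d 1) (h : ℕ) : Prop := ∀ w : T.V, T.graph.dist (T.root 0) w ≤ h

/-- The set of vertices that lie on a cycle of length at most `ℓ`. -/
def cycleVertices (G : MRFG d m) (ℓ : ℕ) : Set G.V :=
  {v | ∃ p : G.graph.Walk v v, p.IsCycle ∧ p.length ≤ ℓ}

/-- `(k, ε, η, r)`-richness, where featured trees take their features in `F`. -/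
def IsRich (F : Set (Fin d → ℝ)) (k : ℕ) (ε η : ℝ) (r : ℕ) (G : MRFG d m) : Prop :=
  ∀ r' ≤ r, ∀ T : MRFG d 1, T.IsRootedTree → T.HeightLE r' → (∀ w, T.feat w ∈ F) →
    ∃ v : Fin k → G.V,
      (∀ i, Sim ε η k (G.ball r' (v i)) T) ∧
      (∀ i j, i ≠ j → ((2 * r + 1 : ℕ) : ℕ∞) < G.graph.edist (v i) (v j)) ∧
      (∀ i, (∀ j, ((2 * r + 1 : ℕ) : ℕ∞) < G.graph.edist (v i) (G.root j)) ∧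
        ∀ w ∈ G.cycleVertices (2 * r + 1),
          ((2 * r + 1 : ℕ) : ℕ∞) < G.graph.edist (v i) w)

open Classical in
/-- The maximum degree `Δ(G)`. -/
def maxDeg (G : MRFG d m) : ℕ :=
  letI := Fintype.ofFinite G.V
  G.graph.maxDegree

/-- `(k, η, r)`-homogeneity. -/
def IsHomogeneous (k : ℕ) (η : ℝ) (r : ℕ) (G : MRFG d m) : Prop :=
  ((k : ℝ) + (G.cycleVertices (2 * r + 1)).ncard) * (G.maxDeg : ℝ) ^ r / Nat.card G.V ≤ η

end MRFG

/-- Outcomes of the featured branching process, in Ulam–Harris coding: potential individuals are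
words of natural numbers, `i :: w` being the `i`-th child of `w` and `[]` the root. The first
component gives the number of children of each word, the second one its feature. -/
abbrev TreeCode (d : ℕ) : Type := (List ℕ → ℕ) × (List ℕ → Fin d → ℝ)

namespace TreeCode

/-- The words that are individuals of the tree with offspring numbers `o`. -/
def IsNode (o : List ℕ → ℕ) : List ℕ → Prop
  | [] => True
  | i :: w => IsNode o w ∧ i < o w

/-- The individuals of the first `r` generations (the root being generation `0`). -/
def nodes (o : List ℕ → ℕ) (r : ℕ) : Set (List ℕ) := {w | IsNode o w ∧ w.length ≤ r}

lemma finite_nodes (o : List ℕ → ℕ) (r : ℕ) : (nodes o r).Finite := by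
  induction r with
  | zero =>
    refine (Set.finite_singleton []).subset ?_
    rintro w ⟨-, hw⟩
    simpa using hw
  | succ r ih =>
    refine ((ih.biUnion fun w _ =>
      (Set.finite_lt_nat (o w)).image fun i => i :: w).union (Set.finite_singleton [])).subset ?_
    rintro (_ | ⟨i, w⟩) ⟨hn, hl⟩
    · exact Or.inr rfl
    · refine Or.inl (Set.mem_biUnion (x := w) ⟨hn.1, by simpa using hl⟩ ⟨i, hn.2, rfl⟩)

/-- The rooted featured tree formed by the first `r` generations of the coded tree. -/
def restrict {d : ℕ} (r : ℕ) (T : TreeCode d) : MRFG d 1 where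
  V := nodes T.1 r
  finite := (finite_nodes T.1 r).to_subtype
  graph := SimpleGraph.fromRel fun u v => ∃ i, v.1 = i :: u.1
  root := fun _ => ⟨[], trivial, Nat.zero_le _⟩
  feat := fun w => T.2 w.1

end TreeCode

/-- The featured branching process `FBP`: independent `Poisson(c)` numbers of children and
independent features with distribution `D`. -/
def FBP {d : ℕ} (D : Measure (Fin d → ℝ)) (c : ℝ) : Measure (TreeCode d) :=
  (Measure.infinitePi fun _ : List ℕ => poissonMeasure c.toNNReal).prod
    (Measure.infinitePi fun _ : List ℕ => D)

namespace MRFG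

variable {d m : ℕ}

/-- `G` is `(k, ε, η, r)`-close to `FBP`: some coupling of the uniform distribution on `V(G)` with
the featured branching process satisfies
`Pr (ball of radius r around v ∼_{k,ε,η} first r generations of T) ≥ 1 - η`.
This is expressed as a bound on the complementary event. -/
def IsCloseToFBP (D : Measure (Fin d → ℝ)) (c : ℝ) (k : ℕ) (ε η : ℝ) (r : ℕ)
    (G : MRFG d m) : Prop :=
  ∃ γ : Measure (G.V × TreeCode d),
    IsCoupling γ (uniformOn Set.univ) (FBP D c) ∧
    γ {x | ¬ Sim ε η k (G.ball r x.1) (x.2.restrict r)} ≤ ENNReal.ofReal η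

/-- `G` is `(k, ε, η, r)`-similar to `FBP`. -/
def IsSimilarToFBP (D : Measure (Fin d → ℝ)) (c : ℝ) (k : ℕ) (ε η : ℝ) (r : ℕ)
    (G : MRFG d m) : Prop :=
  ∀ r' ≤ r, G.IsCloseToFBP D c k ε η r'

/-- The featured graph (without roots) on `{0, …, n-1}` with given edges and features. -/
def ofPair {n : ℕ} (x : SimpleGraph (Fin n) × (Fin n → Fin d → ℝ)) : MRFG d 0 where
  V := Fin n
  graph := x.1
  root := Fin.elim0
  feat := x.2

end MRFG

/-- The edge probability `c / n` (truncated to `1` for the finitely many `n < c`). -/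
def edgeProb (c : ℝ) (n : ℕ) : unitInterval := Set.projIcc 0 1 zero_le_one (c / n)

/-- The law of `G_D(n, c/n)`: an Erdős–Rényi graph on `n` vertices with edge probability `c / n`
and, independently, independent features with distribution `D`. -/
def randomFeaturedGraph {d : ℕ} (D : Measure (Fin d → ℝ)) (c : ℝ) (n : ℕ) :
    Measure (SimpleGraph (Fin n) × (Fin n → Fin d → ℝ)) :=
  (SimpleGraph.binomialRandom (Fin n) (edgeProb c n)).prod (Measure.pi fun _ => D)

/-- `G_D(n, c/n)` satisfies `P` asymptotically almost surely: the probability that `P` fails tends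
to `0` (for outer measure, so this presupposes no measurability of `P`). -/
def HoldsAAS {d : ℕ} (D : Measure (Fin d → ℝ)) (c : ℝ) (P : MRFG d 0 → Prop) : Prop :=
  Tendsto (fun n : ℕ => randomFeaturedGraph D c n {x | ¬ P (MRFG.ofPair x)}) atTop (𝓝 0)

end

/-! Let `H` be a finite tree of height at most `r` with vertex set `W`, and let `I` be the number of
its vertices of depth below `r`. An injection of `W` into the `n` vertices is an isomorphism onto
the `r`-ball around the image of the root exactly when `|W| - 1` given pairs are edges and a further
`I * n + O(1)` given pairs are not. With `p = c / n` this has probability about `(c / n) ^ (|W| - 1)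
* exp (-c) ^ I`, times the probability that the features fall into prescribed cells. There are about
`n ^ |W|` injections, so the expected number of such embeddings is linear in `n`. If embeddings
differing by permutations of siblings are counted once, the slope acquires the factor `1 / ∏ (number
of children)!` and becomes the probability that `FBP` starts with this tree, by the form of the
Poisson weights (`FBP_real_agree`). Embeddings with disjoint images are almost independent, and
those whose images meet have roots at distance at most `2 * r`, of which only `O(n)` pairs are
expected. Hence the variance is `o(n ^ 2)`, and Chebyshev's inequality shows that a.a.s. the count
is not much below its mean (`tendsto_real_eventCount_le`).

(II) Features are rounded to a grid of mesh `ε`. Finitely many classes of trees then carry almost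
all the mass of `FBP` (`exists_finset_codes`), and a.a.s. each occurs among the balls at least about
as often as it should. These lower bounds nearly sum to `1`, so matching equal classes yields the
coupling (`exists_coupling_of_labels`).

(I) Since the support of `D` is totally bounded, featured graphs fall into finitely many types up to
similarity (`exists_finite_types`), and one representative tree per type has to be copied. It has
linearly many copies; all balls of bounded radius are of size at most `δ * n`, and few vertices are
near a short cycle, so `k` copies can be chosen greedily.

(III) The expected number of vertices on short cycles is bounded and the maximum degree is below any
given power of `n`, both by first moment bounds. -/

noncomputable section

/-! ### Prescribed edges, non-edges and features -/

/-- The random graph is the image under `fromEdgeSet` of a Bernoulli random subset of `Sym2 V`, so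
distinct pairs are independent. Excluding diagonal pairs makes `fromEdgeSet` harmless for the pairs
in `E` and `N`. -/
lemma binomialRandom_real_edges {V : Type*} [Finite V] [DecidableEq V] (p : unitInterval)
    (E N : Finset (Sym2 V)) (hE : ∀ e ∈ E, ¬ e.IsDiag) (hEN : Disjoint E N)
    (hN : ∀ e ∈ N, ¬ e.IsDiag) :
    (SimpleGraph.binomialRandom V p).real
      {G | (∀ e ∈ E, e ∈ G.edgeSet) ∧ ∀ e ∈ N, e ∉ G.edgeSet} =
      (p : ℝ) ^ E.card * (1 - p : ℝ) ^ N.card := by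
  classical
  have hmE : ∀ e : Sym2 V, MeasurableSet {s : Set (Sym2 V) | e ∈ s} := fun e => by measurability
  have hms : MeasurableSet {s : Set (Sym2 V) | (∀ e ∈ E, e ∈ s) ∧ ∀ e ∈ N, e ∉ s} := by
    have : {s : Set (Sym2 V) | (∀ e ∈ E, e ∈ s) ∧ ∀ e ∈ N, e ∉ s} =
        (⋂ e ∈ E, {s | e ∈ s}) ∩ ⋂ e ∈ N, {s | e ∈ s}ᶜ := by
      ext s; simp
    rw [this]
    exact (Finset.measurableSet_biInter _ fun e _ => hmE e).inter
      (Finset.measurableSet_biInter _ fun e _ => (hmE e).compl)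
  have hm : MeasurableSet {G : SimpleGraph V |
      (∀ e ∈ E, e ∈ G.edgeSet) ∧ ∀ e ∈ N, e ∉ G.edgeSet} :=
    hms.preimage SimpleGraph.measurable_edgeSet
  have hpre : SimpleGraph.fromEdgeSet ⁻¹' {G : SimpleGraph V |
      (∀ e ∈ E, e ∈ G.edgeSet) ∧ ∀ e ∈ N, e ∉ G.edgeSet} =
      {s : Set (Sym2 V) | (∀ e ∈ E, e ∈ s) ∧ ∀ e ∈ N, e ∉ s} := by
    ext s
    simp only [Set.mem_preimage, Set.mem_ofPred_eq, SimpleGraph.edgeSet_fromEdgeSet, Set.mem_sdiff,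
      Sym2.mem_diagSet, not_and, not_not]
    constructor
    · rintro ⟨h1, h2⟩
      exact ⟨fun e he => (h1 e he).1, fun e he hs => hN e he (h2 e he hs)⟩
    · rintro ⟨h1, h2⟩
      exact ⟨fun e he => ⟨h1 e he, hE e he⟩, fun e he hs => absurd hs (h2 e he)⟩
  rw [measureReal_def, SimpleGraph.binomialRandom_eq_map,
    Measure.map_apply SimpleGraph.measurable_fromEdgeSet hm, hpre, setBernoulli_apply']
  have hpi : (fun q : Sym2 V → Prop => {i | q i}) ⁻¹'
      {s : Set (Sym2 V) | (∀ e ∈ E, e ∈ s) ∧ ∀ e ∈ N, e ∉ s} =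
      Set.pi (E ∪ N : Finset (Sym2 V)) fun e => if e ∈ E then {True} else {False} := by
    ext q
    simp only [Set.mem_preimage, Set.mem_ofPred_eq, Set.mem_pi, Finset.coe_union, Set.mem_union,
      Finset.mem_coe]
    constructor
    · rintro ⟨h1, h2⟩ e he
      by_cases heE : e ∈ E
      · simp [heE, h1 e heE]
      · simp [heE, h2 e (he.resolve_left heE)]
    · intro h
      refine ⟨fun e he => ?_, fun e he => ?_⟩
      · simpa [he] using h e (Or.inl he)
      · simpa [Finset.disjoint_right.1 hEN he] using h e (Or.inr he)
  rw [hpi, Measure.infinitePi_pi _ (fun e _ => by split_ifs <;> exact MeasurableSet.singleton _),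
    Finset.prod_union hEN, ENNReal.toReal_mul, ENNReal.toReal_prod, ENNReal.toReal_prod]
  congr 1
  · rw [Finset.prod_eq_pow_card]
    intro e he
    have : e ∈ Sym2.diagSetᶜ := by simpa using hE e he
    simp only [he, if_true, Measure.add_apply, Measure.smul_apply]
    simp [this, ENNReal.smul_def]
  · rw [Finset.prod_eq_pow_card]
    intro e he
    have h1 : e ∉ E := Finset.disjoint_right.1 hEN he
    simp only [h1, if_false, Measure.add_apply, Measure.smul_apply]
    simp [hN e he, ENNReal.smul_def]

lemma measurableSet_edges {V : Type*} [Finite V] (E N : Finset (Sym2 V)) :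
    MeasurableSet {G : SimpleGraph V | (∀ e ∈ E, e ∈ G.edgeSet) ∧ ∀ e ∈ N, e ∉ G.edgeSet} := by
  have hmE : ∀ e : Sym2 V, MeasurableSet {G : SimpleGraph V | e ∈ G.edgeSet} := fun e =>
    (show MeasurableSet {s : Set (Sym2 V) | e ∈ s} by measurability).preimage
      SimpleGraph.measurable_edgeSet
  have : {G : SimpleGraph V | (∀ e ∈ E, e ∈ G.edgeSet) ∧ ∀ e ∈ N, e ∉ G.edgeSet} =
      (⋂ e ∈ E, {G : SimpleGraph V | e ∈ G.edgeSet}) ∩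
        ⋂ e ∈ N, {G : SimpleGraph V | e ∈ G.edgeSet}ᶜ := by
    ext s; simp
  rw [this]
  exact (Finset.measurableSet_biInter _ fun e _ => hmE e).inter
    (Finset.measurableSet_biInter _ fun e _ => (hmE e).compl)

/-- Without the disjointness assumption the formula remains an upper bound. -/
lemma binomialRandom_real_edges_le {V : Type*} [Finite V] [DecidableEq V] (p : unitInterval)
    (E N : Finset (Sym2 V)) (hE : ∀ e ∈ E, ¬ e.IsDiag) (hN : ∀ e ∈ N, ¬ e.IsDiag) :
    (SimpleGraph.binomialRandom V p).real
      {G | (∀ e ∈ E, e ∈ G.edgeSet) ∧ ∀ e ∈ N, e ∉ G.edgeSet} ≤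
      (p : ℝ) ^ E.card * (1 - p : ℝ) ^ N.card := by
  by_cases hEN : Disjoint E N
  · exact (binomialRandom_real_edges p E N hE hEN hN).le
  · obtain ⟨e, he, he'⟩ := Finset.not_disjoint_iff.1 hEN
    have : {G : SimpleGraph V | (∀ e ∈ E, e ∈ G.edgeSet) ∧ ∀ e ∈ N, e ∉ G.edgeSet} = ∅ := by
      ext G
      simp only [Set.mem_ofPred_eq, Set.mem_empty_iff_false, iff_false]
      exact fun h => h.2 e he' (h.1 e he)
    rw [this]
    simp only [measureReal_empty]
    have := p.2.1; have := p.2.2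
    exact mul_nonneg (pow_nonneg p.2.1 _) (pow_nonneg (by linarith) _)

lemma pi_real_forall_mem {V W X : Type*} [Fintype V] [Fintype W] [MeasurableSpace X]
    (D : Measure X) [IsProbabilityMeasure D] (f : W → V) (hf : Function.Injective f)
    (C : W → Set X) :
    (Measure.pi fun _ : V => D).real {χ | ∀ w, χ (f w) ∈ C w} = ∏ w, D.real (C w) := by
  classical
  -- Coordinates outside the range of `f` are left free; injectivity makes the constraint on each
  -- other coordinate unique.
  have : {χ : V → X | ∀ w, χ (f w) ∈ C w} =
      Set.pi Set.univ fun v => if h : ∃ w, f w = v then C h.choose else Set.univ := by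
    ext χ
    simp only [Set.mem_ofPred_eq, Set.mem_pi, Set.mem_univ, true_implies]
    constructor
    · intro h v
      split_ifs with hv
      · have := h hv.choose
        rwa [hv.choose_spec] at this
      · trivial
    · intro h w
      have hw : ∃ w', f w' = f w := ⟨w, rfl⟩
      have := h (f w)
      rw [dif_pos hw, hf hw.choose_spec] at this
      exact this
  rw [measureReal_def, this, Measure.pi_pi, ENNReal.toReal_prod]
  rw [← Finset.prod_subset (Finset.subset_univ (Finset.univ.image f)), Finset.prod_image
    (fun a _ b _ h => hf h)]
  · refine Finset.prod_congr rfl fun w _ => ?_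
    have hw : ∃ w', f w' = f w := ⟨w, rfl⟩
    rw [dif_pos hw, hf hw.choose_spec]; rfl
  · intro v _ hv
    rw [dif_neg]
    · simp
    · rintro ⟨w, rfl⟩
      exact hv (by simp)

/-! ### Similarity: reflexivity and transport along isomorphisms -/

namespace MRFG

variable {d m : ℕ}

instance (G : MRFG d m) : DiscreteMeasurableSpace G.V := ⟨fun _ => trivial⟩

lemma uniformOn_map_equiv {α β : Type*} [MeasurableSpace α] [MeasurableSpace β]
    [DiscreteMeasurableSpace α] [DiscreteMeasurableSpace β] (e : α ≃ β) (S : Set β) :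
    (uniformOn S).map e.symm = uniformOn (e ⁻¹' S) := by
  have hc : ∀ A : Set β, Measure.count (e ⁻¹' A) = Measure.count A := fun A => by
    rw [Measure.count_apply .of_discrete, Measure.count_apply .of_discrete,
      Set.encard_preimage_of_bijective e.bijective]
  ext A -
  rw [Measure.map_apply .of_discrete .of_discrete, uniformOn, uniformOn,
    cond_apply .of_discrete, cond_apply .of_discrete, hc S, ← hc (S ∩ _)]
  congr 3
  ext x
  simp

/-- Each root's neighbourhood is coupled with itself along the diagonal. -/
lemma Sim.refl {ε η : ℝ} (hε : 0 ≤ ε) (hη : 0 ≤ η) (k : ℕ) {m : ℕ} (G : MRFG d m) :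
    Sim ε η k G G := by
  induction k generalizing m with
  | zero => exact ⟨fun i j => ⟨Iff.rfl, Iff.rfl⟩, fun i => by simpa using hε⟩
  | succ k ih =>
    refine ⟨⟨fun p => ⟨p, ih _⟩, fun p => ⟨p, ih _⟩⟩, fun i => ⟨Iff.rfl, fun hi _ => ?_⟩⟩
    have hm : Measurable fun x : G.V => (x, x) := .of_discrete
    refine ⟨(uniformOn (G.graph.neighborSet (G.root i))).map fun x => (x, x), ⟨?_, ?_⟩, ?_⟩
    · rw [Measure.map_map measurable_fst hm]
      exact Measure.map_id
    · rw [Measure.map_map measurable_snd hm]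
      exact Measure.map_id
    · refine le_trans ?_ (Measure.le_map_apply hm.aemeasurable _)
      have : (fun x : G.V => (x, x)) ⁻¹'
          {x : G.V × G.V | Sim ε η k (G.addRoot x.1) (G.addRoot x.2)} = Set.univ := by
        ext x; simpa using ih _
      rw [this, uniformOn_of_univ (Set.toFinite _) (by simpa using hi)]
      exact ENNReal.ofReal_le_one.2 (by linarith)

/-- A restricted form of transitivity: an isomorphism carries couplings over unchanged, so only the
feature errors add up and `η` is kept. -/
lemma Sim.of_equiv {ε₁ ε₂ η : ℝ} {k : ℕ} {m : ℕ} {G H T : MRFG d m} (e : G.V ≃ H.V)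
    (hadj : ∀ x y, H.graph.Adj (e x) (e y) ↔ G.graph.Adj x y)
    (hroot : ∀ i, e (G.root i) = H.root i)
    (hfeat : ∀ x, ‖G.feat x - H.feat (e x)‖ ≤ ε₁) (h : Sim ε₂ η k H T) :
    Sim (ε₁ + ε₂) η k G T := by
  induction k generalizing m with
  | zero =>
    refine ⟨fun i j => ⟨?_, ?_⟩, fun i => ?_⟩
    · rw [← (h.1 i j).1, ← hroot, ← hroot, e.apply_eq_iff_eq]
    · rw [← (h.1 i j).2, ← hroot, ← hroot, hadj]
    · have h1 := h.2 i
      have h2 := hfeat (G.root i)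
      rw [hroot] at h2
      calc _ = ‖(G.feat (G.root i) - H.feat (H.root i)) +
            (H.feat (H.root i) - T.feat (T.root i))‖ := by congr 1; abel
        _ ≤ _ := (norm_add_le _ _).trans (add_le_add h2 h1)
  | succ k ih =>
    obtain ⟨⟨hp, hq⟩, hr⟩ := h
    have step : ∀ (p : G.V) (q : T.V), Sim ε₂ η k (H.addRoot (e p)) (T.addRoot q) →
        Sim (ε₁ + ε₂) η k (G.addRoot p) (T.addRoot q) := by
      intro p q hs
      refine ih (G := G.addRoot p) (H := H.addRoot (e p)) (T := T.addRoot q) e hadj ?_ hfeat hs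
      intro i
      refine Fin.lastCases ?_ (fun i => ?_) i
      · exact (congrArg e (Fin.snoc_last (α := fun _ => G.V) p G.root)).trans
          (Fin.snoc_last (α := fun _ => H.V) (e p) H.root).symm
      · exact (congrArg e (Fin.snoc_castSucc (α := fun _ => G.V) p G.root i)).trans
          ((hroot i).trans (Fin.snoc_castSucc (α := fun _ => H.V) (e p) H.root i).symm)
    have hnbr : ∀ i, e ⁻¹' H.graph.neighborSet (H.root i) = G.graph.neighborSet (G.root i) := by
      intro i
      ext x
      rw [← hroot]
      exact hadj _ _
    have hiso : ∀ i, G.graph.IsIsolated (G.root i) ↔ H.graph.IsIsolated (H.root i) := by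
      intro i
      rw [← SimpleGraph.neighborSet_eq_empty, ← SimpleGraph.neighborSet_eq_empty, ← hnbr,
        Set.preimage_eq_empty_iff]
      simp
    refine ⟨⟨fun p => ?_, fun q => ?_⟩, fun i => ⟨(hiso i).trans (hr i).1, fun hG hT => ?_⟩⟩
    · obtain ⟨q, hq⟩ := hp (e p)
      exact ⟨q, step p q hq⟩
    · obtain ⟨p, hp⟩ := hq q
      exact ⟨e.symm p, step _ q (by rwa [e.apply_symm_apply])⟩
    · obtain ⟨γ, ⟨h1, h2⟩, h3⟩ := (hr i).2 (by rwa [← hiso]) hT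
      have hm : Measurable (Prod.map e.symm id : H.V × T.V → G.V × T.V) := .of_discrete
      refine ⟨γ.map (Prod.map e.symm id), ⟨?_, ?_⟩, ?_⟩
      · rw [Measure.map_map measurable_fst hm]
        have : Prod.fst ∘ (Prod.map e.symm id : H.V × T.V → G.V × T.V) = e.symm ∘ Prod.fst := rfl
        rw [this, ← Measure.map_map .of_discrete measurable_fst, h1, uniformOn_map_equiv, hnbr]
      · rw [Measure.map_map measurable_snd hm]
        exact h2
      · refine h3.trans (le_trans (measure_mono ?_) (Measure.le_map_apply hm.aemeasurable _))
        rintro ⟨x, y⟩ hxy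
        exact step _ _ (by simpa using hxy)

lemma Sim.of_near_iso {ε η : ℝ} (hη : 0 ≤ η) {k : ℕ} {m : ℕ} {G H : MRFG d m} (e : G.V ≃ H.V)
    (hadj : ∀ x y, H.graph.Adj (e x) (e y) ↔ G.graph.Adj x y)
    (hroot : ∀ i, e (G.root i) = H.root i)
    (hfeat : ∀ x, ‖G.feat x - H.feat (e x)‖ ≤ ε) : Sim ε η k G H := by
  simpa using Sim.of_equiv e hadj hroot hfeat (Sim.refl le_rfl hη k H)

end MRFG

/-! ### Couplings that match labels, and finiteness of the number of types -/

open scoped ENNReal in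
/-- Two probability measures can be coupled so that matching labels `a` occur with probability at
least `∑ a, min (μ (E a)) (ν (F a))`. -/
lemma exists_coupling_of_labels {α β ι : Type*} [MeasurableSpace α] [MeasurableSpace β]
    (μ : Measure α) (ν : Measure β) [IsProbabilityMeasure μ] [IsProbabilityMeasure ν]
    (s : Finset ι) (E : ι → Set α) (F : ι → Set β) (hE : ∀ a ∈ s, MeasurableSet (E a))
    (hF : ∀ a ∈ s, MeasurableSet (F a)) (hEd : (s : Set ι).PairwiseDisjoint E)
    (hFd : (s : Set ι).PairwiseDisjoint F) :
    ∃ γ : Measure (α × β), IsCoupling γ μ ν ∧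
      ∑ a ∈ s, min (μ (E a)) (ν (F a)) ≤ γ (⋃ a ∈ s, E a ×ˢ F a) := by
  classical
  -- Dividing by the larger mass leaves block `a` with total mass `min (μ (E a)) (ν (F a))`, while
  -- its marginals stay below the restrictions of `μ` and `ν`. If both masses vanish, the factor `∞`
  -- multiplies the zero measure.
  set c : ι → ℝ≥0∞ := fun a => (max (μ (E a)) (ν (F a)))⁻¹
  set γ₀ : Measure (α × β) := ∑ a ∈ s, c a • (μ.restrict (E a)).prod (ν.restrict (F a))
  have hc1 : ∀ a, c a * ν (F a) ≤ 1 := fun a => by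
    rw [mul_comm]
    exact (ENNReal.div_le_of_le_mul (by simp))
  have hc2 : ∀ a, c a * μ (E a) ≤ 1 := fun a => by
    rw [mul_comm]
    exact (ENNReal.div_le_of_le_mul (by simp))
  have hcm : ∀ a, min (μ (E a)) (ν (F a)) ≤ c a * (μ (E a) * ν (F a)) := by
    intro a
    by_cases h0 : max (μ (E a)) (ν (F a)) = 0
    · have : μ (E a) = 0 := nonpos_iff_eq_zero.1 ((le_max_left _ _).trans_eq h0)
      simp [this]
    · have ht : max (μ (E a)) (ν (F a)) ≠ ∞ := by simp
      rw [← max_mul_min (μ (E a)), ← mul_assoc, ENNReal.inv_mul_cancel h0 ht, one_mul]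
  have hfst : ∀ A, MeasurableSet A → (γ₀.map Prod.fst) A = ∑ a ∈ s, c a * (μ (A ∩ E a) * ν (F a)) := by
    intro A hA
    rw [Measure.map_apply measurable_fst hA, ← Set.prod_univ, Measure.finsetSum_apply]
    simp [Measure.restrict_apply hA]
  have hsnd : ∀ A, MeasurableSet A → (γ₀.map Prod.snd) A = ∑ a ∈ s, c a * (μ (E a) * ν (A ∩ F a)) := by
    intro A hA
    rw [Measure.map_apply measurable_snd hA, ← Set.univ_prod, Measure.finsetSum_apply]
    simp [Measure.restrict_apply hA]
  have hle1 : γ₀.map Prod.fst ≤ μ := by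
    refine Measure.le_iff.2 fun A hA => ?_
    rw [hfst A hA]
    calc _ ≤ ∑ a ∈ s, μ (A ∩ E a) := Finset.sum_le_sum fun a _ => by
          calc _ = (c a * ν (F a)) * μ (A ∩ E a) := by ring
            _ ≤ 1 * μ (A ∩ E a) := by gcongr; exact hc1 a
            _ = _ := one_mul _
      _ = μ (⋃ a ∈ s, A ∩ E a) := (measure_biUnion_finset
          (fun a ha b hb hab => (hEd ha hb hab).mono Set.inter_subset_right Set.inter_subset_right)
          fun a ha => hA.inter (hE a ha)).symm
      _ ≤ _ := measure_mono (by simp)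
  have hle2 : γ₀.map Prod.snd ≤ ν := by
    refine Measure.le_iff.2 fun A hA => ?_
    rw [hsnd A hA]
    calc _ ≤ ∑ a ∈ s, ν (A ∩ F a) := Finset.sum_le_sum fun a _ => by
          calc _ = (c a * μ (E a)) * ν (A ∩ F a) := by ring
            _ ≤ 1 * ν (A ∩ F a) := by gcongr; exact hc2 a
            _ = _ := one_mul _
      _ = ν (⋃ a ∈ s, A ∩ F a) := (measure_biUnion_finset
          (fun a ha b hb hab => (hFd ha hb hab).mono Set.inter_subset_right Set.inter_subset_right)
          fun a ha => hA.inter (hF a ha)).symm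
      _ ≤ _ := measure_mono (by simp)
  have hu1 : γ₀.map Prod.fst Set.univ = γ₀ Set.univ := by
    rw [Measure.map_apply measurable_fst .univ, Set.preimage_univ]
  have hu2 : γ₀.map Prod.snd Set.univ = γ₀ Set.univ := by
    rw [Measure.map_apply measurable_snd .univ, Set.preimage_univ]
  have hfin : γ₀ Set.univ ≤ 1 := by
    rw [← hu1]; exact (hle1 _).trans_eq measure_univ
  have : IsFiniteMeasure γ₀ := ⟨hfin.trans_lt ENNReal.one_lt_top⟩
  -- The unmatched remainders have the same total mass `t`, so their product divided by `t`
  -- completes both marginals. For `t = 0` the remainders vanish and `t⁻¹ = ∞` does no harm.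
  set μ' := μ - γ₀.map Prod.fst
  set ν' := ν - γ₀.map Prod.snd
  have hμ' : μ' Set.univ = 1 - γ₀ Set.univ := by
    rw [Measure.sub_apply .univ hle1, hu1, measure_univ]
  have hν' : ν' Set.univ = 1 - γ₀ Set.univ := by
    rw [Measure.sub_apply .univ hle2, hu2, measure_univ]
  set t := 1 - γ₀ Set.univ
  have htt : t ≠ ∞ := (tsub_le_self.trans_lt ENNReal.one_lt_top).ne
  have : IsFiniteMeasure μ' := ⟨by rw [hμ']; exact htt.lt_top⟩
  have : IsFiniteMeasure ν' := ⟨by rw [hν']; exact htt.lt_top⟩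
  have hrem1 : (t⁻¹ • μ'.prod ν').map Prod.fst = μ' := by
    rw [Measure.map_smul, Measure.map_fst_prod, hν', smul_smul]
    by_cases h0 : t = 0
    · have : μ' = 0 := Measure.measure_univ_eq_zero.1 (hμ'.trans h0)
      simp [this]
    · rw [ENNReal.inv_mul_cancel h0 htt, one_smul]
  have hrem2 : (t⁻¹ • μ'.prod ν').map Prod.snd = ν' := by
    rw [Measure.map_smul, Measure.map_snd_prod, hμ', smul_smul]
    by_cases h0 : t = 0
    · have : ν' = 0 := Measure.measure_univ_eq_zero.1 (hν'.trans h0)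
      simp [this]
    · rw [ENNReal.inv_mul_cancel h0 htt, one_smul]
  refine ⟨γ₀ + t⁻¹ • μ'.prod ν', ⟨?_, ?_⟩, ?_⟩
  · rw [Measure.map_add _ _ measurable_fst, hrem1, add_comm]
    exact Measure.sub_add_cancel_of_le hle1
  · rw [Measure.map_add _ _ measurable_snd, hrem2, add_comm]
    exact Measure.sub_add_cancel_of_le hle2
  · calc _ ≤ ∑ a ∈ s, c a * (μ (E a) * ν (F a)) := Finset.sum_le_sum fun a _ => hcm a
      _ ≤ γ₀ (⋃ a ∈ s, E a ×ˢ F a) := by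
        rw [Measure.finsetSum_apply]
        refine Finset.sum_le_sum fun a ha => ?_
        calc _ = (c a • (μ.restrict (E a)).prod (ν.restrict (F a))) (E a ×ˢ F a) := by
              simp
          _ ≤ _ := measure_mono (Set.subset_biUnion_of_mem (u := fun a => E a ×ˢ F a) ha)
      _ ≤ _ := by rw [Measure.add_apply]; exact le_self_add

namespace MRFG

variable {d : ℕ}

/-- Two maps into a finite type whose push-forwards have almost equal weights can be coupled so as
to agree with probability close to `1`. -/
lemma exists_coupling_of_close {α β A : Type*} [MeasurableSpace α] [MeasurableSpace β]
    [DiscreteMeasurableSpace α] [DiscreteMeasurableSpace β] [Fintype A]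
    (μ : Measure α) (ν : Measure β) [IsProbabilityMeasure μ] [IsProbabilityMeasure ν]
    (f : α → A) (g : β → A) (δ : ℝ) (hδ : 0 ≤ δ)
    (h : ∀ a, μ.real {x | f x = a} ≤ ν.real {y | g y = a} + δ) :
    ∃ γ : Measure (α × β), IsCoupling γ μ ν ∧
      ENNReal.ofReal (1 - Fintype.card A * δ) ≤ γ {x | f x.1 = g x.2} := by
  classical
  obtain ⟨γ, hγ, hle⟩ := exists_coupling_of_labels μ ν Finset.univ (fun a => {x | f x = a})
    (fun a => {y | g y = a}) (fun _ _ => .of_discrete) (fun _ _ => .of_discrete)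
    (fun a _ b _ hab => Set.disjoint_left.2 fun x hx hx' => hab (hx.symm.trans hx'))
    (fun a _ b _ hab => Set.disjoint_left.2 fun x hx hx' => hab (hx.symm.trans hx'))
  refine ⟨γ, hγ, le_trans ?_ (hle.trans (measure_mono ?_))⟩
  · have hsum : ∑ a, μ.real {x | f x = a} = 1 := by
      have := sum_measureReal_preimage_singleton (μ := μ) (f := f) Finset.univ
        (fun _ _ => .of_discrete)
      rw [Finset.coe_univ, Set.preimage_univ, probReal_univ] at this
      exact this
    have : 1 - Fintype.card A * δ ≤
        ∑ a, min (μ.real {x | f x = a}) (ν.real {y | g y = a}) := by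
      calc 1 - Fintype.card A * δ = ∑ a, (μ.real {x | f x = a} - δ) := by
            rw [Finset.sum_sub_distrib, hsum]; simp
        _ ≤ _ := Finset.sum_le_sum fun a _ =>
            le_min (by linarith) (by linarith [h a])
    refine (ENNReal.ofReal_le_ofReal this).trans ?_
    rw [ENNReal.ofReal_sum_of_nonneg fun a _ => le_min measureReal_nonneg measureReal_nonneg]
    refine Finset.sum_le_sum fun a _ => le_min ?_ ?_
    · refine (ENNReal.ofReal_le_ofReal (min_le_left _ _)).trans ?_
      simp
    · refine (ENNReal.ofReal_le_ofReal (min_le_right _ _)).trans ?_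
      simp
  · intro x hx
    simp only [Set.mem_iUnion] at hx
    obtain ⟨a, -, h1, h2⟩ := hx
    exact h1.trans (Eq.symm h2)

/-- For every `k`, the featured graphs with features in a totally bounded set fall into finitely
many classes such that any two members of a class are similar. -/
theorem exists_finite_types {F : Set (Fin d → ℝ)} (hF : TotallyBounded F) {ε η : ℝ} (hε : 0 < ε)
    (hη : 0 < η) (k m : ℕ) :
    ∃ (A : Type) (_ : Finite A) (τ : MRFG d m → A), ∀ G H : MRFG d m,
      (∀ w, G.feat w ∈ F) → (∀ w, H.feat w ∈ F) → τ G = τ H → Sim ε η k G H := by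
  classical
  induction k generalizing m with
  | zero =>
    obtain ⟨t, ht, hcov⟩ := Metric.totallyBounded_iff.1 hF (ε / 2) (by linarith)
    have htf : Finite t := ht.to_subtype
    -- The value `none` only serves features outside `F`, about which nothing is claimed.
    let cell : (Fin d → ℝ) → Option t := fun x =>
      if h : ∃ y : t, dist x y < ε / 2 then some h.choose else none
    refine ⟨(Fin m → Fin m → Prop × Prop) × (Fin m → Option t), inferInstance, fun G =>
      (fun i j => (G.root i = G.root j, G.graph.Adj (G.root i) (G.root j)),
        fun i => cell (G.feat (G.root i))), ?_⟩
    intro G H hG hH h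
    rw [Prod.ext_iff] at h
    refine ⟨fun i j => ?_, fun i => ?_⟩
    · have := congrFun (congrFun h.1 i) j
      simp only [Prod.mk.injEq] at this
      exact ⟨iff_of_eq this.1, iff_of_eq this.2⟩
    · have hi := congrFun h.2 i
      have hex : ∀ x ∈ F, ∃ y : t, dist x y < ε / 2 := fun x hx => by
        simpa using hcov hx
      have h1 := hex _ (hG (G.root i))
      have h2 := hex _ (hH (H.root i))
      simp only [cell, dif_pos h1, dif_pos h2, Option.some.injEq] at hi
      rw [← dist_eq_norm]
      refine (dist_triangle_right _ _ (h1.choose : Fin d → ℝ)).trans ?_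
      have a1 := h1.choose_spec
      have a2 := h2.choose_spec
      rw [← hi] at a2
      linarith
  | succ k ih =>
    obtain ⟨A, hA, τ, hτ⟩ := ih (m + 1)
    -- The type for `k + 1` records which types of one-vertex extensions occur and, for each root,
    -- whether it is isolated and the proportion of its neighbours of each type, rounded down to a
    -- multiple of `1 / M`. Equal records mean an error of at most `1 / M` per type, hence at most
    -- `card A / M ≤ η` in total.
    have := Fintype.ofFinite A
    obtain ⟨M, hM⟩ := exists_nat_gt (Fintype.card A / η)
    have hM0 : (0 : ℝ) < M := lt_of_le_of_lt (by positivity) hM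
    let pr : (G : MRFG d m) → Fin m → A → ℝ := fun G i a =>
      (uniformOn (G.graph.neighborSet (G.root i))).real {v | τ (G.addRoot v) = a}
    refine ⟨Set A × (Fin m → Prop × (A → Fin (M + 1))), inferInstance, fun G =>
      (Set.range fun p => τ (G.addRoot p), fun i => (G.graph.IsIsolated (G.root i),
        fun a => Fin.ofNat (M + 1) ⌊M * pr G i a⌋₊)), ?_⟩
    intro G H hG hH h
    rw [Prod.ext_iff] at h
    obtain ⟨hr, hi⟩ := h
    simp only at hr hi
    have key : ∀ p q, τ (G.addRoot p) = τ (H.addRoot q) →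
        Sim ε η k (G.addRoot p) (H.addRoot q) := fun p q h => hτ _ _ hG hH h
    refine ⟨⟨fun p => ?_, fun q => ?_⟩, fun i => ⟨?_, fun h1 h2 => ?_⟩⟩
    · obtain ⟨q, hq⟩ : τ (G.addRoot p) ∈ Set.range fun q => τ (H.addRoot q) := by
        rw [← hr]; exact ⟨p, rfl⟩
      exact ⟨q, key p q hq.symm⟩
    · obtain ⟨p, hp⟩ : τ (H.addRoot q) ∈ Set.range fun q => τ (G.addRoot q) := by
        rw [hr]; exact ⟨q, rfl⟩
      exact ⟨p, key p q hp⟩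
    · have := congrFun hi i
      simp only [Prod.mk.injEq] at this
      exact iff_of_eq this.1
    · have hb := congrFun hi i
      simp only [Prod.mk.injEq] at hb
      have hpG : IsProbabilityMeasure (uniformOn (G.graph.neighborSet (G.root i))) :=
        isProbabilityMeasure_uniformOn (Set.toFinite _) (by simpa using h1)
      have hpH : IsProbabilityMeasure (uniformOn (H.graph.neighborSet (H.root i))) :=
        isProbabilityMeasure_uniformOn (Set.toFinite _) (by simpa using h2)
      obtain ⟨γ, hγ, hle⟩ := exists_coupling_of_close
        (uniformOn (G.graph.neighborSet (G.root i))) (uniformOn (H.graph.neighborSet (H.root i)))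
        (fun v => τ (G.addRoot v)) (fun v => τ (H.addRoot v)) (1 / M) (by positivity) (by
          intro a
          change pr G i a ≤ pr H i a + 1 / M
          have hba := congrArg Fin.val (congrFun hb.2 a)
          -- Thus the reduction modulo `M + 1` in `Fin.ofNat` loses nothing.
          have hlt : ∀ (K : MRFG d m), pr K i a ≤ 1 → ⌊M * pr K i a⌋₊ < M + 1 := by
            intro K hK
            rw [Nat.lt_succ_iff]
            exact Nat.floor_le_of_le (by nlinarith)
          have hG1 : pr G i a ≤ 1 := measureReal_le_one
          have hH1 : pr H i a ≤ 1 := measureReal_le_one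
          simp only [Fin.ofNat, Nat.mod_eq_of_lt (hlt G hG1), Nat.mod_eq_of_lt (hlt H hH1)] at hba
          have f1 := Nat.lt_floor_add_one ((M : ℝ) * pr G i a)
          have f2 := Nat.floor_le (mul_nonneg hM0.le (measureReal_nonneg : 0 ≤ pr H i a))
          rw [hba] at f1
          have : pr G i a - pr H i a ≤ 1 / M := by
            rw [le_div_iff₀ hM0]; nlinarith
          linarith)
      refine ⟨γ, hγ, le_trans (ENNReal.ofReal_le_ofReal ?_) (hle.trans (measure_mono ?_))⟩
      · rw [div_lt_iff₀ hη] at hM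
        have : (Fintype.card A : ℝ) * (1 / M) ≤ η := by
          rw [mul_one_div, div_le_iff₀ hM0]; linarith
        linarith
      · rintro ⟨p, q⟩ hpq
        exact key p q hpq

end MRFG

/-! ### First and second moments of the number of events that occur -/

section Counting

variable {Ω ι : Type*} [Fintype ι]

open Classical in
/-- The number of events of the family `A` that contain `x`. -/
def eventCount (A : ι → Set Ω) (x : Ω) : ℕ := (Finset.univ.filter fun i => x ∈ A i).card

lemma eventCount_eq_sum (A : ι → Set Ω) (x : Ω) :
    (eventCount A x : ℝ) = ∑ i, (A i).indicator 1 x := by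
  classical
  simp [eventCount, Set.indicator_apply]

variable [MeasurableSpace Ω] (μ : Measure Ω) [IsProbabilityMeasure μ]

lemma integrable_indicator_one' {A : Set Ω} (hA : MeasurableSet A) :
    Integrable (A.indicator (1 : Ω → ℝ)) μ :=
  (integrable_const (1 : ℝ)).indicator hA

lemma integral_eventCount {A : ι → Set Ω} (hA : ∀ i, MeasurableSet (A i)) :
    ∫ x, (eventCount A x : ℝ) ∂μ = ∑ i, μ.real (A i) := by
  simp_rw [eventCount_eq_sum]
  rw [integral_finsetSum _ fun i _ => integrable_indicator_one' μ (hA i)]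
  simp [integral_indicator_one (hA _)]

lemma integral_eventCount_sq {A : ι → Set Ω} (hA : ∀ i, MeasurableSet (A i)) :
    ∫ x, (eventCount A x : ℝ) ^ 2 ∂μ = ∑ i, ∑ j, μ.real (A i ∩ A j) := by
  simp_rw [eventCount_eq_sum, sq, Finset.sum_mul_sum]
  have : ∀ i j x, (A i).indicator (1 : Ω → ℝ) x * (A j).indicator (1 : Ω → ℝ) x =
      (A i ∩ A j).indicator (1 : Ω → ℝ) x := fun i j x => by
    rw [Set.inter_indicator_one]; rfl
  simp_rw [this]
  rw [integral_finsetSum _ fun i _ => integrable_finsetSum _ fun j _ =>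
    integrable_indicator_one' μ ((hA i).inter (hA j))]
  refine Finset.sum_congr rfl fun i _ => ?_
  rw [integral_finsetSum _ fun j _ => integrable_indicator_one' μ ((hA i).inter (hA j))]
  simp [integral_indicator_one ((hA _).inter (hA _))]

lemma measurable_eventCount {A : ι → Set Ω} (hA : ∀ i, MeasurableSet (A i)) :
    Measurable fun x => (eventCount A x : ℝ) := by
  simp_rw [eventCount_eq_sum]
  exact Finset.measurable_sum _ fun i _ => measurable_one.indicator (hA i)

lemma memLp_eventCount {A : ι → Set Ω} (hA : ∀ i, MeasurableSet (A i)) :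
    MemLp (fun x => (eventCount A x : ℝ)) 2 μ := by
  refine MemLp.of_bound (measurable_eventCount hA).aestronglyMeasurable (Fintype.card ι)
    (ae_of_all _ fun x => ?_)
  simpa [eventCount] using Finset.card_le_univ _

lemma measureReal_eventCount_ge_le {A : ι → Set Ω} (hA : ∀ i, MeasurableSet (A i)) {t : ℝ}
    (ht : 0 < t) : μ.real {x | t ≤ eventCount A x} ≤ (∑ i, μ.real (A i)) / t := by
  rw [le_div_iff₀ ht, mul_comm, ← integral_eventCount μ hA]
  exact mul_meas_ge_le_integral_of_nonneg (ae_of_all _ fun x => Nat.cast_nonneg _)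
    ((memLp_eventCount μ hA).integrable (by norm_num)) t

/-- The second moment method. -/
lemma measureReal_eventCount_le_le {A : ι → Set Ω} (hA : ∀ i, MeasurableSet (A i)) {s : ℝ}
    (hs : 0 < s) : μ.real {x | (eventCount A x : ℝ) ≤ (∑ i, μ.real (A i)) - s} ≤
      ((∑ i, ∑ j, μ.real (A i ∩ A j)) - (∑ i, μ.real (A i)) ^ 2) / s ^ 2 := by
  have h := meas_ge_le_variance_div_sq (μ := μ) (memLp_eventCount μ hA) hs
  rw [variance_eq_sub (memLp_eventCount μ hA)] at h
  simp only [Pi.pow_apply, integral_eventCount μ hA, integral_eventCount_sq μ hA] at h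
  have h0 : 0 ≤ ((∑ i, ∑ j, μ.real (A i ∩ A j)) - (∑ i, μ.real (A i)) ^ 2) / s ^ 2 := by
    have := variance_nonneg (fun x => (eventCount A x : ℝ)) μ
    rw [variance_eq_sub (memLp_eventCount μ hA)] at this
    simp only [Pi.pow_apply, integral_eventCount μ hA, integral_eventCount_sq μ hA] at this
    positivity
  refine le_trans (measureReal_mono ?_) (ENNReal.toReal_le_of_le_ofReal h0 h)
  intro x hx
  simp only [Set.mem_ofPred_eq] at hx ⊢
  rw [abs_sub_comm]
  exact le_trans (by linarith) (le_abs_self _)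

end Counting

/-! ### Trails: short distances, short cycles and large degrees -/

/-- Prescribing the status of every pair isolates a single graph, and there are finitely many
graphs. Every graph property is therefore measurable. -/
instance {V : Type*} [Finite V] : DiscreteMeasurableSpace (SimpleGraph V) := by
  classical
  cases nonempty_fintype V
  have : MeasurableSingletonClass (SimpleGraph V) := ⟨fun G => by
    have h := measurableSet_edges (Finset.univ.filter fun e => e ∈ G.edgeSet)
      (Finset.univ.filter fun e => e ∉ G.edgeSet)
    convert h using 1
    ext H
    simp only [Set.mem_singleton_iff, Finset.mem_filter, Finset.mem_univ, true_and,
      Set.mem_ofPred_eq]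
    constructor
    · rintro rfl
      exact ⟨fun _ h => h, fun _ h => h⟩
    · rintro ⟨h1, h2⟩
      rw [← SimpleGraph.edgeSet_inj]
      ext e
      exact ⟨fun h => by_contra fun h' => h2 e h' h, h1 e⟩⟩
  infer_instance

lemma SimpleGraph.Walk.edges_eq_ofFn {V : Type*} {G : SimpleGraph V} {u v : V} (p : G.Walk u v) :
    p.edges = List.ofFn fun i : Fin p.length => s(p.getVert i, p.getVert (i + 1)) := by
  induction p with
  | nil => simp
  | cons h p ih =>
    simp only [SimpleGraph.Walk.edges_cons, SimpleGraph.Walk.length_cons, List.ofFn_succ, ih]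
    simp

section Trails

variable {V : Type*} [DecidableEq V]

/-- The edges traversed by a sequence of vertices. -/
def trailEdges {l : ℕ} (f : Fin (l + 1) → V) : Finset (Sym2 V) :=
  Finset.univ.image fun i : Fin l => s(f i.castSucc, f i.succ)

/-- Trails cover paths and cycles alike. Their edges are distinct, so a given vertex sequence is a
trail with probability at most `p ^ l`. -/
lemma SimpleGraph.Walk.IsTrail.exists_trailEdges {G : SimpleGraph V} {u v : V} {p : G.Walk u v}
    (hp : p.IsTrail) : ∃ f : Fin (p.length + 1) → V, f 0 = u ∧ f (Fin.last _) = v ∧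
      (trailEdges f).card = p.length ∧ ∀ e ∈ trailEdges f, e ∈ G.edgeSet := by
  have hnd := hp.edges_nodup
  rw [p.edges_eq_ofFn, List.nodup_ofFn] at hnd
  refine ⟨fun i => p.getVert i, by simp, by simp, ?_, ?_⟩
  · rw [trailEdges, Finset.card_image_of_injective]
    · simp
    · intro i j hij
      exact hnd (by simpa using hij)
  · intro e he
    simp only [trailEdges, Finset.mem_image, Finset.mem_univ, true_and] at he
    obtain ⟨i, rfl⟩ := he
    exact p.adj_getVert_succ i.2

variable [Fintype V] (p : unitInterval)

lemma binomialRandom_real_trail_le {l : ℕ} (f : Fin (l + 1) → V) :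
    (SimpleGraph.binomialRandom V p).real
      {G | (trailEdges f).card = l ∧ ∀ e ∈ trailEdges f, e ∈ G.edgeSet} ≤ (p : ℝ) ^ l := by
  by_cases h : (trailEdges f).card = l ∧ ∀ e ∈ trailEdges f, ¬ e.IsDiag
  · refine (measureReal_mono ?_).trans ((binomialRandom_real_edges_le p (trailEdges f) ∅ h.2
      (by simp)).trans (by simp [h.1]))
    intro G hG
    exact ⟨hG.2, by simp⟩
  · have : {G : SimpleGraph V | (trailEdges f).card = l ∧ ∀ e ∈ trailEdges f, e ∈ G.edgeSet}
        = ∅ := by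
      ext G
      simp only [Set.mem_ofPred_eq, Set.mem_empty_iff_false, iff_false]
      exact fun hG => h ⟨hG.1, fun e he => G.not_isDiag_of_mem_edgeSet (hG.2 e he)⟩
    rw [this, measureReal_empty]
    exact pow_nonneg p.2.1 _

lemma binomialRandom_real_exists_trail_le (s : Finset ℕ)
    (Q : (l : ℕ) → (Fin (l + 1) → V) → Prop) [∀ l, DecidablePred (Q l)] :
    (SimpleGraph.binomialRandom V p).real
      {G | ∃ l ∈ s, ∃ f, Q l f ∧ (trailEdges f).card = l ∧ ∀ e ∈ trailEdges f, e ∈ G.edgeSet} ≤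
      ∑ l ∈ s, ((Finset.univ.filter (Q l)).card : ℝ) * (p : ℝ) ^ l := by
  have : {G : SimpleGraph V | ∃ l ∈ s, ∃ f, Q l f ∧ (trailEdges f).card = l ∧
      ∀ e ∈ trailEdges f, e ∈ G.edgeSet} ⊆ ⋃ l ∈ s, ⋃ f ∈ Finset.univ.filter (Q l),
        {G | (trailEdges f).card = l ∧ ∀ e ∈ trailEdges f, e ∈ G.edgeSet} := by
    rintro G ⟨l, hl, f, hf, h⟩
    simp only [Set.mem_iUnion]
    exact ⟨l, hl, f, by simpa using hf, h⟩
  refine (measureReal_mono this (measure_ne_top _ _)).trans ((measureReal_biUnion_finset_le _ _).trans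
    (Finset.sum_le_sum fun l _ => (measureReal_biUnion_finset_le _ _).trans ?_))
  refine (Finset.sum_le_sum fun f _ => binomialRandom_real_trail_le p f).trans ?_
  simp

/-- The expected number of pairs of vertices at distance at most `R`. -/
lemma sum_binomialRandom_edist_le (R : ℕ) :
    ∑ x : V × V, (SimpleGraph.binomialRandom V p).real {G | G.edist x.1 x.2 ≤ R} ≤
      ∑ l ∈ Finset.range (R + 1), (Fintype.card V : ℝ) ^ (l + 1) * (p : ℝ) ^ l := by
  have h : ∀ x : V × V, (SimpleGraph.binomialRandom V p).real {G | G.edist x.1 x.2 ≤ R} ≤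
      ∑ l ∈ Finset.range (R + 1), ((Finset.univ.filter fun f : Fin (l + 1) → V =>
        (f 0, f (Fin.last _)) = x).card : ℝ) * (p : ℝ) ^ l := by
    intro x
    refine le_trans (measureReal_mono ?_) (binomialRandom_real_exists_trail_le p
      (Finset.range (R + 1)) fun l (f : Fin (l + 1) → V) => (f 0, f (Fin.last _)) = x)
    intro G hG
    simp only [Set.mem_ofPred_eq] at hG
    obtain ⟨w, hw⟩ := SimpleGraph.exists_walk_of_edist_ne_top
      (ne_top_of_le_ne_top (ENat.natCast_ne_top R) hG)
    have hl : w.bypass.length ≤ R := by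
      rw [← hw] at hG
      exact w.length_bypass_le_length.trans (by exact_mod_cast hG)
    obtain ⟨f, h0, h1, h2⟩ := w.bypass_isPath.isTrail.exists_trailEdges
    exact ⟨_, by simpa [Nat.lt_succ_iff] using hl, f, by simp [h0, h1], h2⟩
  refine (Finset.sum_le_sum fun x _ => h x).trans (le_of_eq ?_)
  rw [Finset.sum_comm]
  refine Finset.sum_congr rfl fun l _ => ?_
  rw [← Finset.sum_mul]
  congr 1
  have := Finset.card_eq_sum_card_fiberwise (s := (Finset.univ : Finset (Fin (l + 1) → V)))
    (f := fun f => (f 0, f (Fin.last _))) (t := Finset.univ) (by simp)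
  rw [← Nat.cast_sum, ← this]
  simp

/-- The expected number of vertices on cycles of length at most `L`. -/
lemma sum_binomialRandom_cycle_le (L : ℕ) :
    ∑ v : V, (SimpleGraph.binomialRandom V p).real
      {G | ∃ w : G.Walk v v, w.IsCycle ∧ w.length ≤ L} ≤
      ∑ l ∈ Finset.Icc 1 L, (Fintype.card V : ℝ) ^ l * (p : ℝ) ^ l := by
  have h : ∀ v : V, (SimpleGraph.binomialRandom V p).real
      {G | ∃ w : G.Walk v v, w.IsCycle ∧ w.length ≤ L} ≤
      ∑ l ∈ Finset.Icc 1 L, ((Finset.univ.filter fun f : Fin (l + 1) → V =>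
        f 0 = f (Fin.last _) ∧ f 0 = v).card : ℝ) * (p : ℝ) ^ l := by
    intro v
    refine le_trans (measureReal_mono ?_) (binomialRandom_real_exists_trail_le p
      (Finset.Icc 1 L) fun l (f : Fin (l + 1) → V) => f 0 = f (Fin.last _) ∧ f 0 = v)
    rintro G ⟨w, hw, hl⟩
    obtain ⟨f, h0, h1, h2⟩ := hw.isTrail.exists_trailEdges
    have := hw.three_le_length
    exact ⟨_, by simp; omega, f, by simp [h0, h1], h2⟩
  refine (Finset.sum_le_sum fun x _ => h x).trans ?_
  rw [Finset.sum_comm]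
  refine Finset.sum_le_sum fun l hl => ?_
  rw [← Finset.sum_mul]
  refine mul_le_mul_of_nonneg_right ?_ (pow_nonneg p.2.1 _)
  obtain ⟨l, rfl⟩ : ∃ l', l = l' + 1 := ⟨l - 1, by simp at hl; omega⟩
  have := Finset.card_eq_sum_card_fiberwise (s := (Finset.univ.filter
    fun f : Fin (l + 1 + 1) → V => f 0 = f (Fin.last _)))
    (f := fun f => f 0) (t := Finset.univ) (by simp)
  simp only [Finset.filter_filter] at this
  rw [← Nat.cast_sum, ← this]
  -- A closed sequence is determined by its tail, which saves one factor `|V|` compared with open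
  -- sequences.
  have hinj := Finset.card_le_card_of_injOn (s := (Finset.univ.filter
    fun f : Fin (l + 1 + 1) → V => f 0 = f (Fin.last _)))
    (t := (Finset.univ : Finset (Fin (l + 1) → V))) (fun f => Fin.tail f) (by simp) (by
      intro f hf g hg hfg
      simp only [Finset.coe_filter, Finset.mem_univ, true_and, Set.mem_ofPred_eq] at hf hg
      have ht : ∀ i, f (Fin.succ i) = g (Fin.succ i) := fun i => congrFun hfg i
      funext i
      refine Fin.cases ?_ ht i
      rw [hf, hg]
      exact ht (Fin.last l))
  calc _ ≤ (((Finset.univ : Finset (Fin (l + 1) → V)).card : ℕ) : ℝ) := by exact_mod_cast hinj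
    _ = _ := by simp

/-- A bound for the probability that some vertex has degree at least `D`. -/
lemma binomialRandom_real_degree_ge_le (D : ℕ) :
    (SimpleGraph.binomialRandom V p).real {G | ∃ v, D ≤ (G.neighborSet v).ncard} ≤
      Fintype.card V * ((Fintype.card V).choose D * (p : ℝ) ^ D) := by
  classical
  have hsub : {G : SimpleGraph V | ∃ v, D ≤ (G.neighborSet v).ncard} ⊆
      ⋃ v ∈ (Finset.univ : Finset V), ⋃ S ∈ Finset.powersetCard D (Finset.univ : Finset V),
        {G | v ∉ S ∧ ∀ w ∈ S, s(v, w) ∈ G.edgeSet} := by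
    rintro G ⟨v, hv⟩
    rw [Set.ncard_eq_toFinset_card'] at hv
    obtain ⟨S, hS, hc⟩ := Finset.exists_subset_card_eq hv
    simp only [Set.mem_iUnion]
    refine ⟨v, Finset.mem_univ _, S, by simp [hc], fun h => ?_, fun w hw => ?_⟩
    · simpa using hS h
    · simpa using hS hw
  refine (measureReal_mono hsub (measure_ne_top _ _)).trans ((measureReal_biUnion_finset_le _ _).trans
    ((Finset.sum_le_card_nsmul _ _ ((Fintype.card V).choose D * (p : ℝ) ^ D) fun v _ => ?_).trans
      (by simp)))
  refine (measureReal_biUnion_finset_le _ _).trans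
    ((Finset.sum_le_card_nsmul _ _ ((p : ℝ) ^ D) fun S hS => ?_).trans (by simp))
  by_cases hv : v ∈ S
  · have : {G : SimpleGraph V | v ∉ S ∧ ∀ w ∈ S, s(v, w) ∈ G.edgeSet} = ∅ := by
      ext G; simp [hv]
    rw [this, measureReal_empty]
    exact pow_nonneg p.2.1 _
  · have hc : (S.image fun w => s(v, w)).card = D := by
      rw [Finset.card_image_of_injective _ (fun a b h => Sym2.congr_right.1 h)]
      exact (Finset.mem_powersetCard.1 hS).2
    refine (measureReal_mono ?_).trans ((binomialRandom_real_edges_le p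
      (S.image fun w => s(v, w)) ∅ ?_ (by simp)).trans (by simp [hc]))
    · rintro G ⟨-, hG⟩
      exact ⟨by simpa using hG, by simp⟩
    · intro e he
      obtain ⟨w, hw, rfl⟩ := Finset.mem_image.1 he
      simp only [Sym2.mk_isDiag_iff]
      rintro rfl
      exact hv hw

end Trails

/-! ### Embeddings of a rooted tree as a ball -/

section BallEmb

variable {W V : Type*} (H : SimpleGraph W) (ρ : W) (r : ℕ)

/-- `φ` is an isomorphism of `H`, rooted at `ρ` and of height at most `r`, onto the ball of radius
`r` around `φ ρ`. -/
def IsBallEmb (G : SimpleGraph V) (φ : W → V) : Prop :=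
  Function.Injective φ ∧ (∀ w w', G.Adj (φ w) (φ w') ↔ H.Adj w w') ∧
    ∀ w, H.dist ρ w < r → ∀ x, G.Adj (φ w) x → x ∈ Set.range φ

variable {H ρ r}

/-- A walk of length at most `r` from `φ ρ` cannot leave the image: every vertex it leaves has depth
below `r`, and all neighbours of such a vertex lie in the image. -/
lemma IsBallEmb.setOf_edist_le {G : SimpleGraph V} {φ : W → V} (h : IsBallEmb H ρ r G φ)
    (hc : H.Connected) (hr : ∀ w, H.dist ρ w ≤ r) :
    {x | G.edist (φ ρ) x ≤ r} = Set.range φ := by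
  obtain ⟨-, hadj, hext⟩ := h
  ext x
  simp only [Set.mem_ofPred_eq]
  constructor
  · intro hx
    have key : ∀ {x y : V} (p : G.Walk x y), y = φ ρ → p.length ≤ r →
        ∃ w, φ w = x ∧ H.dist ρ w ≤ p.length := by
      intro x y p
      induction p with
      | nil => exact fun h _ => ⟨ρ, h.symm, by simp⟩
      | @cons x y z hxy p ih =>
        intro hz hl
        rw [SimpleGraph.Walk.length_cons] at hl
        obtain ⟨w, rfl, hw⟩ := ih hz (by omega)
        obtain ⟨w', rfl⟩ := hext w (by omega) _ hxy.symm
        refine ⟨w', rfl, ?_⟩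
        have h1 := hc.dist_triangle (u := ρ) (v := w) (w := w')
        have h2 : H.dist w w' = 1 := SimpleGraph.dist_eq_one_iff_adj.2 ((hadj _ _).1 hxy.symm)
        rw [SimpleGraph.Walk.length_cons]
        omega
    obtain ⟨p, hp⟩ := SimpleGraph.exists_walk_of_edist_ne_top
      (ne_top_of_le_ne_top (ENat.natCast_ne_top r) hx)
    rw [← hp] at hx
    obtain ⟨w, hw, -⟩ := key p.reverse rfl (by simpa using hx)
    exact ⟨w, hw⟩
  · rintro ⟨w, rfl⟩
    obtain ⟨p, hp⟩ := hc.exists_walk_length_eq_dist ρ w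
    let f : H →g G := ⟨φ, fun {a b} hab => (hadj a b).2 hab⟩
    refine (SimpleGraph.edist_le (p.map f)).trans ?_
    rw [SimpleGraph.Walk.length_map, hp]
    exact_mod_cast hr w

/-- Ball embeddings with the same root image have the same range, namely the ball, so they differ by
a self-map of `W`. -/
lemma IsBallEmb.card_le [Fintype W] [Fintype V] {G : SimpleGraph V} (hc : H.Connected)
    (hr : ∀ w, H.dist ρ w ≤ r) (v : V) (s : Finset (W → V))
    (hs : ∀ φ ∈ s, IsBallEmb H ρ r G φ ∧ φ ρ = v) :
    s.card ≤ Fintype.card W ^ Fintype.card W := by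
  classical
  rcases s.eq_empty_or_nonempty with rfl | ⟨φ₀, hφ₀⟩
  · simp
  have hran : ∀ φ ∈ s, Set.range φ = {x | G.edist v x ≤ r} := fun φ hφ => by
    rw [← (hs φ hφ).2, (hs φ hφ).1.setOf_edist_le hc hr]
  have hsub : s ⊆ Finset.univ.image fun σ : W → W => φ₀ ∘ σ := by
    intro φ hφ
    have h : ∀ w, ∃ w', φ₀ w' = φ w := fun w => by
      have : φ w ∈ Set.range φ₀ := by rw [hran φ₀ hφ₀, ← hran φ hφ]; exact ⟨w, rfl⟩
      exact this
    choose σ hσ using h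
    exact Finset.mem_image.2 ⟨σ, Finset.mem_univ _, funext hσ⟩
  calc s.card ≤ _ := Finset.card_le_card hsub
    _ ≤ _ := Finset.card_image_le
    _ = _ := by simp

lemma IsBallEmb.edist_le_of_not_disjoint {G : SimpleGraph V} {φ φ' : W → V}
    (h : IsBallEmb H ρ r G φ) (h' : IsBallEmb H ρ r G φ') (hc : H.Connected)
    (hr : ∀ w, H.dist ρ w ≤ r) (hd : ¬ Disjoint (Set.range φ) (Set.range φ')) :
    G.edist (φ ρ) (φ' ρ) ≤ (2 * r : ℕ) := by
  obtain ⟨x, hx, hx'⟩ := Set.not_disjoint_iff.1 hd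
  rw [← h.setOf_edist_le hc hr] at hx
  rw [← h'.setOf_edist_le hc hr] at hx'
  simp only [Set.mem_ofPred_eq] at hx hx'
  rw [SimpleGraph.edist_comm] at hx'
  calc _ ≤ _ := SimpleGraph.edist_triangle (v := x)
    _ ≤ (r : ℕ∞) + r := add_le_add hx hx'
    _ = _ := by push_cast; ring

variable (H ρ r) [Fintype W]

open Classical in
/-- The pairs that have to be edges if `φ` is a ball embedding. -/
def embEdges (φ : W → V) : Finset (Sym2 V) := H.edgeFinset.image (Sym2.map φ)

variable {H ρ r}

lemma mem_embEdges {φ : W → V} {e : Sym2 V} :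
    e ∈ embEdges H φ ↔ ∃ w w', H.Adj w w' ∧ s(φ w, φ w') = e := by
  classical
  simp only [embEdges, Finset.mem_image, SimpleGraph.mem_edgeFinset]
  constructor
  · rintro ⟨e, he, rfl⟩
    induction e with
    | _ w w' => exact ⟨w, w', he, rfl⟩
  · rintro ⟨w, w', h, rfl⟩
    exact ⟨s(w, w'), h, rfl⟩

lemma not_isDiag_of_mem_embEdges {φ : W → V} (hφ : Function.Injective φ) {e : Sym2 V}
    (he : e ∈ embEdges H φ) : ¬ e.IsDiag := by
  obtain ⟨w, w', h, rfl⟩ := mem_embEdges.1 he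
  simpa [hφ.eq_iff] using h.ne

lemma card_embEdges {φ : W → V} (hφ : Function.Injective φ) (hH : H.IsTree) :
    (embEdges H φ).card = Fintype.card W - 1 := by
  classical
  rw [embEdges, Finset.card_image_of_injective _ (Sym2.map.injective hφ), ← hH.card_edgeFinset]
  simp

lemma embEdges_disjoint {φ φ' : W → V} (hd : Disjoint (Set.range φ) (Set.range φ')) :
    Disjoint (embEdges H φ) (embEdges H φ') := by
  rw [Finset.disjoint_left]
  intro e he he'
  obtain ⟨a, b, -, rfl⟩ := mem_embEdges.1 he
  obtain ⟨a', b', -, h⟩ := mem_embEdges.1 he'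
  rw [Sym2.eq_iff] at h
  rcases h with ⟨h, -⟩ | ⟨h, -⟩ <;>
  exact Set.disjoint_left.1 hd ⟨_, rfl⟩ ⟨_, h⟩

variable (H ρ r) [Fintype V]

open Classical in
/-- The pairs that must not be edges if `φ` is a ball embedding. -/
def embNonEdges (φ : W → V) : Finset (Sym2 V) :=
  Finset.univ.filter fun e => ¬ e.IsDiag ∧ e ∉ embEdges H φ ∧
    ((∃ w w', e = s(φ w, φ w')) ∨ ∃ w, H.dist ρ w < r ∧ φ w ∈ e)

variable {H ρ r}

lemma mem_embNonEdges {φ : W → V} {e : Sym2 V} :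
    e ∈ embNonEdges H ρ r φ ↔ ¬ e.IsDiag ∧ e ∉ embEdges H φ ∧
      ((∃ w w', e = s(φ w, φ w')) ∨ ∃ w, H.dist ρ w < r ∧ φ w ∈ e) := by
  classical
  simp [embNonEdges]

lemma exists_mem_of_mem_embNonEdges {φ : W → V} {e : Sym2 V} (he : e ∈ embNonEdges H ρ r φ) :
    ∃ w, φ w ∈ e := by
  rcases (mem_embNonEdges.1 he).2.2 with ⟨w, w', rfl⟩ | ⟨w, -, h⟩
  · exact ⟨w, by simp⟩
  · exact ⟨w, h⟩

/-- This reduces a ball embedding to prescribed edges and non-edges, whose probability is explicit.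
-/
lemma isBallEmb_iff {G : SimpleGraph V} {φ : W → V} (hφ : Function.Injective φ) :
    IsBallEmb H ρ r G φ ↔
      (∀ e ∈ embEdges H φ, e ∈ G.edgeSet) ∧ ∀ e ∈ embNonEdges H ρ r φ, e ∉ G.edgeSet := by
  constructor
  · rintro ⟨-, hadj, hext⟩
    refine ⟨fun e he => ?_, fun e he heG => ?_⟩
    · obtain ⟨w, w', h, rfl⟩ := mem_embEdges.1 he
      exact (hadj _ _).2 h
    · obtain ⟨-, hE, h⟩ := mem_embNonEdges.1 he
      rcases h with ⟨w, w', rfl⟩ | ⟨w, hw, hwe⟩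
      · exact hE (mem_embEdges.2 ⟨w, w', (hadj _ _).1 heG, rfl⟩)
      · obtain ⟨x, rfl⟩ := Sym2.mem_iff_exists.1 hwe
        obtain ⟨w', rfl⟩ := hext w hw x heG
        exact hE (mem_embEdges.2 ⟨w, w', (hadj _ _).1 heG, rfl⟩)
  · rintro ⟨h1, h2⟩
    have key : ∀ w x, G.Adj (φ w) x → (x ∈ Set.range φ ∨ H.dist ρ w < r) →
        ∃ w', φ w' = x ∧ H.Adj w w' := by
      intro w x hx hor
      have hE : s(φ w, x) ∈ embEdges H φ := by
        by_contra hE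
        refine h2 _ (mem_embNonEdges.2 ⟨by simpa using hx.ne, hE, ?_⟩) hx
        rcases hor with ⟨w', rfl⟩ | hw
        · exact Or.inl ⟨w, w', rfl⟩
        · exact Or.inr ⟨w, hw, by simp⟩
      obtain ⟨a, b, hab, h⟩ := mem_embEdges.1 hE
      rw [Sym2.eq_iff] at h
      rcases h with ⟨ha, hb⟩ | ⟨ha, hb⟩
      · exact ⟨b, hb, hφ ha ▸ hab⟩
      · exact ⟨a, ha, hφ hb ▸ hab.symm⟩
    refine ⟨hφ, fun w w' => ⟨fun h => ?_, fun h => ?_⟩, fun w hw x hx => ?_⟩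
    · obtain ⟨a, ha, hwa⟩ := key w _ h (Or.inl ⟨w', rfl⟩)
      rwa [← hφ ha]
    · exact h1 _ (mem_embEdges.2 ⟨w, w', h, rfl⟩)
    · obtain ⟨a, ha, -⟩ := key w x hx (Or.inr hw)
      exact ⟨a, ha⟩

lemma card_embNonEdges_le (φ : W → V) :
    (embNonEdges H ρ r φ).card ≤
      {w | H.dist ρ w < r}.ncard * Fintype.card V + Fintype.card W ^ 2 := by
  classical
  have hsub : embNonEdges H ρ r φ ⊆
      ((Finset.univ.filter fun w => H.dist ρ w < r) ×ˢ (Finset.univ : Finset V)).image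
        (fun x => s(φ x.1, x.2)) ∪
      (Finset.univ : Finset (W × W)).image fun x => s(φ x.1, φ x.2) := by
    intro e he
    obtain ⟨-, -, h⟩ := mem_embNonEdges.1 he
    rcases h with ⟨w, w', rfl⟩ | ⟨w, hw, hwe⟩
    · exact Finset.mem_union_right _ (Finset.mem_image.2 ⟨(w, w'), by simp, rfl⟩)
    · obtain ⟨x, rfl⟩ := Sym2.mem_iff_exists.1 hwe
      exact Finset.mem_union_left _ (Finset.mem_image.2 ⟨(w, x), by simpa using hw, rfl⟩)
  refine (Finset.card_le_card hsub).trans ((Finset.card_union_le _ _).trans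
    (add_le_add (Finset.card_image_le.trans ?_) (Finset.card_image_le.trans ?_)))
  · rw [Finset.card_product, Set.ncard_eq_toFinset_card']
    simp
  · simp [sq]

-- A pair forbidden by both embeddings meets both images, so it joins a vertex of one to a vertex of
-- the other. The bound does not depend on `V`.
open Classical in
lemma card_embNonEdges_inter_le {φ φ' : W → V} (hd : Disjoint (Set.range φ) (Set.range φ')) :
    (embNonEdges H ρ r φ ∩ embNonEdges H ρ r φ').card ≤ Fintype.card W ^ 2 := by
  have hsub : embNonEdges H ρ r φ ∩ embNonEdges H ρ r φ' ⊆
      (Finset.univ : Finset (W × W)).image fun x => s(φ x.1, φ' x.2) := by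
    intro e he
    rw [Finset.mem_inter] at he
    obtain ⟨w, hw⟩ := exists_mem_of_mem_embNonEdges he.1
    obtain ⟨w', hw'⟩ := exists_mem_of_mem_embNonEdges he.2
    refine Finset.mem_image.2 ⟨(w, w'), by simp, ?_⟩
    refine ((Sym2.mem_and_mem_iff fun h => ?_).1 ⟨hw, hw'⟩).symm
    exact Set.disjoint_left.1 hd ⟨w, rfl⟩ ⟨w', h.symm⟩
  refine (Finset.card_le_card hsub).trans (Finset.card_image_le.trans ?_)
  simp [sq]

variable (p : unitInterval)

lemma binomialRandom_real_isBallEmb (hH : H.IsTree) {φ : W → V} (hφ : Function.Injective φ) :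
    (SimpleGraph.binomialRandom V p).real {G | IsBallEmb H ρ r G φ} =
      (p : ℝ) ^ (Fintype.card W - 1) * (1 - p : ℝ) ^ (embNonEdges H ρ r φ).card := by
  classical
  simp_rw [isBallEmb_iff hφ]
  rw [binomialRandom_real_edges p _ _ (fun e he => not_isDiag_of_mem_embEdges hφ he) ?_
    (fun e he => (mem_embNonEdges.1 he).1), card_embEdges hφ hH]
  exact Finset.disjoint_right.2 fun e he => (mem_embNonEdges.1 he).2.1

/-- The required edges of the two embeddings are disjoint. Only the shared forbidden pairs, at most
`|W| ^ 2` of them, are counted twice in the product of the probabilities, and the factor on the left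
compensates for them. It tends to `1` as `p` tends to `0`. -/
lemma binomialRandom_real_isBallEmb_and_le (hH : H.IsTree) {φ φ' : W → V}
    (hφ : Function.Injective φ) (hφ' : Function.Injective φ')
    (hd : Disjoint (Set.range φ) (Set.range φ')) :
    (SimpleGraph.binomialRandom V p).real {G | IsBallEmb H ρ r G φ ∧ IsBallEmb H ρ r G φ'} *
      (1 - p : ℝ) ^ (Fintype.card W ^ 2) ≤
      (SimpleGraph.binomialRandom V p).real {G | IsBallEmb H ρ r G φ} *
        (SimpleGraph.binomialRandom V p).real {G | IsBallEmb H ρ r G φ'} := by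
  classical
  have h0 : (0 : ℝ) ≤ 1 - p := by linarith [p.2.2]
  have h1 : (1 - p : ℝ) ≤ 1 := by linarith [p.2.1]
  have hp0 : (0 : ℝ) ≤ p := p.2.1
  rw [binomialRandom_real_isBallEmb p hH hφ, binomialRandom_real_isBallEmb p hH hφ']
  simp_rw [isBallEmb_iff hφ, isBallEmb_iff hφ']
  have hle : (SimpleGraph.binomialRandom V p).real {G |
      ((∀ e ∈ embEdges H φ, e ∈ G.edgeSet) ∧ ∀ e ∈ embNonEdges H ρ r φ, e ∉ G.edgeSet) ∧
      ((∀ e ∈ embEdges H φ', e ∈ G.edgeSet) ∧ ∀ e ∈ embNonEdges H ρ r φ', e ∉ G.edgeSet)} ≤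
      (p : ℝ) ^ (embEdges H φ ∪ embEdges H φ').card *
        (1 - p : ℝ) ^ (embNonEdges H ρ r φ ∪ embNonEdges H ρ r φ').card := by
    refine (measureReal_mono ?_).trans (binomialRandom_real_edges_le p
      (embEdges H φ ∪ embEdges H φ') (embNonEdges H ρ r φ ∪ embNonEdges H ρ r φ') ?_ ?_)
    · refine fun G hG => ⟨fun e he => ?_, fun e he => ?_⟩
      · rcases Finset.mem_union.1 he with he | he
        exacts [hG.1.1 e he, hG.2.1 e he]
      · rcases Finset.mem_union.1 he with he | he
        exacts [hG.1.2 e he, hG.2.2 e he]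
    · intro e he
      rcases Finset.mem_union.1 he with he | he
      exacts [not_isDiag_of_mem_embEdges hφ he, not_isDiag_of_mem_embEdges hφ' he]
    · intro e he
      rcases Finset.mem_union.1 he with he | he
      exacts [(mem_embNonEdges.1 he).1, (mem_embNonEdges.1 he).1]
  refine (mul_le_mul_of_nonneg_right hle (pow_nonneg h0 _)).trans ?_
  rw [Finset.card_union_of_disjoint (embEdges_disjoint hd), card_embEdges hφ hH,
    card_embEdges hφ' hH, mul_assoc, ← pow_add, pow_add, mul_mul_mul_comm, ← pow_add (1 - p : ℝ)]
  refine mul_le_mul_of_nonneg_left (pow_le_pow_of_le_one h0 h1 ?_) (by positivity)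
  rw [← Finset.card_union_add_card_inter]
  exact Nat.add_le_add_left (card_embNonEdges_inter_le hd) _

end BallEmb

/-- Double counting: at each point of `B` at most `K` of the indicators are nonzero. This replaces
sums over embeddings by sums over their root images. -/
lemma sum_measureReal_inter_le {Ω ι : Type*} [MeasurableSpace Ω] (μ : Measure Ω)
    [IsProbabilityMeasure μ] (s : Finset ι) {A : ι → Set Ω} {B : Set Ω}
    (hA : ∀ i, MeasurableSet (A i)) (hB : MeasurableSet B) (K : ℕ)
    (hK : ∀ x, ∀ t ⊆ s, (∀ i ∈ t, x ∈ A i) → t.card ≤ K) :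
    ∑ i ∈ s, μ.real (A i ∩ B) ≤ K * μ.real B := by
  classical
  have h1 : ∀ i, μ.real (A i ∩ B) = ∫ x, (A i ∩ B).indicator 1 x ∂μ := fun i =>
    (integral_indicator_one ((hA i).inter hB)).symm
  simp_rw [h1]
  rw [← integral_finsetSum _ fun i _ => integrable_indicator_one' μ ((hA i).inter hB),
    ← integral_indicator_one hB, ← integral_const_mul]
  refine integral_mono (integrable_finsetSum _ fun i _ =>
    integrable_indicator_one' μ ((hA i).inter hB))
    ((integrable_indicator_one' μ hB).const_mul _) fun x => ?_
  by_cases hx : x ∈ B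
  · simp only [Set.indicator_apply, Set.mem_inter_iff, hx, and_true, if_true, Pi.one_apply]
    rw [Finset.sum_boole, mul_one]
    exact_mod_cast hK x _ (Finset.filter_subset _ _) fun i hi => (Finset.mem_filter.1 hi).2
  · simp [hx]

/-! ### Featured ball embeddings and their second moment -/

section FeaturedBall

/-- The event that `φ` embeds `H` as a ball, with features in the prescribed cells. -/
def featBallEvent {W V X : Type*} (H : SimpleGraph W) (ρ : W) (r : ℕ) (C : W → Set X)
    (φ : W → V) : Set (SimpleGraph V × (V → X)) :=
  {x | IsBallEmb H ρ r x.1 φ ∧ ∀ w, x.2 (φ w) ∈ C w}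

lemma featBallEvent_eq_prod {W V X : Type*} {H : SimpleGraph W} {ρ : W} {r : ℕ} (C : W → Set X)
    (φ : W → V) : featBallEvent H ρ r C φ =
      {G | IsBallEmb H ρ r G φ} ×ˢ {χ : V → X | ∀ w, χ (φ w) ∈ C w} := rfl

variable {W V X : Type*} [Fintype W] [Fintype V] [MeasurableSpace X] {H : SimpleGraph W} {ρ : W}
  {r : ℕ}

lemma measurableSet_featBallEvent {C : W → Set X} (hC : ∀ w, MeasurableSet (C w)) (φ : W → V) :
    MeasurableSet (featBallEvent H ρ r C φ) := by
  rw [featBallEvent_eq_prod]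
  refine MeasurableSet.prod .of_discrete ?_
  have : {χ : V → X | ∀ w, χ (φ w) ∈ C w} = ⋂ w, {χ | χ (φ w) ∈ C w} := by ext; simp
  rw [this]
  exact MeasurableSet.iInter fun w => measurable_pi_apply (φ w) (hC w)

variable (p : unitInterval) (D : Measure X) [IsProbabilityMeasure D]

lemma real_featBallEvent (hH : H.IsTree) (C : W → Set X) {φ : W → V}
    (hφ : Function.Injective φ) :
    ((SimpleGraph.binomialRandom V p).prod (Measure.pi fun _ => D)).real
      (featBallEvent H ρ r C φ) =
      (p : ℝ) ^ (Fintype.card W - 1) * (1 - p : ℝ) ^ (embNonEdges H ρ r φ).card *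
        ∏ w, D.real (C w) := by
  rw [featBallEvent_eq_prod, measureReal_prod_prod, binomialRandom_real_isBallEmb p hH hφ,
    pi_real_forall_mem D φ hφ]

lemma real_featBallEvent_inter_le (hH : H.IsTree) (C : W → Set X) {φ φ' : W → V}
    (hφ : Function.Injective φ) (hφ' : Function.Injective φ')
    (hd : Disjoint (Set.range φ) (Set.range φ')) :
    ((SimpleGraph.binomialRandom V p).prod (Measure.pi fun _ => D)).real
        (featBallEvent H ρ r C φ ∩ featBallEvent H ρ r C φ') * (1 - p : ℝ) ^ (Fintype.card W ^ 2) ≤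
      ((SimpleGraph.binomialRandom V p).prod (Measure.pi fun _ => D)).real
        (featBallEvent H ρ r C φ) *
      ((SimpleGraph.binomialRandom V p).prod (Measure.pi fun _ => D)).real
        (featBallEvent H ρ r C φ') := by
  have hinter : featBallEvent H ρ r C φ ∩ featBallEvent H ρ r C φ' =
      {G | IsBallEmb H ρ r G φ ∧ IsBallEmb H ρ r G φ'} ×ˢ
        {χ : V → X | ∀ w : W ⊕ W, χ (Sum.elim φ φ' w) ∈ Sum.elim C C w} := by
    ext x
    simp only [featBallEvent, Set.mem_inter_iff, Set.mem_ofPred_eq, Set.mem_prod, Sum.forall,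
      Sum.elim_inl, Sum.elim_inr]
    tauto
  have hinj : Function.Injective (Sum.elim φ φ') := by
    refine hφ.sumElim hφ' fun a b h => ?_
    exact Set.disjoint_left.1 hd ⟨a, rfl⟩ ⟨b, h.symm⟩
  rw [hinter, featBallEvent_eq_prod, featBallEvent_eq_prod, measureReal_prod_prod,
    measureReal_prod_prod, measureReal_prod_prod, pi_real_forall_mem D _ hinj,
    pi_real_forall_mem D φ hφ, pi_real_forall_mem D φ' hφ', Fintype.prod_sum_type]
  simp only [Sum.elim_inl, Sum.elim_inr]
  have := binomialRandom_real_isBallEmb_and_le p (ρ := ρ) (r := r) hH hφ hφ' hd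
  have hP : 0 ≤ ∏ w, D.real (C w) := Finset.prod_nonneg fun _ _ => measureReal_nonneg
  nlinarith [mul_le_mul_of_nonneg_right this (mul_nonneg hP hP)]

/-- Pairs with disjoint images give the first summand, by near independence. If the images meet, the
roots are at distance at most `2 * r`. Grouped by the two root images, at most `K ^ 2` pairs of
embeddings occur at once, with `K = |W| ^ |W|`, so these pairs are controlled by the expected number
of close pairs of vertices. -/
lemma sum_real_featBallEvent_inter_le (hH : H.IsTree) (hr : ∀ w, H.dist ρ w ≤ r)
    {C : W → Set X} (hC : ∀ w, MeasurableSet (C w)) (Φ : Finset (W → V))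
    (hΦ : ∀ φ ∈ Φ, Function.Injective φ) (hp : (p : ℝ) < 1) :
    let μ := (SimpleGraph.binomialRandom V p).prod (Measure.pi fun _ : V => D)
    ∑ φ : Φ, ∑ φ' : Φ, μ.real (featBallEvent H ρ r C φ.1 ∩ featBallEvent H ρ r C φ'.1) ≤
      (∑ φ : Φ, μ.real (featBallEvent H ρ r C φ.1)) ^ 2 / (1 - p : ℝ) ^ (Fintype.card W ^ 2) +
      ((Fintype.card W ^ Fintype.card W) ^ 2 : ℕ) *
        ∑ l ∈ Finset.range (2 * r + 1), (Fintype.card V : ℝ) ^ (l + 1) * (p : ℝ) ^ l := by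
  intro μ
  classical
  set A : Φ → Set (SimpleGraph V × (V → X)) := fun φ => featBallEvent H ρ r C φ.1
  have hA : ∀ φ, MeasurableSet (A φ) := fun φ => measurableSet_featBallEvent hC φ.1
  set B : V × V → Set (SimpleGraph V × (V → X)) := fun v =>
    {G : SimpleGraph V | G.edist v.1 v.2 ≤ (2 * r : ℕ)} ×ˢ Set.univ
  have hB : ∀ v, MeasurableSet (B v) := fun v => MeasurableSet.prod .of_discrete .univ
  have hq : (0 : ℝ) < (1 - p : ℝ) ^ (Fintype.card W ^ 2) := pow_pos (by linarith) _
  have h1 : ∀ φ φ' : Φ, μ.real (A φ ∩ A φ') ≤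
      μ.real (A φ) * μ.real (A φ') / (1 - p : ℝ) ^ (Fintype.card W ^ 2) +
        μ.real (A φ ∩ A φ' ∩ B (φ.1 ρ, φ'.1 ρ)) := by
    intro φ φ'
    by_cases hd : Disjoint (Set.range φ.1) (Set.range φ'.1)
    · refine le_add_of_le_of_nonneg ?_ measureReal_nonneg
      rw [le_div_iff₀ hq]
      exact real_featBallEvent_inter_le p D hH C (hΦ _ φ.2) (hΦ _ φ'.2) hd
    · have : A φ ∩ A φ' ∩ B (φ.1 ρ, φ'.1 ρ) = A φ ∩ A φ' := by
        refine Set.inter_eq_left.2 fun x hx => ⟨?_, trivial⟩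
        exact hx.1.1.edist_le_of_not_disjoint hx.2.1 hH.connected hr hd
      rw [this]
      exact le_add_of_nonneg_left (by positivity)
  refine (Finset.sum_le_sum fun φ _ => Finset.sum_le_sum fun φ' _ => h1 φ φ').trans ?_
  simp_rw [Finset.sum_add_distrib]
  refine add_le_add (le_of_eq ?_) ?_
  · rw [sq (∑ φ : Φ, _), Finset.sum_mul_sum, Finset.sum_div]
    simp_rw [Finset.sum_div]
    rfl
  · rw [← Finset.sum_product', ← Finset.sum_fiberwise_of_maps_to
      (g := fun x : Φ × Φ => (x.1.1 ρ, x.2.1 ρ)) (t := Finset.univ) (by simp)]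
    have h2 : ∀ v : V × V, ∑ x ∈ (Finset.univ ×ˢ Finset.univ : Finset (Φ × Φ)) with
        (x.1.1 ρ, x.2.1 ρ) = v, μ.real (A x.1 ∩ A x.2 ∩ B (x.1.1 ρ, x.2.1 ρ)) ≤
        ((Fintype.card W ^ Fintype.card W) ^ 2 : ℕ) *
          (SimpleGraph.binomialRandom V p).real {G | G.edist v.1 v.2 ≤ (2 * r : ℕ)} := by
      intro v
      have hBv : μ.real (B v) =
          (SimpleGraph.binomialRandom V p).real {G | G.edist v.1 v.2 ≤ (2 * r : ℕ)} := by
        simp only [μ, B]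
        rw [measureReal_prod_prod]; simp
      rw [← hBv]
      refine le_trans (le_of_eq (Finset.sum_congr rfl fun x hx => ?_))
        (sum_measureReal_inter_le μ _ (A := fun x : Φ × Φ => A x.1 ∩ A x.2) (B := B v)
          (fun x => (hA _).inter (hA _)) (hB v) _ ?_)
      · rw [(Finset.mem_filter.1 hx).2]
      · intro x t ht hx
        have hK : ∀ (u : V) (s : Finset Φ), (∀ φ ∈ s, x ∈ A φ ∧ φ.1 ρ = u) →
            s.card ≤ Fintype.card W ^ Fintype.card W := by
          intro u s hs
          rw [← Finset.card_map (Function.Embedding.subtype _)]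
          refine IsBallEmb.card_le hH.connected hr u _ (G := x.1) fun φ hφ => ?_
          obtain ⟨φ, h, rfl⟩ := Finset.mem_map.1 hφ
          exact ⟨(hs φ h).1.1, (hs φ h).2⟩
        have hsub : t ⊆ t.image Prod.fst ×ˢ t.image Prod.snd := fun y hy =>
          Finset.mem_product.2 ⟨Finset.mem_image_of_mem _ hy, Finset.mem_image_of_mem _ hy⟩
        refine (Finset.card_le_card hsub).trans ?_
        rw [Finset.card_product, sq]
        refine Nat.mul_le_mul (hK v.1 _ fun φ hφ => ?_) (hK v.2 _ fun φ hφ => ?_)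
        · obtain ⟨y, hy, rfl⟩ := Finset.mem_image.1 hφ
          exact ⟨(hx y hy).1, by rw [← (Finset.mem_filter.1 (ht hy)).2]⟩
        · obtain ⟨y, hy, rfl⟩ := Finset.mem_image.1 hφ
          exact ⟨(hx y hy).2, by rw [← (Finset.mem_filter.1 (ht hy)).2]⟩
    refine (Finset.sum_le_sum fun v _ => h2 v).trans ?_
    rw [← Finset.mul_sum]
    exact mul_le_mul_of_nonneg_left (sum_binomialRandom_edist_le p (2 * r)) (by positivity)

lemma sum_real_featBallEvent_le (hH : H.IsTree) (hr : ∀ w, H.dist ρ w ≤ r)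
    {C : W → Set X} (hC : ∀ w, MeasurableSet (C w)) (Φ : Finset (W → V)) :
    ∑ φ : Φ, ((SimpleGraph.binomialRandom V p).prod (Measure.pi fun _ : V => D)).real
      (featBallEvent H ρ r C φ.1) ≤ (Fintype.card W ^ Fintype.card W : ℕ) * Fintype.card V := by
  classical
  rw [← Finset.sum_fiberwise_of_maps_to (g := fun φ : Φ => φ.1 ρ) (t := Finset.univ) (by simp)]
  have h : ∀ v : V, ∑ φ : Φ with φ.1 ρ = v,
      ((SimpleGraph.binomialRandom V p).prod (Measure.pi fun _ : V => D)).real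
      (featBallEvent H ρ r C φ.1) ≤ (Fintype.card W ^ Fintype.card W : ℕ) := by
    intro v
    have := sum_measureReal_inter_le
      ((SimpleGraph.binomialRandom V p).prod (Measure.pi fun _ : V => D))
      (Finset.univ.filter fun φ : Φ => φ.1 ρ = v) (A := fun φ => featBallEvent H ρ r C φ.1)
      (B := Set.univ) (fun φ => measurableSet_featBallEvent hC φ.1) .univ
      (Fintype.card W ^ Fintype.card W) (by
        intro x t ht hx
        rw [← Finset.card_map (Function.Embedding.subtype _)]
        refine IsBallEmb.card_le hH.connected hr v _ (G := x.1) fun φ hφ => ?_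
        obtain ⟨φ, h, rfl⟩ := Finset.mem_map.1 hφ
        exact ⟨(hx φ h).1, (Finset.mem_filter.1 (ht h)).2⟩)
    simpa using this
  refine (Finset.sum_le_sum fun v _ => h v).trans ?_
  simp [mul_comm]

end FeaturedBall

/-! ### The count of ball embeddings at edge probability `c / n` -/

lemma edgeProb_le {c : ℝ} (hc : 0 ≤ c) (n : ℕ) : (edgeProb c n : ℝ) ≤ c / n := by
  rw [edgeProb, Set.coe_projIcc]
  exact max_le (by positivity) (min_le_right _ _)

lemma eventually_edgeProb (c : ℝ) (hc : 0 ≤ c) :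
    ∀ᶠ n : ℕ in atTop, 0 < n ∧ c / n < 1 ∧ (edgeProb c n : ℝ) = c / n := by
  obtain ⟨N, hN⟩ := exists_nat_gt c
  filter_upwards [eventually_ge_atTop (N + 1)] with n hn
  have hn0 : (0 : ℝ) < n := by exact_mod_cast (by omega : 0 < n)
  have hcn : c / n < 1 := by
    rw [div_lt_one hn0]
    exact hN.trans (by exact_mod_cast (by omega : N < n))
  refine ⟨by omega, hcn, ?_⟩
  rw [edgeProb, Set.coe_projIcc, min_eq_right hcn.le, max_eq_right (by positivity)]

instance {d : ℕ} (D : Measure (Fin d → ℝ)) [IsProbabilityMeasure D] (c : ℝ) (n : ℕ) :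
    IsProbabilityMeasure (randomFeaturedGraph D c n) := by
  unfold randomFeaturedGraph; infer_instance

lemma tendsto_one_sub_div_pow (c : ℝ) (j : ℕ) :
    Tendsto (fun n : ℕ => (1 - c / n) ^ j) atTop (𝓝 1) := by
  have h := tendsto_const_div_atTop_nhds_zero_nat c
  simpa using (h.const_sub 1).pow j

/-- The number of ball embeddings of a tree is concentrated around its mean. -/
theorem tendsto_real_eventCount_le {d : ℕ} (D : Measure (Fin d → ℝ)) [IsProbabilityMeasure D]
    {c : ℝ} (hc : 0 < c) {W : Type*} [Fintype W] {H : SimpleGraph W} {ρ : W} {r : ℕ}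
    (hH : H.IsTree) (hr : ∀ w, H.dist ρ w ≤ r) {C : W → Set (Fin d → ℝ)}
    (hC : ∀ w, MeasurableSet (C w)) (Φ : ∀ n, Finset (W → Fin n))
    (hΦ : ∀ n, ∀ φ ∈ Φ n, Function.Injective φ) (b : ℕ → ℝ) (hb : ∀ n, b n ≤ (Φ n).card) (a : ℝ)
    (ha : Tendsto (fun n : ℕ => b n / (n : ℝ) ^ Fintype.card W) atTop (𝓝 a))
    (δ : ℝ) (hδ : 0 < δ) :
    Tendsto (fun n : ℕ => (randomFeaturedGraph D c n).real
      {x | (eventCount (fun φ : Φ n => featBallEvent H ρ r C φ.1) x : ℝ) ≤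
        (a * c ^ (Fintype.card W - 1) * Real.exp (-c) ^ {w | H.dist ρ w < r}.ncard *
          ∏ w, D.real (C w) - δ) * n}) atTop (𝓝 0) := by
  set I := {w | H.dist ρ w < r}.ncard
  set q := a * c ^ (Fintype.card W - 1) * Real.exp (-c) ^ I * ∏ w, D.real (C w)
  set K : ℕ := Fintype.card W ^ Fintype.card W
  set m : ℕ → ℝ := fun n => ∑ φ : Φ n, (randomFeaturedGraph D c n).real
    (featBallEvent H ρ r C φ.1)
  have hP0 : 0 ≤ ∏ w, D.real (C w) := Finset.prod_nonneg fun _ _ => measureReal_nonneg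
  have hW : 0 < Fintype.card W := Fintype.card_pos_iff.2 ⟨ρ⟩
  have hlim : Tendsto (fun n : ℕ => b n / (n : ℝ) ^ Fintype.card W * c ^ (Fintype.card W - 1) *
      ((1 + -c / n) ^ n) ^ I * (1 - c / n) ^ (Fintype.card W ^ 2) * ∏ w, D.real (C w)) atTop
      (𝓝 q) := by
    have := (((ha.mul_const (c ^ (Fintype.card W - 1))).mul
      ((Real.tendsto_one_add_div_pow_exp (-c)).pow I)).mul
      (tendsto_one_sub_div_pow c (Fintype.card W ^ 2))).mul_const (∏ w, D.real (C w))
    simpa [q] using this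
  -- A lower bound for the mean suffices, so the number of forbidden pairs is replaced by its upper
  -- bound `I * n + |W| ^ 2` and the number of embeddings by its lower bound `b n`.
  have hm : ∀ᶠ n : ℕ in atTop, (q - δ / 2) * n ≤ m n := by
    filter_upwards [hlim.eventually_const_le (show q - δ / 2 < q by linarith),
      eventually_edgeProb c hc.le] with n hn ⟨hn0, hlt, hpn⟩
    have hn0' : (0 : ℝ) < n := by exact_mod_cast hn0
    refine (mul_le_mul_of_nonneg_right hn hn0'.le).trans ?_
    have hc1 : 0 ≤ 1 - c / n := by linarith
    have hterm : ∀ φ : Φ n, (c / n) ^ (Fintype.card W - 1) *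
        (1 - c / n) ^ (I * n + Fintype.card W ^ 2) * ∏ w, D.real (C w) ≤
        (randomFeaturedGraph D c n).real (featBallEvent H ρ r C φ.1) := by
      intro φ
      rw [randomFeaturedGraph, real_featBallEvent _ D hH C (hΦ n _ φ.2), hpn]
      refine mul_le_mul_of_nonneg_right (mul_le_mul_of_nonneg_left ?_ (by positivity)) hP0
      refine pow_le_pow_of_le_one hc1 (by linarith [div_nonneg hc.le hn0'.le]) ?_
      simpa using card_embNonEdges_le (H := H) (ρ := ρ) (r := r) φ.1
    have hsum := Finset.card_nsmul_le_sum Finset.univ _ _ fun φ _ => hterm φ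
    refine le_trans ?_ hsum
    rw [Finset.card_univ, Fintype.card_coe, nsmul_eq_mul]
    refine le_trans (le_of_eq ?_) (mul_le_mul_of_nonneg_right (hb n)
      (mul_nonneg (mul_nonneg (by positivity) (pow_nonneg hc1 _)) hP0))
    obtain ⟨w, hw⟩ : ∃ w, Fintype.card W = w + 1 := ⟨Fintype.card W - 1, by omega⟩
    rw [hw, Nat.add_sub_cancel, div_pow, pow_add (1 - c / n), neg_div, ← sub_eq_add_neg, ← pow_mul,
      mul_comm n I, pow_succ (n : ℝ) w]
    field_simp
  -- The mean is at least `(q - δ / 2) * n`, so the event is a deviation of at least `δ / 2 * n`.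
  -- Chebyshev's inequality applies, and the excess of the second moment is `o(n ^ 2)` because the
  -- mean is at most `K * n`.
  have hbound : ∀ᶠ n : ℕ in atTop, (randomFeaturedGraph D c n).real
      {x | (eventCount (fun φ : Φ n => featBallEvent H ρ r C φ.1) x : ℝ) ≤ (q - δ) * n} ≤
      ((K : ℝ) ^ 2 * (1 / (1 - c / n) ^ (Fintype.card W ^ 2) - 1) +
        (K ^ 2 : ℕ) * ((∑ l ∈ Finset.range (2 * r + 1), c ^ l) / n)) / (δ / 2) ^ 2 := by
    filter_upwards [hm, eventually_edgeProb c hc.le] with n hn ⟨hn0, hlt, hpn⟩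
    have hn0' : (0 : ℝ) < n := by exact_mod_cast hn0
    have hs : 0 < δ / 2 * n := by positivity
    have h1 := measureReal_eventCount_le_le (randomFeaturedGraph D c n)
      (A := fun φ : Φ n => featBallEvent H ρ r C φ.1)
      (fun φ => measurableSet_featBallEvent hC φ.1) hs
    have h2 := sum_real_featBallEvent_inter_le (edgeProb c n) D hH hr hC (Φ n) (hΦ n)
      (by rw [hpn]; exact hlt)
    have h3 := sum_real_featBallEvent_le (edgeProb c n) D hH hr hC (Φ n)
    simp only [Fintype.card_fin, hpn] at h2 h3
    refine (measureReal_mono ?_).trans (h1.trans ?_)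
    · intro x hx
      simp only [Set.mem_ofPred_eq] at hx ⊢
      refine hx.trans ?_
      change _ ≤ m n - _
      linarith
    · have hm0 : 0 ≤ m n := Finset.sum_nonneg fun _ _ => measureReal_nonneg
      have hc1 : 0 < (1 - c / n) ^ (Fintype.card W ^ 2) := pow_pos (by linarith) _
      have hc2 : (1 - c / n) ^ (Fintype.card W ^ 2) ≤ 1 :=
        pow_le_one₀ (by linarith) (by linarith [div_nonneg hc.le hn0'.le])
      have hX : 0 ≤ 1 / (1 - c / n) ^ (Fintype.card W ^ 2) - 1 := by
        rw [sub_nonneg, le_div_iff₀ hc1]; linarith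
      have hS : ∑ l ∈ Finset.range (2 * r + 1), (n : ℝ) ^ (l + 1) * (c / n) ^ l =
          (∑ l ∈ Finset.range (2 * r + 1), c ^ l) / n * n ^ 2 := by
        rw [Finset.sum_div, Finset.sum_mul]
        refine Finset.sum_congr rfl fun l _ => ?_
        rw [div_pow, pow_succ]
        field_simp
      rw [hS] at h2
      have hmsq : m n ^ 2 ≤ (K : ℝ) ^ 2 * n ^ 2 := by
        rw [← mul_pow]
        exact pow_le_pow_left₀ hm0 h3 2
      rw [div_le_div_iff₀ (by positivity) (by positivity)]
      change (_ - m n ^ 2) * _ ≤ _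
      have h4 : m n ^ 2 / (1 - c / n) ^ (Fintype.card W ^ 2) - m n ^ 2 ≤
          (K : ℝ) ^ 2 * n ^ 2 * (1 / (1 - c / n) ^ (Fintype.card W ^ 2) - 1) := by
        calc _ = m n ^ 2 * (1 / (1 - c / n) ^ (Fintype.card W ^ 2) - 1) := by ring
          _ ≤ _ := mul_le_mul_of_nonneg_right hmsq hX
      change ∑ φ : Φ n, ∑ φ' : Φ n, (randomFeaturedGraph D c n).real
        (featBallEvent H ρ r C φ.1 ∩ featBallEvent H ρ r C φ'.1) ≤
          m n ^ 2 / _ + (K ^ 2 : ℕ) * _ at h2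
      rw [mul_pow, mul_comm ((δ / 2) ^ 2), ← mul_assoc]
      refine mul_le_mul_of_nonneg_right ?_ (by positivity)
      linarith
  have hz : Tendsto (fun n : ℕ => ((K : ℝ) ^ 2 * (1 / (1 - c / n) ^ (Fintype.card W ^ 2) - 1) +
      (K ^ 2 : ℕ) * ((∑ l ∈ Finset.range (2 * r + 1), c ^ l) / n)) / (δ / 2) ^ 2) atTop (𝓝 0) := by
    have h1 := ((tendsto_one_sub_div_pow c (Fintype.card W ^ 2)).inv₀ one_ne_zero).sub_const 1
    have h2 := tendsto_const_div_atTop_nhds_zero_nat (∑ l ∈ Finset.range (2 * r + 1), c ^ l)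
    have := ((h1.const_mul ((K : ℝ) ^ 2)).add (h2.const_mul ((K ^ 2 : ℕ) : ℝ))).div_const
      ((δ / 2) ^ 2)
    simpa using this
  exact tendsto_of_tendsto_of_tendsto_of_le_of_le' tendsto_const_nhds hz
    (Eventually.of_forall fun n => measureReal_nonneg) hbound

/-! ### Trees coded by words and their order-preserving embeddings -/

namespace TreeCode

variable {o : List ℕ → ℕ} {r : ℕ}

instance (o : List ℕ → ℕ) (r : ℕ) : Fintype (nodes o r) := (finite_nodes o r).fintype

/-- The tree formed by the first `r` generations. -/
def nodeGraph (o : List ℕ → ℕ) (r : ℕ) : SimpleGraph (nodes o r) :=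
  SimpleGraph.fromRel fun u v => ∃ i, v.1 = i :: u.1

/-- The root as an individual. -/
def rootNode (o : List ℕ → ℕ) (r : ℕ) : nodes o r := ⟨[], trivial, Nat.zero_le _⟩

lemma nodeGraph_adj {u v : nodes o r} :
    (nodeGraph o r).Adj u v ↔ (∃ i, v.1 = i :: u.1) ∨ ∃ i, u.1 = i :: v.1 := by
  simp only [nodeGraph, SimpleGraph.fromRel_adj, and_iff_right_iff_imp]
  rintro (⟨i, h⟩ | ⟨i, h⟩) rfl <;> simp at h

lemma mem_nodes_tail {i : ℕ} {w : List ℕ} (h : i :: w ∈ nodes o r) : w ∈ nodes o r :=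
  ⟨h.1.1, by have := h.2; simp at this; omega⟩

lemma exists_walk_length (w : nodes o r) :
    ∃ p : (nodeGraph o r).Walk (rootNode o r) w, p.length = w.1.length := by
  obtain ⟨w, hw⟩ := w
  induction w with
  | nil => exact ⟨.nil, rfl⟩
  | cons i w ih =>
    obtain ⟨p, hp⟩ := ih (mem_nodes_tail hw)
    exact ⟨p.concat (nodeGraph_adj.2 (Or.inl ⟨i, rfl⟩)), by simp [hp]⟩

lemma nodeGraph_connected (o : List ℕ → ℕ) (r : ℕ) : (nodeGraph o r).Connected := by
  rw [SimpleGraph.connected_iff_exists_forall_reachable]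
  exact ⟨rootNode o r, fun w => ⟨(exists_walk_length w).choose⟩⟩

lemma nodeGraph_dist (w : nodes o r) : (nodeGraph o r).dist (rootNode o r) w = w.1.length := by
  refine le_antisymm ?_ ?_
  · obtain ⟨p, hp⟩ := exists_walk_length w
    exact hp ▸ SimpleGraph.dist_le p
  · obtain ⟨p, hp⟩ := (nodeGraph_connected o r).exists_walk_length_eq_dist (rootNode o r) w
    rw [← hp]
    have key : ∀ {u v : nodes o r} (p : (nodeGraph o r).Walk u v),
        v.1.length ≤ u.1.length + p.length := by
      intro u v p
      induction p with
      | nil => simp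
      | @cons u v w h p ih =>
        rw [SimpleGraph.Walk.length_cons]
        rcases nodeGraph_adj.1 h with ⟨i, h⟩ | ⟨i, h⟩ <;>
        · have := congrArg List.length h
          simp at this
          omega
    simpa [rootNode] using key p

lemma nodeGraph_isTree (o : List ℕ → ℕ) (r : ℕ) : (nodeGraph o r).IsTree := by
  rw [SimpleGraph.isTree_iff_connected_and_card]
  refine ⟨nodeGraph_connected o r,
    le_antisymm ?_ (nodeGraph_connected o r).card_vert_le_card_edgeSet_add_one⟩
  -- Every edge joins a non-root individual to its parent, which bounds the number of edges from
  -- above; connectedness gives the reverse bound.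
  have hlt : Nat.card (nodeGraph o r).edgeSet ≤ Nat.card {w : nodes o r // w ≠ rootNode o r} := by
    have hpar : ∀ w : {w : nodes o r // w ≠ rootNode o r}, ∃ e : (nodeGraph o r).edgeSet,
        ∃ u : nodes o r, (∃ i, w.1.1 = i :: u.1) ∧ e.1 = s(u, w.1) := by
      rintro ⟨⟨w, hw⟩, hne⟩
      cases w with
      | nil => exact absurd rfl hne
      | cons i w =>
        exact ⟨⟨s(⟨w, mem_nodes_tail hw⟩, ⟨i :: w, hw⟩), nodeGraph_adj.2 (Or.inl ⟨i, rfl⟩)⟩,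
          ⟨w, mem_nodes_tail hw⟩, ⟨i, rfl⟩, rfl⟩
    choose f hf using hpar
    refine Nat.card_le_card_of_surjective f ?_
    have huniq : ∀ (u w : nodes o r) (i : ℕ) (hi : w.1 = i :: u.1)
        (he : s(u, w) ∈ (nodeGraph o r).edgeSet), ∃ a, f a = ⟨s(u, w), he⟩ := by
      intro u w i hi he
      have hne : w ≠ rootNode o r := by
        rintro rfl
        simp [rootNode] at hi
      obtain ⟨u', ⟨j, hj⟩, h⟩ := hf ⟨w, hne⟩
      refine ⟨⟨w, hne⟩, Subtype.ext ?_⟩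
      rw [h]
      have hu : u' = u := Subtype.ext (List.cons.inj (hj.symm.trans hi)).2
      rw [hu]
    rintro ⟨e, he⟩
    induction e with
    | _ u w =>
      rcases nodeGraph_adj.1 he with ⟨i, hi⟩ | ⟨i, hi⟩
      · exact huniq u w i hi he
      · obtain ⟨a, ha⟩ := huniq w u i hi (by rwa [Sym2.eq_swap])
        exact ⟨a, ha.trans (Subtype.ext Sym2.eq_swap)⟩
  have hcard : Nat.card {w : nodes o r // w ≠ rootNode o r} + 1 = Nat.card (nodes o r) := by
    classical
    rw [Nat.card_eq_fintype_card, Nat.card_eq_fintype_card, Fintype.card_subtype_compl,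
      Fintype.card_subtype_eq]
    exact Nat.sub_add_cancel (Fintype.card_pos_iff.2 ⟨rootNode o r⟩)
  omega

/-- The individuals of the first `r` generations other than the last one. -/
abbrev Inner (o : List ℕ → ℕ) (r : ℕ) : Type := {w : nodes o r // w.1.length < r}

/-- Every individual is the root or a child of a unique individual. -/
def childFun (o : List ℕ → ℕ) (r : ℕ) : Option (Σ w : Inner o r, Fin (o w.1.1)) → nodes o r
  | none => rootNode o r
  | some ⟨w, i⟩ => ⟨i.1 :: w.1.1, ⟨w.1.2.1, i.2⟩, w.2⟩

lemma childFun_bijective (o : List ℕ → ℕ) (r : ℕ) : Function.Bijective (childFun o r) := by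
  constructor
  · rintro (_ | ⟨⟨⟨w, hw⟩, hl⟩, i⟩) (_ | ⟨⟨⟨w', hw'⟩, hl'⟩, i'⟩) h
    · rfl
    · have := congrArg Subtype.val h
      simp [childFun, rootNode] at this
    · have := congrArg Subtype.val h
      simp [childFun, rootNode] at this
    · have := congrArg Subtype.val h
      simp only [childFun, List.cons.injEq] at this
      obtain ⟨h1, rfl⟩ := this
      have : i = i' := Fin.ext h1
      rw [this]
  · rintro ⟨w, hw⟩
    cases w with
    | nil => exact ⟨none, rfl⟩
    | cons i w => exact ⟨some ⟨⟨⟨w, mem_nodes_tail hw⟩, hw.2⟩, ⟨i, hw.1.2⟩⟩, rfl⟩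

/-- `childFun` as an equivalence. -/
def childEquiv (o : List ℕ → ℕ) (r : ℕ) :
    Option (Σ w : Inner o r, Fin (o w.1.1)) ≃ nodes o r :=
  Equiv.ofBijective _ (childFun_bijective o r)

lemma card_nodes (o : List ℕ → ℕ) (r : ℕ) :
    Fintype.card (nodes o r) = (∑ w : Inner o r, o w.1.1) + 1 := by
  rw [← Fintype.card_congr (childEquiv o r)]
  simp

/-- The embeddings that respect the order of siblings. -/
def IsOrdered {n : ℕ} (φ : nodes o r → Fin n) : Prop :=
  ∀ w : Inner o r, StrictMono fun i : Fin (o w.1.1) => φ (childEquiv o r (some ⟨w, i⟩))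

/-- Permuting siblings. -/
def permute (σ : ∀ w : Inner o r, Equiv.Perm (Fin (o w.1.1))) : Equiv.Perm (nodes o r) :=
  (childEquiv o r).symm.trans
    ((Equiv.optionCongr (Equiv.sigmaCongrRight σ)).trans (childEquiv o r))

lemma permute_childEquiv (σ : ∀ w : Inner o r, Equiv.Perm (Fin (o w.1.1))) (w : Inner o r)
    (i : Fin (o w.1.1)) :
    permute σ (childEquiv o r (some ⟨w, i⟩)) = childEquiv o r (some ⟨w, σ w i⟩) := by
  simp [permute]

lemma permute_inv_apply (σ : ∀ w : Inner o r, Equiv.Perm (Fin (o w.1.1))) (x : nodes o r) :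
    permute σ (permute (fun w => (σ w)⁻¹) x) = x := by
  obtain ⟨y, rfl⟩ := (childEquiv o r).surjective x
  rcases y with _ | ⟨w, i⟩
  · simp [permute]
  · simp [permute_childEquiv]

open Classical in
/-- The injective maps from the tree to `Fin n` that respect the order of siblings. -/
def orderedMaps (o : List ℕ → ℕ) (r n : ℕ) : Finset (nodes o r → Fin n) :=
  Finset.univ.filter fun φ => Function.Injective φ ∧ IsOrdered φ

lemma mem_orderedMaps {n : ℕ} {φ : nodes o r → Fin n} :
    φ ∈ orderedMaps o r n ↔ Function.Injective φ ∧ IsOrdered φ := by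
  classical
  simp [orderedMaps]

lemma card_filter_injective {W V : Type*} [Fintype W] [Fintype V] [DecidableEq W]
    [DecidablePred fun φ : W → V => Function.Injective φ] :
    (Finset.univ.filter fun φ : W → V => Function.Injective φ).card =
      (Fintype.card V).descFactorial (Fintype.card W) := by
  classical
  rw [← Fintype.card_embedding_eq, ← Fintype.card_subtype]
  exact Fintype.card_congr (Equiv.subtypeInjectiveEquivEmbedding _ _)

/-- Sorting the values of an injection on each group of siblings makes it ordered, so every
injection is an ordered map composed with a sibling permutation. These permutations move individuals
without their descendants and need not be automorphisms; only their number matters. -/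
lemma descFactorial_le_card_orderedMaps (o : List ℕ → ℕ) (r n : ℕ) :
    n.descFactorial (Fintype.card (nodes o r)) ≤
      (orderedMaps o r n).card * ∏ w : Inner o r, (o w.1.1).factorial := by
  classical
  have hsub : (Finset.univ.filter fun φ : nodes o r → Fin n => Function.Injective φ) ⊆
      (orderedMaps o r n ×ˢ
        (Finset.univ : Finset (∀ w : Inner o r, Equiv.Perm (Fin (o w.1.1))))).image
        fun x => x.1 ∘ permute x.2 := by
    intro f hf
    have hf : Function.Injective f := (Finset.mem_filter.1 hf).2
    let σ : ∀ w : Inner o r, Equiv.Perm (Fin (o w.1.1)) := fun w =>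
      Tuple.sort fun i => f (childEquiv o r (some ⟨w, i⟩))
    refine Finset.mem_image.2 ⟨(f ∘ permute σ, fun w => (σ w)⁻¹), ?_, ?_⟩
    · refine Finset.mem_product.2 ⟨mem_orderedMaps.2 ⟨hf.comp (permute σ).injective, fun w => ?_⟩,
        Finset.mem_univ _⟩
      have hm := Tuple.monotone_sort fun i => f (childEquiv o r (some ⟨w, i⟩))
      simp only [Function.comp_apply, permute_childEquiv]
      refine hm.strictMono_of_injective fun i j hij => ?_
      simpa using (childEquiv o r).injective (hf hij)
    · funext x
      simp [permute_inv_apply]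
  calc _ = (Finset.univ.filter fun φ : nodes o r → Fin n => Function.Injective φ).card := by
        rw [card_filter_injective, Fintype.card_fin]
    _ ≤ _ := Finset.card_le_card hsub
    _ ≤ _ := Finset.card_image_le
    _ = _ := by
      rw [Finset.card_product, Finset.card_univ, Fintype.card_pi]
      simp [Fintype.card_perm]

lemma tendsto_descFactorial_div_pow (k : ℕ) :
    Tendsto (fun n : ℕ => (n.descFactorial k : ℝ) / (n : ℝ) ^ k) atTop (𝓝 1) := by
  have h := isEquivalent_descFactorial k
  refine (Asymptotics.isEquivalent_iff_tendsto_one ?_).1 h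
  filter_upwards [eventually_gt_atTop 0] with n hn
  have : (n : ℝ) ≠ 0 := by exact_mod_cast hn.ne'
  positivity

/-- A vertex is the root of at most one plane tree embedded as a ball around it. -/
lemma IsOrdered.unique {o' : List ℕ → ℕ} {n : ℕ} {G : SimpleGraph (Fin n)}
    {φ : nodes o r → Fin n} {φ' : nodes o' r → Fin n}
    (h : IsBallEmb (nodeGraph o r) (rootNode o r) r G φ)
    (h' : IsBallEmb (nodeGraph o' r) (rootNode o' r) r G φ')
    (ho : IsOrdered φ) (ho' : IsOrdered φ') (hroot : φ (rootNode o r) = φ' (rootNode o' r)) :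
    ∀ (w : List ℕ) (hw : w ∈ nodes o r), ∃ hw' : w ∈ nodes o' r,
      φ ⟨w, hw⟩ = φ' ⟨w, hw'⟩ ∧ (w.length < r → o w = o' w) := by
  -- The children of an inner vertex are its neighbours in `G` other than its parent, so `G` and the
  -- parent determine their set.
  have hchild : ∀ {o : List ℕ → ℕ} {φ : nodes o r → Fin n}
      (_ : IsBallEmb (nodeGraph o r) (rootNode o r) r G φ) (w : Inner o r) (x : Fin n),
      x ∈ Set.range (fun i : Fin (o w.1.1) => φ (childEquiv o r (some ⟨w, i⟩))) ↔
        G.Adj (φ w.1) x ∧ ∀ u : nodes o r, (∃ i, w.1.1 = i :: u.1) → x ≠ φ u := by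
    intro o φ h w x
    constructor
    · rintro ⟨i, rfl⟩
      refine ⟨(h.2.1 _ _).2 (nodeGraph_adj.2 (Or.inl ⟨i, rfl⟩)), ?_⟩
      rintro u ⟨j, hj⟩ hu
      have := congrArg (fun v : nodes o r => v.1.length) (h.1 hu)
      simp only [childEquiv, Equiv.ofBijective_apply, childFun] at this
      have hl := congrArg List.length hj
      simp only [List.length_cons] at this hl
      omega
    · rintro ⟨hadj, hu⟩
      obtain ⟨v, rfl⟩ := h.2.2 w.1 (by rw [nodeGraph_dist]; exact w.2) x hadj
      rcases nodeGraph_adj.1 ((h.2.1 _ _).1 hadj) with ⟨i, hi⟩ | hi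
      · obtain ⟨v, hv⟩ := v
        simp only at hi
        subst hi
        exact ⟨⟨i, hv.1.2⟩, rfl⟩
      · exact absurd rfl (hu v hi)
  have step : ∀ (w : List ℕ) (hw : w ∈ nodes o r) (hw' : w ∈ nodes o' r),
      φ ⟨w, hw⟩ = φ' ⟨w, hw'⟩ →
      (∀ i u, w = i :: u → ∃ (hu : u ∈ nodes o r) (hu' : u ∈ nodes o' r),
        φ ⟨u, hu⟩ = φ' ⟨u, hu'⟩) → ∀ hl : w.length < r, ∃ ho : o w = o' w, ∀ i : Fin (o w),
          φ (childEquiv o r (some ⟨⟨⟨w, hw⟩, hl⟩, i⟩)) =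
          φ' (childEquiv o' r (some ⟨⟨⟨w, hw'⟩, hl⟩, Fin.cast ho i⟩)) := by
    intro w hw hw' heq hpar hl
    have hran : Set.range (fun i : Fin (o w) => φ (childEquiv o r (some ⟨⟨⟨w, hw⟩, hl⟩, i⟩))) =
        Set.range (fun i : Fin (o' w) => φ' (childEquiv o' r (some ⟨⟨⟨w, hw'⟩, hl⟩, i⟩))) := by
      ext x
      rw [hchild h ⟨⟨w, hw⟩, hl⟩ x, hchild h' ⟨⟨w, hw'⟩, hl⟩ x, heq]
      refine and_congr_right fun _ => ?_
      constructor
      · rintro H u ⟨i, hi⟩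
        obtain ⟨hu, hu', he⟩ := hpar i u.1 hi
        have := H ⟨u.1, hu⟩ ⟨i, hi⟩
        rwa [he] at this
      · rintro H u ⟨i, hi⟩
        obtain ⟨hu, hu', he⟩ := hpar i u.1 hi
        have := H ⟨u.1, hu'⟩ ⟨i, hi⟩
        rwa [← he] at this
    have hm := ho ⟨⟨w, hw⟩, hl⟩
    have hm' := ho' ⟨⟨w, hw'⟩, hl⟩
    have hcard : o w = o' w := by
      have := congrArg Set.ncard hran
      rwa [← Nat.card_coe_set_eq, ← Nat.card_coe_set_eq,
        Nat.card_range_of_injective hm.injective, Nat.card_range_of_injective hm'.injective,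
        Nat.card_fin, Nat.card_fin] at this
    refine ⟨hcard, fun i => ?_⟩
    have hm'' : StrictMono ((fun i : Fin (o' w) =>
        φ' (childEquiv o' r (some ⟨⟨⟨w, hw'⟩, hl⟩, i⟩))) ∘ Fin.cast hcard) :=
      hm'.comp (Fin.cast_strictMono hcard)
    -- Two increasing enumerations of the same set agree; this is where the order of siblings
    -- enters.
    refine congrFun ((StrictMono.range_inj hm hm'').1 ?_) i
    rw [Set.range_comp, (finCongr hcard).surjective.range_eq (f := Fin.cast hcard),
      Set.image_univ]
    exact hran
  -- The induction carries agreement at the parent along, since children are recognised only once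
  -- the parent is excluded.
  have main : ∀ (w : List ℕ) (hw : w ∈ nodes o r), (∃ hw' : w ∈ nodes o' r,
      φ ⟨w, hw⟩ = φ' ⟨w, hw'⟩) ∧ ∀ i u, w = i :: u →
        ∃ (hu : u ∈ nodes o r) (hu' : u ∈ nodes o' r), φ ⟨u, hu⟩ = φ' ⟨u, hu'⟩ := by
    intro w
    induction w with
    | nil => exact fun hw => ⟨⟨(rootNode o' r).2, hroot⟩, fun i u h => by simp at h⟩
    | cons i w ih =>
      intro hw
      obtain ⟨⟨hw', he⟩, hp⟩ := ih (mem_nodes_tail hw)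
      have hl : w.length < r := hw.2
      obtain ⟨hoo, hc⟩ := step w _ hw' he hp hl
      refine ⟨⟨⟨⟨hw'.1, hoo ▸ hw.1.2⟩, hl⟩, hc ⟨i, hw.1.2⟩⟩, ?_⟩
      intro j u hju
      obtain ⟨rfl, rfl⟩ := List.cons.inj hju
      exact ⟨_, hw', he⟩
  intro w hw
  obtain ⟨⟨hw', he⟩, hp⟩ := main w hw
  exact ⟨hw', he, fun hl => (step w hw hw' he hp hl).choose⟩

end TreeCode

/-! ### Rounding features, and the branching process up to rounding -/

/-- The cell of `x` in the cubic grid of mesh `ε`. -/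
def gridCell {d : ℕ} (ε : ℝ) (x : Fin d → ℝ) : Fin d → ℤ := fun i => ⌊x i / ε⌋

lemma measurable_gridCell {d : ℕ} (ε : ℝ) : Measurable (gridCell (d := d) ε) :=
  measurable_pi_lambda _ fun i =>
    have h : Measurable fun x : Fin d → ℝ => x i / ε := by fun_prop
    h.floor

lemma norm_sub_le_of_gridCell_eq {d : ℕ} {ε : ℝ} (hε : 0 < ε) {x y : Fin d → ℝ}
    (h : gridCell ε x = gridCell ε y) : ‖x - y‖ ≤ ε := by
  refine (pi_norm_le_iff_of_nonneg hε.le).2 fun i => ?_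
  have hi : ⌊x i / ε⌋ = ⌊y i / ε⌋ := congrFun h i
  have h1 := Int.abs_sub_lt_one_of_floor_eq_floor hi
  rw [← sub_div, abs_div, abs_of_pos hε, div_lt_one hε] at h1
  exact h1.le

namespace TreeCode

variable {d : ℕ}

/-- The codes that agree with `T₀` on the first `r` generations, up to the mesh of the grid. -/
def agree (ε : ℝ) (r : ℕ) (T₀ : TreeCode d) : Set (TreeCode d) :=
  {T | (∀ w : Inner T₀.1 r, T.1 w.1.1 = T₀.1 w.1.1) ∧
    ∀ w : nodes T₀.1 r, gridCell ε (T.2 w.1) = gridCell ε (T₀.2 w.1)}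

lemma cons_mem_nodes {o : List ℕ → ℕ} {r i : ℕ} {w : List ℕ} :
    i :: w ∈ nodes o r ↔ w ∈ nodes o r ∧ w.length < r ∧ i < o w :=
  ⟨fun h => ⟨mem_nodes_tail h, h.2, h.1.2⟩, fun h => ⟨⟨h.1.1, h.2.2⟩, h.2.1⟩⟩

lemma nodes_eq_of_mem_agree {ε : ℝ} {r : ℕ} {T₀ T : TreeCode d} (h : T ∈ agree ε r T₀) :
    nodes T.1 r = nodes T₀.1 r := by
  ext w
  induction w with
  | nil => exact ⟨fun _ => (rootNode _ r).2, fun _ => (rootNode _ r).2⟩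
  | cons i w ih =>
    rw [cons_mem_nodes, cons_mem_nodes, ih]
    refine and_congr_right fun hw => and_congr_right fun hl => ?_
    rw [h.1 ⟨⟨w, hw⟩, hl⟩]

open Classical in
/-- The information on a coded tree that determines its class under `agree`. -/
def key (ε : ℝ) (r : ℕ) (T : TreeCode d) : Finset (List ℕ × ℕ × (Fin d → ℤ)) :=
  Finset.univ.image fun w : nodes T.1 r =>
    -- The offspring numbers of generation `r` lie beyond the truncation and are erased by the
    -- default `0`.
    (w.1, if w.1.length < r then T.1 w.1 else 0, gridCell ε (T.2 w.1))

lemma mem_agree_iff_key {ε : ℝ} {r : ℕ} {T₀ T : TreeCode d} :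
    T ∈ agree ε r T₀ ↔ key ε r T = key ε r T₀ := by
  classical
  constructor
  · intro h
    have hn := nodes_eq_of_mem_agree h
    ext x
    simp only [key, Finset.mem_image, Finset.mem_univ, true_and]
    have hv : ∀ (w : List ℕ) (hw : w ∈ nodes T₀.1 r),
        (w, if w.length < r then T.1 w else 0, gridCell ε (T.2 w)) =
        (w, if w.length < r then T₀.1 w else 0, gridCell ε (T₀.2 w)) := by
      intro w hw
      rw [h.2 ⟨w, hw⟩]
      split_ifs with hl
      · rw [h.1 ⟨⟨w, hw⟩, hl⟩]
      · rfl
    constructor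
    · rintro ⟨w, rfl⟩
      have hw : w.1 ∈ nodes T₀.1 r := by rw [← hn]; exact w.2
      exact ⟨⟨w.1, hw⟩, (hv w.1 hw).symm⟩
    · rintro ⟨w, rfl⟩
      exact ⟨⟨w.1, by rw [hn]; exact w.2⟩, hv w.1 w.2⟩
  · intro h
    have hw : ∀ w : nodes T₀.1 r, (w.1.length < r → T.1 w.1 = T₀.1 w.1) ∧
        gridCell ε (T.2 w.1) = gridCell ε (T₀.2 w.1) := by
      intro w
      have : (w.1, if w.1.length < r then T₀.1 w.1 else 0, gridCell ε (T₀.2 w.1)) ∈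
          key ε r T := by
        rw [h]
        exact Finset.mem_image_of_mem _ (Finset.mem_univ w)
      obtain ⟨u, -, hu⟩ := Finset.mem_image.1 this
      simp only [Prod.mk.injEq] at hu
      obtain ⟨h1, h2, h3⟩ := hu
      rw [h1] at h2 h3
      exact ⟨fun hl => by simpa [hl] using h2, h3⟩
    exact ⟨fun w => (hw w.1).1 w.2, fun w => (hw w).2⟩

variable (D : Measure (Fin d → ℝ)) [IsProbabilityMeasure D] (c : ℝ)

instance : IsProbabilityMeasure (FBP D c) := by
  unfold FBP; infer_instance

lemma agree_eq_prod (ε : ℝ) (r : ℕ) (T₀ : TreeCode d) :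
    agree ε r T₀ =
      (Set.pi ((Finset.univ : Finset (Inner T₀.1 r)).image fun w => w.1.1 : Finset (List ℕ))
        fun w => {T₀.1 w}) ×ˢ
      (Set.pi ((Finset.univ : Finset (nodes T₀.1 r)).image fun w => w.1 : Finset (List ℕ))
        fun w => {x | gridCell ε x = gridCell ε (T₀.2 w)}) := by
  ext T
  simp only [agree, Set.mem_ofPred_eq, Set.mem_prod, Set.mem_pi, Finset.mem_coe, Finset.mem_image,
    Finset.mem_univ, true_and, Set.mem_singleton_iff, forall_exists_index,
    forall_apply_eq_imp_iff]

lemma measurableSet_gridCell_eq (ε : ℝ) (l : Fin d → ℤ) :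
    MeasurableSet {x : Fin d → ℝ | gridCell ε x = l} :=
  measurable_gridCell ε (MeasurableSet.singleton l)

lemma measurableSet_agree (ε : ℝ) (r : ℕ) (T₀ : TreeCode d) : MeasurableSet (agree ε r T₀) := by
  rw [agree_eq_prod]
  exact (MeasurableSet.pi (Finset.countable_toSet _) fun w _ => MeasurableSet.singleton _).prod
    (MeasurableSet.pi (Finset.countable_toSet _) fun w _ => measurableSet_gridCell_eq ε _)

/-- Each inner individual with `j` children contributes the Poisson weight `exp (-c) * c ^ j / j!`,
and the numbers of children add up to the number of individuals minus one. The right-hand side is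
written in the form of the limit constant in `tendsto_real_eventCount_le`. -/
lemma FBP_real_agree (hc : 0 ≤ c) (ε : ℝ) (r : ℕ) (T₀ : TreeCode d) :
    (FBP D c).real (agree ε r T₀) = 1 / (∏ w : Inner T₀.1 r, (T₀.1 w.1.1).factorial : ℕ) *
      c ^ (Fintype.card (nodes T₀.1 r) - 1) *
      Real.exp (-c) ^ {w | (nodeGraph T₀.1 r).dist (rootNode T₀.1 r) w < r}.ncard *
      ∏ w : nodes T₀.1 r, D.real {x | gridCell ε x = gridCell ε (T₀.2 w.1)} := by
  classical
  rw [agree_eq_prod, FBP, measureReal_prod_prod, measureReal_def, measureReal_def,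
    Measure.infinitePi_pi _ (fun w _ => MeasurableSet.singleton _),
    Measure.infinitePi_pi _ (fun w _ => measurableSet_gridCell_eq ε _),
    Finset.prod_image (fun a _ b _ h => Subtype.ext (Subtype.ext h)),
    Finset.prod_image (fun a _ b _ h => Subtype.ext h), ENNReal.toReal_prod, ENNReal.toReal_prod]
  simp only [← measureReal_def, poissonMeasure_real_singleton, Real.coe_toNNReal c hc]
  congr 1
  rw [Finset.prod_div_distrib, Finset.prod_mul_distrib, Finset.prod_const, Finset.prod_pow_eq_pow_sum,
    card_nodes, Nat.add_sub_cancel, Finset.card_univ]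
  have : {w | (nodeGraph T₀.1 r).dist (rootNode T₀.1 r) w < r}.ncard =
      Fintype.card (Inner T₀.1 r) := by
    simp only [nodeGraph_dist]
    rw [← Nat.card_coe_set_eq, ← Nat.card_eq_fintype_card]
    rfl
  rw [this]
  push_cast
  ring

/-- Finitely many classes of coded trees carry almost all of the mass of `FBP`. -/
lemma exists_finset_codes (ε : ℝ) (r : ℕ) {δ : ℝ} (hδ : 0 < δ) :
    ∃ S : Finset (TreeCode d), Set.InjOn (key (d := d) ε r) (S : Set (TreeCode d)) ∧
      1 - δ ≤ ∑ T ∈ S, (FBP D c).real (agree ε r T) := by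
  classical
  have hfib : ∀ q : Finset (List ℕ × ℕ × (Fin d → ℤ)),
      key ε r ⁻¹' {q} = ∅ ∨ ∃ T : TreeCode d, key ε r T = q ∧ key ε r ⁻¹' {q} = agree ε r T := by
    intro q
    rcases (key (d := d) ε r ⁻¹' {q}).eq_empty_or_nonempty with h | ⟨T, hT⟩
    · exact Or.inl h
    · refine Or.inr ⟨T, hT, ?_⟩
      ext T'
      rw [mem_agree_iff_key]
      simp only [Set.mem_preimage, Set.mem_singleton_iff] at hT ⊢
      rw [hT]
  have hmeas : ∀ q : Finset (List ℕ × ℕ × (Fin d → ℤ)),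
      MeasurableSet (key (d := d) ε r ⁻¹' {q}) := by
    intro q
    rcases hfib q with h | ⟨T, -, h⟩
    · rw [h]; exact .empty
    · rw [h]; exact measurableSet_agree ε r T
  -- Keys form a countable type, so the masses of the fibres sum to `1` and a finite partial sum
  -- exceeds `1 - δ`.
  have hsum := tsum_measure_preimage_singleton (μ := FBP D c) (s := Set.univ)
    (Set.countable_univ) (f := key (d := d) ε r) fun q _ => hmeas q
  rw [Set.preimage_univ, measure_univ, tsum_univ (f := fun q => FBP D c (key ε r ⁻¹' {q}))] at hsum
  have hhas : HasSum (fun q => FBP D c (key ε r ⁻¹' {q})) 1 := hsum ▸ ENNReal.summable.hasSum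
  have hev := hhas.eventually_const_lt (show ENNReal.ofReal (1 - δ) < 1 from
    ENNReal.ofReal_lt_one.2 (by linarith))
  obtain ⟨s, hs⟩ := hev.exists
  choose! rep hrep using fun (q : Finset (List ℕ × ℕ × (Fin d → ℤ)))
    (hq : (key (d := d) ε r ⁻¹' {q}) ≠ ∅) => (hfib q).resolve_left hq
  set s' := s.filter fun q => (key (d := d) ε r ⁻¹' {q}) ≠ ∅
  have hs' : ∀ q ∈ s', key ε r (rep q) = q := fun q hq => (hrep q (Finset.mem_filter.1 hq).2).1
  have hinj : Set.InjOn rep s' := fun a ha b hb h => by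
    rw [← hs' a ha, ← hs' b hb, h]
  refine ⟨s'.image rep, ?_, ?_⟩
  · intro a ha b hb h
    rw [Finset.mem_coe, Finset.mem_image] at ha hb
    obtain ⟨q, hq, rfl⟩ := ha
    obtain ⟨q', hq', rfl⟩ := hb
    rw [hs' q hq, hs' q' hq'] at h
    rw [h]
  · rw [Finset.sum_image hinj]
    have h1 : ∑ q ∈ s, FBP D c (key ε r ⁻¹' {q}) = ∑ q ∈ s', FBP D c (agree ε r (rep q)) := by
      rw [← Finset.sum_subset (Finset.filter_subset
        (fun q => (key (d := d) ε r ⁻¹' {q}) ≠ ∅) s) fun q hq hq' => ?_]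
      · exact Finset.sum_congr rfl fun q hq => by rw [(hrep q (Finset.mem_filter.1 hq).2).2]
      · have : key (d := d) ε r ⁻¹' {q} = ∅ := by
          by_contra h
          exact hq' (Finset.mem_filter.2 ⟨hq, h⟩)
        rw [this, measure_empty]
    rw [h1] at hs
    have h2 : ∑ q ∈ s', (FBP D c).real (agree ε r (rep q)) =
        (∑ q ∈ s', FBP D c (agree ε r (rep q))).toReal :=
      (ENNReal.toReal_sum fun q _ => measure_ne_top _ _).symm
    rw [h2]
    refine (ENNReal.ofReal_le_iff_le_toReal ?_).1 hs.le
    exact ENNReal.sum_ne_top.2 fun q _ => measure_ne_top _ _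

end TreeCode

/-! ### Calculus of events that hold asymptotically almost surely -/

section AAS

variable {d : ℕ} {D : Measure (Fin d → ℝ)} {c : ℝ}

/-- The events `S n` hold asymptotically almost surely. -/
def IsAAS (D : Measure (Fin d → ℝ)) (c : ℝ)
    (S : ∀ n, Set (SimpleGraph (Fin n) × (Fin n → Fin d → ℝ))) : Prop :=
  Tendsto (fun n => randomFeaturedGraph D c n (S n)ᶜ) atTop (𝓝 0)

lemma IsAAS.mono {S S' : ∀ n, Set (SimpleGraph (Fin n) × (Fin n → Fin d → ℝ))}
    (h : IsAAS D c S) (hS : ∀ᶠ n in atTop, S n ⊆ S' n) : IsAAS D c S' :=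
  tendsto_of_tendsto_of_tendsto_of_le_of_le' tendsto_const_nhds h
    (Eventually.of_forall fun _ => zero_le)
    (hS.mono fun _ hn => measure_mono (Set.compl_subset_compl.2 hn))

lemma IsAAS.inter {S S' : ∀ n, Set (SimpleGraph (Fin n) × (Fin n → Fin d → ℝ))}
    (h : IsAAS D c S) (h' : IsAAS D c S') : IsAAS D c fun n => S n ∩ S' n := by
  have := Tendsto.add h h'
  rw [add_zero] at this
  refine tendsto_of_tendsto_of_tendsto_of_le_of_le tendsto_const_nhds this
    (fun _ => zero_le) fun n => ?_
  simp only [Set.compl_inter]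
  exact measure_union_le _ _

lemma IsAAS.biInter {ι : Type*} (s : Finset ι)
    {S : ι → ∀ n, Set (SimpleGraph (Fin n) × (Fin n → Fin d → ℝ))}
    (h : ∀ i ∈ s, IsAAS D c (S i)) : IsAAS D c fun n => ⋂ i ∈ s, S i n := by
  have := tendsto_finsetSum s h
  rw [Finset.sum_const_zero] at this
  refine tendsto_of_tendsto_of_tendsto_of_le_of_le tendsto_const_nhds this
    (fun _ => zero_le) fun n => ?_
  simp only [Set.compl_iInter]
  exact measure_biUnion_finset_le _ _

lemma isAAS_of_real [IsProbabilityMeasure D]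
    {S : ∀ n, Set (SimpleGraph (Fin n) × (Fin n → Fin d → ℝ))}
    (h : Tendsto (fun n => (randomFeaturedGraph D c n).real (S n)ᶜ) atTop (𝓝 0)) :
    IsAAS D c S := by
  have := ENNReal.tendsto_ofReal h
  simpa [IsAAS] using this

end AAS

/-! ### From ball embeddings to similarity of balls and coded trees -/

namespace MRFG

variable {d m : ℕ}

lemma exists_equiv_ball (G : MRFG d m) {W : Type*} {H : SimpleGraph W} {ρ : W} {r : ℕ}
    {φ : W → G.V} (h : IsBallEmb H ρ r G.graph φ) (hc : H.Connected)
    (hr : ∀ w, H.dist ρ w ≤ r) (v : G.V) (hv : φ ρ = v) :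
    ∃ e : (G.ball r v).V ≃ W, (∀ x y, H.Adj (e x) (e y) ↔ (G.ball r v).graph.Adj x y) ∧
      (∀ i, e ((G.ball r v).root i) = ρ) ∧ ∀ x, (G.ball r v).feat x = G.feat (φ (e x)) := by
  subst hv
  have hset : Set.range φ = G.ballSet r (φ ρ) := (h.setOf_edist_le hc hr).symm
  let e₀ : W ≃ G.ballSet r (φ ρ) := (Equiv.ofInjective φ h.1).trans (Equiv.setCongr hset)
  have he : ∀ w, (e₀ w : G.V) = φ w := fun w => rfl
  have hx : ∀ x : G.ballSet r (φ ρ), (x : G.V) = φ (e₀.symm x) := fun x =>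
    (congrArg Subtype.val (e₀.apply_symm_apply x)).symm
  refine ⟨e₀.symm, fun x y => ?_, fun i => ?_, fun x => congrArg G.feat (hx x)⟩
  · rw [← h.2.1]
    exact iff_of_eq (congrArg₂ G.graph.Adj (hx x).symm (hx y).symm)
  · exact (e₀.symm_apply_eq).2 (Subtype.ext (he ρ).symm)

lemma Sim.of_isBallEmb {ε₁ ε₂ η : ℝ} {k r : ℕ} {G : MRFG d m} {T T' : MRFG d 1}
    {φ : T.V → G.V} (h : IsBallEmb T.graph (T.root 0) r G.graph φ) (hc : T.graph.Connected)
    (hr : T.HeightLE r) (hf : ∀ w, ‖G.feat (φ w) - T.feat w‖ ≤ ε₁) (hs : Sim ε₂ η k T T') :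
    Sim (ε₁ + ε₂) η k (G.ball r (φ (T.root 0))) T' := by
  obtain ⟨e, he1, he2, he3⟩ := G.exists_equiv_ball h hc hr _ rfl
  refine Sim.of_equiv (H := T) e he1 (fun i => ?_) (fun x => ?_) hs
  · rw [he2, Subsingleton.elim i 0]
  · rw [he3]
    exact hf _

end MRFG

namespace TreeCode

variable {d : ℕ}

/-- The event that `φ` embeds the first `r` generations of `T` as a ball, up to the mesh `ε`. -/
def codeEvent (ε : ℝ) (r : ℕ) (T : TreeCode d) {n : ℕ} (φ : nodes T.1 r → Fin n) :
    Set (SimpleGraph (Fin n) × (Fin n → Fin d → ℝ)) :=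
  featBallEvent (nodeGraph T.1 r) (rootNode T.1 r) r
    (fun w => {x | gridCell ε x = gridCell ε (T.2 w.1)}) φ

/-- The vertices whose `r`-ball looks like the first `r` generations of `T`. -/
def ballVertices (ε : ℝ) (r : ℕ) (T : TreeCode d) {n : ℕ}
    (x : SimpleGraph (Fin n) × (Fin n → Fin d → ℝ)) : Set (Fin n) :=
  {v | ∃ φ ∈ orderedMaps T.1 r n, φ (rootNode T.1 r) = v ∧ x ∈ codeEvent ε r T φ}

variable {ε : ℝ} {r n : ℕ} {T T' : TreeCode d} {x : SimpleGraph (Fin n) × (Fin n → Fin d → ℝ)}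

/-- The ball and the numbering of its vertices determine the code up to rounding. Inequivalent codes
thus have disjoint sets of vertices, as the coupling requires. -/
lemma mem_agree_of_mem_ballVertices {v : Fin n} (h : v ∈ ballVertices ε r T x)
    (h' : v ∈ ballVertices ε r T' x) : T' ∈ agree ε r T := by
  obtain ⟨φ, hφ, hr, hx⟩ := h
  obtain ⟨φ', hφ', hr', hx'⟩ := h'
  have key := IsOrdered.unique hx.1 hx'.1 (mem_orderedMaps.1 hφ).2 (mem_orderedMaps.1 hφ').2
    (hr.trans hr'.symm)
  refine ⟨fun w => ?_, fun w => ?_⟩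
  · obtain ⟨_, -, h⟩ := key w.1.1 w.1.2
    exact (h w.2).symm
  · obtain ⟨hw, h, -⟩ := key w.1 w.2
    have h1 : gridCell ε (x.2 (φ w)) = gridCell ε (T.2 w.1) := hx.2 w
    have h2 : gridCell ε (x.2 (φ' ⟨w.1, hw⟩)) = gridCell ε (T'.2 w.1) := hx'.2 ⟨w.1, hw⟩
    rw [← h1, ← h2]
    exact congrArg (fun v => gridCell ε (x.2 v)) h.symm

/-- Ordered embeddings with the same root image coincide, so counting embeddings amounts to counting
vertices. -/
lemma eventCount_le_ncard_ballVertices :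
    eventCount (fun φ : orderedMaps T.1 r n => codeEvent ε r T φ.1) x ≤
      (ballVertices ε r T x).ncard := by
  classical
  rw [eventCount, ← Set.ncard_coe_finset]
  refine Set.ncard_le_ncard_of_injOn (fun φ => φ.1 (rootNode T.1 r)) ?_ ?_ (Set.toFinite _)
  · intro φ hφ
    exact ⟨φ.1, φ.2, rfl, by simpa using hφ⟩
  · intro φ hφ φ' hφ' h
    have h1 : x ∈ codeEvent ε r T φ.1 := by simpa using hφ
    have h2 : x ∈ codeEvent ε r T φ'.1 := by simpa using hφ'
    refine Subtype.ext (funext fun w => ?_)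
    obtain ⟨_, h, -⟩ := IsOrdered.unique h1.1 h2.1 (mem_orderedMaps.1 φ.2).2
      (mem_orderedMaps.1 φ'.2).2 h w.1 w.2
    exact h

lemma sim_of_mem_ballVertices (hε : 0 < ε) {η : ℝ} (hη : 0 ≤ η) (k : ℕ) {v : Fin n}
    (h : v ∈ ballVertices ε r T x) (h' : T' ∈ agree ε r T) :
    MRFG.Sim ε η k ((MRFG.ofPair x).ball r v) (T'.restrict r) := by
  obtain ⟨φ, -, hv, hx⟩ := h
  have hn := nodes_eq_of_mem_agree h'
  obtain ⟨e, he1, he2, he3⟩ := (MRFG.ofPair x).exists_equiv_ball hx.1 (nodeGraph_connected _ _)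
    (fun w => by rw [nodeGraph_dist]; exact w.2.2) v hv
  have hadj : ∀ u u' : nodes T.1 r, (nodeGraph T'.1 r).Adj (Equiv.setCongr hn.symm u)
      (Equiv.setCongr hn.symm u') ↔ (nodeGraph T.1 r).Adj u u' := fun u u' => by
    rw [nodeGraph_adj, nodeGraph_adj]
    rfl
  refine MRFG.Sim.of_near_iso hη (e.trans (Equiv.setCongr hn.symm)) (fun y z => ?_) (fun i => ?_)
    fun y => ?_
  · rw [← he1]
    exact hadj _ _
  · exact congrArg (Equiv.setCongr hn.symm) (he2 i)
  · rw [he3]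
    have h1 : gridCell ε (x.2 (φ (e y))) = gridCell ε (T.2 (e y).1) := hx.2 (e y)
    have h2 : gridCell ε (T'.2 (e y).1) = gridCell ε (T.2 (e y).1) := h'.2 (e y)
    exact norm_sub_le_of_gridCell_eq hε (h1.trans h2.symm)

variable (D : Measure (Fin d → ℝ)) [IsProbabilityMeasure D] (c : ℝ)

/-- The event that about the expected number of balls look like `T`. -/
def goodEvent (ε : ℝ) (r : ℕ) (δ : ℝ) (T : TreeCode d) (n : ℕ) :
    Set (SimpleGraph (Fin n) × (Fin n → Fin d → ℝ)) :=
  {x | ((FBP D c).real (agree ε r T) - δ) * n ≤ (ballVertices ε r T x).ncard}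

/-- The count of ordered embeddings has limit density `1 / ∏ (number of children)!` among all maps,
which turns the limit constant into the probability given by `FBP_real_agree`. -/
lemma isAAS_goodEvent (hc : 0 < c) (ε : ℝ) (r : ℕ) {δ : ℝ} (hδ : 0 < δ) (T : TreeCode d) :
    IsAAS D c (goodEvent D c ε r δ T) := by
  have h := tendsto_real_eventCount_le D hc (nodeGraph_isTree T.1 r)
    (ρ := rootNode T.1 r) (r := r) (fun w => by rw [nodeGraph_dist]; exact w.2.2)
    (C := fun w => {x | gridCell ε x = gridCell ε (T.2 w.1)})
    (fun w => measurableSet_gridCell_eq ε _) (orderedMaps T.1 r)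
    (fun n φ hφ => (mem_orderedMaps.1 hφ).1)
    (fun n => (n.descFactorial (Fintype.card (nodes T.1 r)) : ℝ) /
      (∏ w : Inner T.1 r, (T.1 w.1.1).factorial : ℕ)) (fun n => ?_)
    (1 / (∏ w : Inner T.1 r, (T.1 w.1.1).factorial : ℕ)) ?_ δ hδ
  · rw [← FBP_real_agree D c hc.le] at h
    refine (isAAS_of_real (S := fun n => {x | (eventCount (fun φ : orderedMaps T.1 r n =>
      codeEvent ε r T φ.1) x : ℝ) ≤ ((FBP D c).real (agree ε r T) - δ) * n}ᶜ) ?_).mono ?_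
    · simp only [compl_compl]
      exact h
    · refine Eventually.of_forall fun n x hx => ?_
      simp only [Set.mem_compl_iff, Set.mem_ofPred_eq, not_le] at hx
      exact hx.le.trans (by exact_mod_cast eventCount_le_ncard_ballVertices)
  · have hpos : 0 < ∏ w : Inner T.1 r, (T.1 w.1.1).factorial :=
      Finset.prod_pos fun w _ => Nat.factorial_pos _
    rw [div_le_iff₀ (by exact_mod_cast hpos)]
    exact_mod_cast descFactorial_le_card_orderedMaps T.1 r n
  · have := (tendsto_descFactorial_div_pow (Fintype.card (nodes T.1 r))).div_const
      ((∏ w : Inner T.1 r, (T.1 w.1.1).factorial : ℕ) : ℝ)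
    refine this.congr fun n => ?_
    rw [div_right_comm]

open scoped ENNReal in
lemma isCloseToFBP_of_mem_goodEvent (hε : 0 < ε) {η : ℝ} (hη : 0 < η) (k : ℕ) (hn : 0 < n)
    {S : Finset (TreeCode d)} (hS : Set.InjOn (key (d := d) ε r) (S : Set (TreeCode d)))
    (hSum : 1 - η / 2 ≤ ∑ T ∈ S, (FBP D c).real (agree ε r T)) {δ : ℝ}
    (hδ0 : 0 ≤ δ) (hδ : S.card * δ ≤ η / 2)
    (hx : ∀ T ∈ S, x ∈ goodEvent D c ε r δ T n) :
    (MRFG.ofPair x).IsCloseToFBP D c k ε η r := by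
  let _ : Fintype (MRFG.ofPair x).V := inferInstanceAs (Fintype (Fin n))
  have hne : Nonempty (MRFG.ofPair x).V := ⟨(⟨0, hn⟩ : Fin n)⟩
  have hn' : (0 : ℝ) < n := by exact_mod_cast hn
  have hP : IsProbabilityMeasure (uniformOn (Set.univ : Set (MRFG.ofPair x).V)) :=
    isProbabilityMeasure_uniformOn Set.finite_univ Set.univ_nonempty
  have hE : ∀ A : Set (MRFG.ofPair x).V,
      (uniformOn (Set.univ : Set (MRFG.ofPair x).V)) A = ENNReal.ofReal (A.ncard / n) := by
    intro A
    have hcard : Fintype.card (MRFG.ofPair x).V = n := Fintype.card_fin n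
    rw [uniformOn_univ, Measure.count_apply .of_discrete, hcard, ENNReal.ofReal_div_of_pos hn',
      ENNReal.ofReal_natCast, ENNReal.ofReal_natCast, ← Set.Finite.cast_ncard_eq A.toFinite]
    rfl
  let B : TreeCode d → Set (MRFG.ofPair x).V := fun T => ballVertices ε r T x
  obtain ⟨γ, hγ, hle⟩ := exists_coupling_of_labels (uniformOn (Set.univ : Set (MRFG.ofPair x).V))
    (FBP D c) S B (fun T => agree ε r T) (fun _ _ => .of_discrete)
    (fun T _ => measurableSet_agree ε r T)
    (fun T hT T' hT' hne => Set.disjoint_left.2 fun v hv hv' => hne (hS hT hT'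
      (mem_agree_iff_key.1 (mem_agree_of_mem_ballVertices hv hv')).symm))
    (fun T hT T' hT' hne => Set.disjoint_left.2 fun v hv hv' => hne (hS hT hT'
      ((mem_agree_iff_key.1 hv).symm.trans (mem_agree_iff_key.1 hv'))))
  refine ⟨γ, hγ, ?_⟩
  have hγP : IsProbabilityMeasure γ := by
    refine ⟨?_⟩
    rw [← Set.preimage_univ (f := Prod.fst), ← Measure.map_apply measurable_fst .univ, hγ.1,
      measure_univ]
  have hlow : ENNReal.ofReal (1 - η) ≤
      γ (⋃ T ∈ S, B T ×ˢ agree ε r T) := by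
    refine le_trans ?_ hle
    have h1 : ∀ T ∈ S, ENNReal.ofReal ((FBP D c).real (agree ε r T) - δ) ≤
        min (uniformOn (Set.univ : Set (MRFG.ofPair x).V) (B T))
          (FBP D c (agree ε r T)) := by
      intro T hT
      refine le_min ?_ ?_
      · refine (ENNReal.ofReal_le_ofReal ?_).trans_eq (hE (B T)).symm
        rw [le_div_iff₀ hn']
        exact hx T hT
      · exact (ENNReal.ofReal_le_ofReal (sub_le_self _ hδ0)).trans (by simp)
    refine le_trans ?_ (Finset.sum_le_sum h1)
    -- The loss is at most `η / 2` from trees outside `S` and `S.card * δ ≤ η / 2` from the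
    -- frequencies. The maximum with `0` reflects the truncation in `ENNReal.ofReal`.
    have h2 : 1 - η ≤ ∑ T ∈ S, max ((FBP D c).real (agree ε r T) - δ) 0 := by
      refine le_trans ?_ (Finset.sum_le_sum fun T _ => le_max_left _ _)
      rw [Finset.sum_sub_distrib, Finset.sum_const, nsmul_eq_mul]
      linarith
    refine (ENNReal.ofReal_le_ofReal h2).trans (le_of_eq ?_)
    rw [ENNReal.ofReal_sum_of_nonneg fun _ _ => le_max_right _ _]
    simp
  have hmeas : MeasurableSet
      (⋃ T ∈ S, B T ×ˢ agree ε r T) :=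
    Finset.measurableSet_biUnion _ fun T _ =>
      MeasurableSet.prod .of_discrete (measurableSet_agree ε r T)
  refine (measure_mono (t := (⋃ T ∈ S,
    B T ×ˢ agree ε r T)ᶜ) ?_).trans ?_
  · intro y hy hy'
    simp only [Set.mem_iUnion] at hy'
    obtain ⟨T, hT, h1, h2⟩ := hy'
    exact hy (sim_of_mem_ballVertices hε hη.le k h1 h2)
  · rw [prob_compl_eq_one_sub hmeas]
    refine (tsub_le_tsub_left hlow 1).trans ?_
    rw [tsub_le_iff_right]
    -- Subadditivity also covers `η > 1`, where `ENNReal.ofReal (1 - η)` is `0`.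
    refine le_trans ?_ ENNReal.ofReal_add_le
    simp

end TreeCode

/-! ### Similarity to the branching process -/

section Similar

variable {d : ℕ} (D : Measure (Fin d → ℝ)) [IsProbabilityMeasure D] {c : ℝ}

/-- A finite family of classes of trees that describes almost all balls. -/
lemma exists_isAAS_goodEvents (hc : 0 < c) (ε : ℝ) (r : ℕ) {η : ℝ} (hη : 0 < η) :
    ∃ (S : Finset (TreeCode d)) (δ : ℝ), Set.InjOn (TreeCode.key (d := d) ε r)
        (S : Set (TreeCode d)) ∧
      1 - η / 2 ≤ ∑ T ∈ S, (FBP D c).real (TreeCode.agree ε r T) ∧ 0 ≤ δ ∧ S.card * δ ≤ η / 2 ∧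
      IsAAS D c fun n => {x | 0 < n ∧ ∀ T ∈ S, x ∈ TreeCode.goodEvent D c ε r δ T n} := by
  obtain ⟨S, hS, hsum⟩ := TreeCode.exists_finset_codes D c ε r (half_pos hη)
  -- The summand `1` keeps the quotient meaningful when `S` is empty.
  have hδ : 0 < η / 2 / (S.card + 1) := by positivity
  refine ⟨S, η / 2 / (S.card + 1), hS, hsum, hδ.le, ?_, ?_⟩
  · rw [mul_div_assoc', div_le_iff₀ (by positivity)]
    nlinarith
  · refine (IsAAS.biInter S fun T _ => TreeCode.isAAS_goodEvent D c hc ε r hδ T).mono ?_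
    filter_upwards [eventually_gt_atTop 0] with n hn x hx
    simp only [Set.mem_iInter] at hx
    exact ⟨hn, hx⟩

lemma isAAS_isSimilarToFBP (hc : 0 < c) (k r : ℕ) {ε η : ℝ} (hε : 0 < ε) (hη : 0 < η) :
    IsAAS D c fun n => {x : SimpleGraph (Fin n) × (Fin n → Fin d → ℝ) |
      (MRFG.ofPair x).IsSimilarToFBP D c k ε η r} := by
  have h : ∀ r' ∈ Finset.range (r + 1), IsAAS D c fun n =>
      {x : SimpleGraph (Fin n) × (Fin n → Fin d → ℝ) |
        (MRFG.ofPair x).IsCloseToFBP D c k ε η r'} := by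
    intro r' _
    obtain ⟨S, δ, hS, hsum, hδ0, hδ, h⟩ := exists_isAAS_goodEvents D hc ε r' hη
    refine h.mono (Eventually.of_forall fun n x hx => ?_)
    exact TreeCode.isCloseToFBP_of_mem_goodEvent D c hε hη k hx.1 hS hsum hδ0 hδ hx.2
  refine (IsAAS.biInter _ h).mono (Eventually.of_forall fun n x hx => ?_)
  simp only [Set.mem_iInter] at hx
  exact fun r' hr' => hx r' (by simp; omega)

/-- For all but few vertices the `R`-ball is acyclic. -/
lemma isAAS_ball_isAcyclic (hc : 0 < c) (R : ℕ) {η : ℝ} (hη : 0 < η) :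
    IsAAS D c fun n => {x : SimpleGraph (Fin n) × (Fin n → Fin d → ℝ) |
      ({v | ¬ ((MRFG.ofPair x).ball R v).graph.IsAcyclic}.ncard : ℝ) ≤ η * n} := by
  -- Features are irrelevant here, so any positive mesh would do. Nearly all `R`-balls are copies of
  -- coded trees, hence acyclic.
  obtain ⟨S, δ, hS, hsum, hδ0, hδ, h⟩ := exists_isAAS_goodEvents D hc 1 R hη
  refine h.mono (Eventually.of_forall fun n x ⟨hn, hx⟩ => ?_)
  classical
  set B : Set (Fin n) := ⋃ T ∈ S, TreeCode.ballVertices 1 R T x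
  have hsub : ({v | ¬ ((MRFG.ofPair x).ball R v).graph.IsAcyclic} : Set (Fin n)) ⊆ Bᶜ := by
    intro v hv hvB
    simp only [B, Set.mem_iUnion] at hvB
    obtain ⟨T, hT, φ, -, hφ, hxφ⟩ := hvB
    obtain ⟨e, he1, -, -⟩ := (MRFG.ofPair x).exists_equiv_ball hxφ.1
      (TreeCode.nodeGraph_connected _ _) (fun w => by rw [TreeCode.nodeGraph_dist]; exact w.2.2)
      v hφ
    let f : ((MRFG.ofPair x).ball R v).graph →g TreeCode.nodeGraph T.1 R :=
      ⟨e, fun {a b} hab => (he1 a b).2 hab⟩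
    exact hv ((TreeCode.nodeGraph_isTree T.1 R).isAcyclic.comap f e.injective)
  have hB : (B.ncard : ℝ) = ∑ T ∈ S, ((TreeCode.ballVertices 1 R T x).ncard : ℝ) := by
    have h1 : B = ((S.biUnion fun T => (TreeCode.ballVertices 1 R T x).toFinset :
        Finset (Fin n)) : Set (Fin n)) := by
      simp [B]
    rw [h1, Set.ncard_coe_finset, Finset.card_biUnion]
    · push_cast
      exact Finset.sum_congr rfl fun T _ => by rw [Set.ncard_eq_toFinset_card']
    · intro T hT T' hT' hne
      refine Finset.disjoint_left.2 fun v hv hv' => ?_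
      exact hne (hS hT hT' (TreeCode.mem_agree_iff_key.1 (TreeCode.mem_agree_of_mem_ballVertices
        (by simpa using hv) (by simpa using hv'))).symm)
  have hlow : (1 - η) * n ≤ B.ncard := by
    rw [hB]
    refine le_trans ?_ (Finset.sum_le_sum fun T hT => hx T hT)
    rw [← Finset.sum_mul, Finset.sum_sub_distrib, Finset.sum_const, nsmul_eq_mul]
    exact mul_le_mul_of_nonneg_right (by linarith) (Nat.cast_nonneg _)
  have hcompl : (Bᶜ.ncard : ℝ) = n - B.ncard := by
    have := Set.ncard_add_ncard_compl B
    rw [Nat.card_fin] at this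
    rw [eq_sub_iff_add_eq, add_comm]
    exact_mod_cast this
  have hle : (({v | ¬ ((MRFG.ofPair x).ball R v).graph.IsAcyclic} : Set (Fin n)).ncard : ℝ) ≤
      Bᶜ.ncard := by
    exact_mod_cast Set.ncard_le_ncard hsub (Set.toFinite _)
  refine hle.trans ?_
  rw [hcompl]
  linarith

end Similar

/-- A cycle of length at most `L` through a vertex at distance at most `R` from `v` lies within
distance `R + L` of `v`. Acyclic balls thus keep short cycles away. -/
lemma MRFG.ball_not_isAcyclic {d m : ℕ} (G : MRFG d m) {R L : ℕ} {v w : G.V}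
    (hw : w ∈ G.cycleVertices L) (hd : G.graph.edist v w ≤ R) :
    ¬ (G.ball (R + L) v).graph.IsAcyclic := by
  classical
  obtain ⟨p, hp, hl⟩ := hw
  have hs : ∀ u ∈ p.support, u ∈ G.ballSet (R + L) v := by
    intro u hu
    have h1 : G.graph.edist w u ≤ L :=
      (SimpleGraph.edist_le (p.takeUntil u hu)).trans
        (by exact_mod_cast (p.length_takeUntil_le_length hu).trans hl)
    calc G.graph.edist v u ≤ _ := SimpleGraph.edist_triangle (v := w)
      _ ≤ (R : ℕ∞) + L := add_le_add hd h1
      _ = _ := by push_cast; rfl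
  intro hac
  have hcyc : (p.induce (G.ballSet (R + L) v) hs).IsCycle := by
    rw [← SimpleGraph.Walk.isCycle_map_iff_of_injective
      (f := (SimpleGraph.Embedding.induce (G := G.graph) (G.ballSet (R + L) v)).toHom)
      Subtype.val_injective, SimpleGraph.Walk.map_induce]
    exact hp
  exact hac _ hcyc

/-! ### Small balls, few short cycles, small degrees; homogeneity -/

section GraphEvents

variable {d : ℕ} {D : Measure (Fin d → ℝ)} [IsProbabilityMeasure D] {c : ℝ}

lemma isAAS_of_graph {S : ∀ n, Set (SimpleGraph (Fin n))}
    (h : Tendsto (fun n => (SimpleGraph.binomialRandom (Fin n) (edgeProb c n)).real (S n)ᶜ)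
      atTop (𝓝 0)) : IsAAS D c fun n => {x | x.1 ∈ S n} := by
  refine isAAS_of_real (h.congr fun n => ?_)
  have : ({x : SimpleGraph (Fin n) × (Fin n → Fin d → ℝ) | x.1 ∈ S n})ᶜ =
      (S n)ᶜ ×ˢ Set.univ := by
    ext x; simp
  rw [this, randomFeaturedGraph, measureReal_prod_prod]
  simp

lemma eventCount_eq_ncard {Ω ι : Type*} [Fintype ι] (A : ι → Set Ω) (x : Ω) :
    eventCount A x = {i | x ∈ A i}.ncard := by
  classical
  rw [eventCount, ← Set.ncard_coe_finset]
  simp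

/-- All balls of a given radius are small. -/
lemma isAAS_ncard_ball_le (hc : 0 < c) (R : ℕ) {δ : ℝ} (hδ : 0 < δ) :
    IsAAS D c fun n => {x | ∀ v, ({w | x.1.edist v w ≤ R}.ncard : ℝ) ≤ δ * n} := by
  have hb : ∀ᶠ n : ℕ in atTop, (SimpleGraph.binomialRandom (Fin n) (edgeProb c n)).real
      {G | ∀ v, ({w | G.edist v w ≤ R}.ncard : ℝ) ≤ δ * n}ᶜ ≤
      (∑ l ∈ Finset.range (2 * R + 1), c ^ l) / δ ^ 2 / n := by
    filter_upwards [eventually_edgeProb c hc.le] with n ⟨hn, _, hp⟩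
    have hn' : (0 : ℝ) < n := by exact_mod_cast hn
    -- An `R`-ball with more than `δ * n` vertices contains more than `(δ * n) ^ 2` ordered pairs at
    -- distance at most `2 * R`, whereas only `O(n)` such pairs are expected.
    have h1 := measureReal_eventCount_ge_le (SimpleGraph.binomialRandom (Fin n) (edgeProb c n))
      (A := fun x : Fin n × Fin n => {G | G.edist x.1 x.2 ≤ (2 * R : ℕ)})
      (fun _ => .of_discrete) (t := (δ * n) ^ 2) (by positivity)
    have h2 := sum_binomialRandom_edist_le (V := Fin n) (edgeProb c n) (2 * R)
    refine (measureReal_mono ?_).trans (h1.trans ?_)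
    · intro G hG
      simp only [Set.mem_compl_iff, Set.mem_ofPred_eq, not_forall, not_le] at hG
      obtain ⟨v, hv⟩ := hG
      simp only [Set.mem_ofPred_eq, eventCount_eq_ncard]
      have hsub : {w | G.edist v w ≤ R} ×ˢ {w | G.edist v w ≤ R} ⊆
          {x : Fin n × Fin n | G.edist x.1 x.2 ≤ (2 * R : ℕ)} := by
        rintro ⟨a, b⟩ ⟨ha, hb⟩
        simp only [Set.mem_ofPred_eq] at ha hb ⊢
        rw [SimpleGraph.edist_comm] at ha
        calc G.edist a b ≤ _ := SimpleGraph.edist_triangle (v := v)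
          _ ≤ (R : ℕ∞) + R := add_le_add ha hb
          _ = _ := by push_cast; ring
      have hcard := Set.ncard_le_ncard hsub (Set.toFinite _)
      rw [Set.ncard_prod, ← sq] at hcard
      calc (δ * n) ^ 2 ≤ ({w | G.edist v w ≤ R}.ncard : ℝ) ^ 2 :=
            pow_le_pow_left₀ (by positivity) hv.le 2
        _ ≤ _ := by exact_mod_cast hcard
    · refine (div_le_div_of_nonneg_right h2 (by positivity)).trans (le_of_eq ?_)
      rw [Fintype.card_fin, hp]
      have : ∀ l, (n : ℝ) ^ (l + 1) * (c / n) ^ l = n * c ^ l := fun l => by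
        rw [div_pow, pow_succ]; field_simp
      simp_rw [this]
      rw [← Finset.mul_sum]
      field_simp
  refine isAAS_of_graph (S := fun n => {G | ∀ v, ({w | G.edist v w ≤ R}.ncard : ℝ) ≤ δ * n}) ?_
  exact tendsto_of_tendsto_of_tendsto_of_le_of_le' tendsto_const_nhds
    (tendsto_const_div_atTop_nhds_zero_nat _) (Eventually.of_forall fun n => measureReal_nonneg) hb

/-- The expected number is bounded uniformly in `n`, since `n ^ l * (c / n) ^ l = c ^ l`; Markov's
inequality then allows any threshold tending to infinity. -/
lemma isAAS_ncard_cycleVertices_le (hc : 0 < c) (L : ℕ) {t : ℕ → ℝ} (ht : Tendsto t atTop atTop) :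
    IsAAS D c fun n => {x | (((MRFG.ofPair x).cycleVertices L).ncard : ℝ) ≤ t n} := by
  have hb : ∀ᶠ n : ℕ in atTop, (SimpleGraph.binomialRandom (Fin n) (edgeProb c n)).real
      {G | ({v | ∃ w : G.Walk v v, w.IsCycle ∧ w.length ≤ L}.ncard : ℝ) ≤ t n}ᶜ ≤
      (∑ l ∈ Finset.Icc 1 L, c ^ l) / t n := by
    filter_upwards [eventually_edgeProb c hc.le, ht.eventually_gt_atTop 0] with n ⟨hn, _, hp⟩ htn
    have hn' : (0 : ℝ) < n := by exact_mod_cast hn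
    have h1 := measureReal_eventCount_ge_le (SimpleGraph.binomialRandom (Fin n) (edgeProb c n))
      (A := fun v : Fin n => {G | ∃ w : G.Walk v v, w.IsCycle ∧ w.length ≤ L})
      (fun _ => .of_discrete) htn
    have h2 := sum_binomialRandom_cycle_le (V := Fin n) (edgeProb c n) L
    refine (measureReal_mono ?_).trans (h1.trans ?_)
    · intro G hG
      simp only [Set.mem_compl_iff, Set.mem_ofPred_eq, not_le] at hG
      simp only [Set.mem_ofPred_eq, eventCount_eq_ncard]
      exact hG.le
    · refine (div_le_div_of_nonneg_right h2 htn.le).trans (le_of_eq ?_)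
      rw [Fintype.card_fin, hp]
      have : ∀ l, (n : ℝ) ^ l * (c / n) ^ l = c ^ l := fun l => by
        rw [← mul_pow, mul_div_cancel₀ _ hn'.ne']
      simp_rw [this]
  refine isAAS_of_graph (S := fun n =>
    {G | ({v | ∃ w : G.Walk v v, w.IsCycle ∧ w.length ≤ L}.ncard : ℝ) ≤ t n}) ?_
  exact tendsto_of_tendsto_of_tendsto_of_le_of_le' tendsto_const_nhds
    (ht.const_div_atTop _) (Eventually.of_forall fun n => measureReal_nonneg) hb

lemma tendsto_pow_mul_pow_div_factorial (c : ℝ) (N : ℕ) :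
    Tendsto (fun n : ℕ => (n : ℝ) ^ N * (c ^ n / n.factorial)) atTop (𝓝 0) := by
  have h1 := tendsto_pow_const_div_const_pow_of_one_lt N (one_lt_two (α := ℝ))
  have h2 := FloorSemiring.tendsto_pow_div_factorial_atTop (2 * c)
  have := h1.mul h2
  rw [mul_zero] at this
  refine this.congr fun n => ?_
  rw [mul_pow]
  have : (2 : ℝ) ^ n ≠ 0 := by positivity
  field_simp

lemma MRFG.maxDeg_le {d m : ℕ} (G : MRFG d m) {M : ℕ}
    (h : ∀ v, (G.graph.neighborSet v).ncard ≤ M) : G.maxDeg ≤ M := by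
  classical
  unfold MRFG.maxDeg
  let := Fintype.ofFinite G.V
  refine SimpleGraph.maxDegree_le_of_forall_degree_le _ _ fun v => ?_
  refine le_trans (le_of_eq ?_) (h v)
  rw [← SimpleGraph.card_neighborSet_eq_degree, ← Nat.card_coe_set_eq, Nat.card_eq_fintype_card]

/-- A union bound over the vertices and their possible sets of `M` neighbours gives at most `n * c ^
M / M!`, and the factorial beats `n ≤ M ^ N`. -/
lemma isAAS_maxDeg_le (hc : 0 < c) (N : ℕ) {M : ℕ → ℕ} (hM : Tendsto M atTop atTop)
    (hMn : ∀ n, n ≤ M n ^ N) : IsAAS D c fun n => {x | (MRFG.ofPair x).maxDeg ≤ M n} := by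
  have hb : ∀ n : ℕ, (SimpleGraph.binomialRandom (Fin n) (edgeProb c n)).real
      {G | ∀ v, (G.neighborSet v).ncard ≤ M n}ᶜ ≤
      (M n : ℝ) ^ N * (c ^ M n / (M n).factorial) := by
    intro n
    have h1 := binomialRandom_real_degree_ge_le (V := Fin n) (edgeProb c n) (M n)
    refine (measureReal_mono ?_).trans (h1.trans ?_)
    · intro G hG
      simp only [Set.mem_compl_iff, Set.mem_ofPred_eq, not_forall, not_le] at hG
      obtain ⟨v, hv⟩ := hG
      exact ⟨v, hv.le⟩
    · rw [Fintype.card_fin]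
      refine mul_le_mul (by exact_mod_cast hMn n) ?_
        (mul_nonneg (Nat.cast_nonneg _) (pow_nonneg (edgeProb c n).2.1 _)) (by positivity)
      have hp := edgeProb_le hc.le n
      calc (n.choose (M n) : ℝ) * (edgeProb c n : ℝ) ^ M n ≤
          (n ^ M n / (M n).factorial) * (c / n) ^ M n :=
            mul_le_mul (Nat.choose_le_pow_div _ _) (pow_le_pow_left₀ (edgeProb c n).2.1 hp _)
              (pow_nonneg (edgeProb c n).2.1 _) (by positivity)
        _ = (n * (c / n)) ^ M n / (M n).factorial := by rw [mul_pow]; ring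
        _ ≤ _ := by
          gcongr
          rcases Nat.eq_zero_or_pos n with rfl | hn
          · simpa using hc.le
          · have hn' : (n : ℝ) ≠ 0 := by exact_mod_cast hn.ne'
            rw [mul_div_cancel₀ _ hn']
  refine (isAAS_of_graph (S := fun n => {G | ∀ v, (G.neighborSet v).ncard ≤ M n}) ?_).mono
    (Eventually.of_forall fun n x hx => MRFG.maxDeg_le _ hx)
  exact tendsto_of_tendsto_of_tendsto_of_le_of_le tendsto_const_nhds
    ((tendsto_pow_mul_pow_div_factorial c N).comp hM) (fun n => measureReal_nonneg) hb

lemma isAAS_isHomogeneous (hc : 0 < c) (k r : ℕ) {η : ℝ} (hη : 0 < η) :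
    IsAAS D c fun n => {x : SimpleGraph (Fin n) × (Fin n → Fin d → ℝ) |
      (MRFG.ofPair x).IsHomogeneous k η r} := by
  -- With at most `s` vertices on short cycles and degrees at most `2 * s`, the quotient is of order
  -- `s ^ (r + 1) / s ^ (r + 2) = 1 / s`.
  set s : ℕ → ℝ := fun n => (n : ℝ) ^ ((1 : ℝ) / (r + 2 : ℕ))
  have hs : Tendsto s atTop atTop :=
    (tendsto_rpow_atTop (by positivity)).comp tendsto_natCast_atTop_atTop
  have hsN : ∀ n, s n ^ (r + 2) = n := fun n => by
    simp only [s]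
    rw [← Real.rpow_natCast, ← Real.rpow_mul (Nat.cast_nonneg _), one_div,
      inv_mul_cancel₀ (by positivity), Real.rpow_one]
  have h1 := isAAS_ncard_cycleVertices_le (D := D) hc (2 * r + 1) hs
  have h2 := isAAS_maxDeg_le (D := D) hc (r + 2) (M := fun n => ⌈s n⌉₊)
    (tendsto_nat_ceil_atTop.comp hs) fun n => by
      have : (n : ℝ) ≤ (⌈s n⌉₊ : ℝ) ^ (r + 2) := by
        rw [← hsN n]
        exact pow_le_pow_left₀ (Real.rpow_nonneg (Nat.cast_nonneg _) _) (Nat.le_ceil _) _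
      exact_mod_cast this
  refine (h1.inter h2).mono ?_
  filter_upwards [hs.eventually_ge_atTop 1, hs.eventually_ge_atTop ((k + 1) * 2 ^ r / η)]
    with n hn1 hn2 x hx
  obtain ⟨hx1, hx2⟩ := hx
  simp only [Set.mem_ofPred_eq] at hx1 hx2
  have hdeg : ((MRFG.ofPair x).maxDeg : ℝ) ≤ 2 * s n := by
    have h3 : ((MRFG.ofPair x).maxDeg : ℝ) ≤ (⌈s n⌉₊ : ℝ) := by exact_mod_cast hx2
    have h4 := Nat.ceil_lt_add_one (zero_le_one.trans hn1)
    linarith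
  have hcard : (Nat.card (MRFG.ofPair x).V : ℝ) = s n ^ (r + 2) := by
    rw [hsN n]
    exact_mod_cast Nat.card_fin n
  have hpos : 0 < s n := zero_lt_one.trans_le hn1
  change _ ≤ η
  rw [hcard, div_le_iff₀ (by positivity)]
  rw [div_le_iff₀ hη] at hn2
  calc _ ≤ ((k + 1) * s n) * (2 * s n) ^ r := by
        refine mul_le_mul ?_ (pow_le_pow_left₀ (Nat.cast_nonneg _) hdeg _) (by positivity)
          (by positivity)
        have := mul_le_mul_of_nonneg_left hn1 (Nat.cast_nonneg (α := ℝ) k)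
        linarith
    _ = ((k + 1) * 2 ^ r) * s n ^ (r + 1) := by rw [mul_pow]; ring
    _ ≤ (s n * η) * s n ^ (r + 1) := mul_le_mul_of_nonneg_right hn2 (by positivity)
    _ = _ := by ring

end GraphEvents

/-! ### Greedy choice of distant copies; richness -/

/-- A large set contains `k` elements that are pairwise not in relation to each other. -/
lemma exists_pairwise_not {V : Type*} [Finite V] {R : V → V → Prop} (hR : ∀ v w, R v w → R w v) {M : ℝ}
    (hM0 : 0 ≤ M) (hM : ∀ v, ({w | R v w}.ncard : ℝ) ≤ M) {S : Set V} (k : ℕ) (hk : k * M < S.ncard) :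
    ∃ f : Fin k → V, (∀ i, f i ∈ S) ∧ ∀ i j, i ≠ j → ¬ R (f i) (f j) := by
  classical
  induction k with
  | zero => exact ⟨Fin.elim0, fun i => i.elim0, fun i => i.elim0⟩
  | succ k ih =>
    push_cast at hk
    have hk' : k * M < S.ncard := by linarith
    obtain ⟨f, hf, hff⟩ := ih hk'
    have hU : ((⋃ i, {w | R (f i) w}).ncard : ℝ) ≤ k * M := by
      have h1 : ((⋃ i, {w | R (f i) w}).ncard : ℝ) ≤ ∑ i, ({w | R (f i) w}.ncard : ℝ) := by
        have h2 := Finset.card_biUnion_le (s := Finset.univ)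
          (t := fun i => (Set.toFinite {w | R (f i) w}).toFinset)
        have h3 : (⋃ i, {w | R (f i) w}) = ((Finset.univ.biUnion fun i =>
            (Set.toFinite {w | R (f i) w}).toFinset : Finset V) : Set V) := by
          ext; simp
        simp_rw [← Set.ncard_eq_toFinset_card _ (Set.toFinite _)] at h2
        rw [← Set.ncard_coe_finset, ← h3] at h2
        exact_mod_cast h2
      refine h1.trans ((Finset.sum_le_sum fun i _ => hM (f i)).trans ?_)
      simp
    obtain ⟨v, hvS, hv⟩ : ∃ v ∈ S, v ∉ ⋃ i, {w | R (f i) w} := by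
      by_contra! hcon
      have : (S.ncard : ℝ) ≤ (⋃ i, {w | R (f i) w}).ncard := by
        exact_mod_cast Set.ncard_le_ncard (fun v hv => hcon v hv) (Set.toFinite _)
      linarith
    simp only [Set.mem_iUnion, Set.mem_ofPred_eq, not_exists] at hv
    refine ⟨Fin.snoc (α := fun _ => V) f v, fun i => ?_, fun i j hij => ?_⟩
    · refine Fin.lastCases ?_ (fun i => ?_) i <;> simp [hvS, hf]
    · induction i using Fin.lastCases with
      | last =>
        induction j using Fin.lastCases with
        | last => exact absurd rfl hij
        | cast j => simpa using fun h => hv j (hR _ _ h)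
      | cast i =>
        induction j using Fin.lastCases with
        | last => simpa using hv i
        | cast j => simpa using hff i j (by simpa using hij)

section Rich

variable {d : ℕ} {D : Measure (Fin d → ℝ)} [IsProbabilityMeasure D] {c : ℝ}

/-- The vertices whose `r`-ball is a copy of the tree `T`, up to `ε` in the features. -/
def MRFG.copies {n : ℕ} (T : MRFG d 1) (ε : ℝ) (r : ℕ)
    (x : SimpleGraph (Fin n) × (Fin n → Fin d → ℝ)) : Set (Fin n) :=
  {v | ∃ φ : T.V → Fin n, IsBallEmb T.graph (T.root 0) r x.1 φ ∧ φ (T.root 0) = v ∧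
    ∀ w, ‖x.2 (φ w) - T.feat w‖ ≤ ε}

/-- Features in the support have neighbourhoods of positive mass, so the expected number of
embeddings has a positive slope `q`. All injections are counted here, and a vertex is the root of at
most `K` embeddings, whence the constant `q / (2 * K)`. -/
lemma isAAS_ncard_copies (hc : 0 < c) (T : MRFG d 1) (hT : T.IsRootedTree) {r : ℕ}
    (hr : T.HeightLE r) (hf : ∀ w, T.feat w ∈ D.support) {ε : ℝ} (hε : 0 < ε) :
    ∃ δ : ℝ, 0 < δ ∧ IsAAS D c fun n => {x | δ * n ≤ (T.copies ε r x).ncard} := by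
  classical
  let := Fintype.ofFinite T.V
  set C : T.V → Set (Fin d → ℝ) := fun w => Metric.closedBall (T.feat w) ε
  have hC : ∀ w, MeasurableSet (C w) := fun w => Metric.isClosed_closedBall.measurableSet
  set q : ℝ := 1 * c ^ (Fintype.card T.V - 1) *
    Real.exp (-c) ^ {w | T.graph.dist (T.root 0) w < r}.ncard * ∏ w, D.real (C w)
  have hq : 0 < q := by
    have : 0 < ∏ w, D.real (C w) := Finset.prod_pos fun w _ =>
      ENNReal.toReal_pos (((Measure.mem_support_iff_forall _).1 (hf w) _
        (Metric.closedBall_mem_nhds _ hε)).ne') (measure_ne_top _ _)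
    positivity
  set Φ : ∀ n, Finset (T.V → Fin n) := fun n => Finset.univ.filter Function.Injective
  set K : ℕ := Fintype.card T.V ^ Fintype.card T.V
  have hK : (0 : ℝ) < K := by
    have : 0 < Fintype.card T.V := Fintype.card_pos_iff.2 ⟨T.root 0⟩
    positivity
  have h := tendsto_real_eventCount_le D hc hT hr hC Φ (fun n φ hφ => (Finset.mem_filter.1 hφ).2)
    (fun n => (n.descFactorial (Fintype.card T.V) : ℝ))
    (fun n => by simp only [Φ]; rw [TreeCode.card_filter_injective, Fintype.card_fin]) 1
    (TreeCode.tendsto_descFactorial_div_pow _) (q / 2) (by positivity)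
  refine ⟨q / (2 * K), by positivity, ?_⟩
  refine (isAAS_of_real (S := fun n => {x | (eventCount (fun φ : Φ n =>
    featBallEvent T.graph (T.root 0) r C φ.1) x : ℝ) ≤ (q - q / 2) * n}ᶜ) ?_).mono
    (Eventually.of_forall fun n x hx => ?_)
  · simp only [compl_compl]
    exact h
  · simp only [Set.mem_compl_iff, Set.mem_ofPred_eq, not_le] at hx
    have hle : eventCount (fun φ : Φ n => featBallEvent T.graph (T.root 0) r C φ.1) x ≤
        K * (T.copies ε r x).ncard := by
      rw [eventCount, Set.ncard_eq_toFinset_card', mul_comm]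
      rw [← Finset.card_map ⟨Subtype.val, Subtype.val_injective⟩]
      refine (Finset.card_le_mul_card_image_of_maps_to (f := fun φ : T.V → Fin n => φ (T.root 0))
        (t := (T.copies ε r x).toFinset) (fun φ hφ => ?_) K fun v _ => ?_).trans_eq (mul_comm _ _)
      · obtain ⟨φ', hφ', rfl⟩ := Finset.mem_map.1 hφ
        have := (Finset.mem_filter.1 hφ').2
        exact Set.mem_toFinset.2 ⟨_, this.1, rfl, fun w => mem_closedBall_iff_norm.1 (this.2 w)⟩
      · refine IsBallEmb.card_le (G := x.1) hT.connected hr v _ fun φ hφ => ?_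
        obtain ⟨hφ, hv⟩ := Finset.mem_filter.1 hφ
        obtain ⟨φ', hφ', rfl⟩ := Finset.mem_map.1 hφ
        exact ⟨(Finset.mem_filter.1 hφ').2.1, hv⟩
    have hle' : (eventCount (fun φ : Φ n => featBallEvent T.graph (T.root 0) r C φ.1) x : ℝ) ≤
        K * (T.copies ε r x).ncard := by exact_mod_cast hle
    simp only [Set.mem_ofPred_eq]
    rw [div_mul_eq_mul_div, div_le_iff₀ (by positivity)]
    linarith

/-- There are many far apart copies of a given tree, which are also far from short cycles. -/
lemma isAAS_exists_copies (hc : 0 < c) (T : MRFG d 1) (hT : T.IsRootedTree) {r' : ℕ}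
    (hr : T.HeightLE r') (hf : ∀ w, T.feat w ∈ D.support) {ε : ℝ} (hε : 0 < ε) (k R : ℕ) :
    IsAAS D c fun n => {x | ∃ v : Fin k → Fin n, (∀ i, v i ∈ T.copies ε r' x) ∧
      (∀ i j, i ≠ j → (R : ℕ∞) < x.1.edist (v i) (v j)) ∧
      ∀ i, ∀ w ∈ (MRFG.ofPair x).cycleVertices R, (R : ℕ∞) < x.1.edist (v i) w} := by
  obtain ⟨δ, hδ, h1⟩ := isAAS_ncard_copies hc T hT hr hf hε
  -- The radius adds the distance `R` to a cycle and the length `R` of the cycle. Half of the `δ *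
  -- n` copies survive the removal of bad vertices, and the greedy choice needs fewer than `δ / 2 *
  -- n`.
  have h2 := isAAS_ball_isAcyclic D hc (R + R) (half_pos hδ)
  have hδ' : 0 < δ / 2 / (k + 1) := by positivity
  have h3 := isAAS_ncard_ball_le (D := D) hc R hδ'
  refine ((h1.inter h2).inter h3).mono ?_
  filter_upwards [eventually_gt_atTop 0] with n hn x hx
  obtain ⟨⟨hx1, hx2⟩, hx3⟩ := hx
  simp only [Set.mem_ofPred_eq] at hx1 hx2 hx3
  have hn' : (0 : ℝ) < n := by exact_mod_cast hn
  set B : Set (Fin n) := {v | ¬ ((MRFG.ofPair x).ball (R + R) v).graph.IsAcyclic}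
  have hB : (B.ncard : ℝ) ≤ δ / 2 * n := hx2
  have hdiff : ((T.copies ε r' x).ncard : ℝ) ≤ (T.copies ε r' x \ B).ncard + B.ncard := by
    exact_mod_cast Set.ncard_le_ncard_sdiff_add_ncard _ _ (Set.toFinite _)
  have hk : k * (δ / 2 / (k + 1) * n) < (T.copies ε r' x \ B).ncard := by
    have : k * (δ / 2 / (k + 1) * n) < δ / 2 * n := by
      have h4 : k * (δ / 2 / (k + 1) * n) = δ / 2 * n * (k / (k + 1)) := by ring
      rw [h4]
      refine mul_lt_of_lt_one_right (by positivity) ?_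
      rw [div_lt_one (by positivity)]
      linarith
    linarith
  obtain ⟨f, hf1, hf2⟩ := exists_pairwise_not (R := fun v w => x.1.edist v w ≤ R)
    (fun v w h => by rwa [SimpleGraph.edist_comm]) (by positivity) hx3 k hk
  refine ⟨f, fun i => (hf1 i).1, fun i j hij => not_le.1 (hf2 i j hij), fun i w hw => ?_⟩
  by_contra hcon
  exact (hf1 i).2 ((MRFG.ofPair x).ball_not_isAcyclic hw (not_lt.1 hcon))

/-- Richness asks about infinitely many trees at once, whereas only finitely many events can be
intersected. One tree of each realised type and height bound is copied up to `ε / 2`; the other `ε /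
2` is spent on replacing it by any tree of the same type. -/
lemma isAAS_isRich (hD : IsCompact D.support) (hc : 0 < c) (k r : ℕ) {ε η : ℝ} (hε : 0 < ε)
    (hη : 0 < η) : IsAAS D c fun n => {x : SimpleGraph (Fin n) × (Fin n → Fin d → ℝ) |
      (MRFG.ofPair x).IsRich D.support k ε η r} := by
  classical
  obtain ⟨A, _, τ, hτ⟩ := MRFG.exists_finite_types hD.totallyBounded (half_pos hε) hη k 1
  let := Fintype.ofFinite A
  set Adm : ℕ → MRFG d 1 → Prop := fun r' T =>
    T.IsRootedTree ∧ T.HeightLE r' ∧ ∀ w, T.feat w ∈ D.support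
  have h : ∀ p ∈ Finset.range (r + 1) ×ˢ (Finset.univ : Finset A), IsAAS D c fun n =>
      {x : SimpleGraph (Fin n) × (Fin n → Fin d → ℝ) | ∀ T, Adm p.1 T → τ T = p.2 →
        ∃ v : Fin k → Fin n, (∀ i, MRFG.Sim ε η k ((MRFG.ofPair x).ball p.1 (v i)) T) ∧
          (∀ i j, i ≠ j → ((2 * r + 1 : ℕ) : ℕ∞) < x.1.edist (v i) (v j)) ∧
          ∀ i, ∀ w ∈ (MRFG.ofPair x).cycleVertices (2 * r + 1),
            ((2 * r + 1 : ℕ) : ℕ∞) < x.1.edist (v i) w} := by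
    rintro ⟨r', a⟩ -
    by_cases hex : ∃ T₀, Adm r' T₀ ∧ τ T₀ = a
    · obtain ⟨T₀, hT₀, rfl⟩ := hex
      refine (isAAS_exists_copies hc T₀ hT₀.1 hT₀.2.1 hT₀.2.2 (half_pos hε) k (2 * r + 1)).mono
        (Eventually.of_forall fun n x hx T hT hTa => ?_)
      obtain ⟨v, hv1, hv2, hv3⟩ := hx
      refine ⟨v, fun i => ?_, hv2, hv3⟩
      obtain ⟨φ, hφ, hφv, hφf⟩ := hv1 i
      have := MRFG.Sim.of_isBallEmb (G := MRFG.ofPair x) hφ hT₀.1.connected hT₀.2.1 hφf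
        (hτ T₀ T hT₀.2.2 hT.2.2 hTa.symm)
      rw [add_halves, hφv] at this
      exact this
    · refine (isAAS_of_real (S := fun n => Set.univ) (by simp)).mono
        (Eventually.of_forall fun n x _ T hT hTa => absurd ⟨T, hT, hTa⟩ hex)
  refine (IsAAS.biInter _ h).mono (Eventually.of_forall fun n x hx => ?_)
  simp only [Set.mem_iInter] at hx
  intro r' hr' T hT hh hf
  obtain ⟨v, hv1, hv2, hv3⟩ := hx (r', τ T) (by simp; omega) T ⟨hT, hh, hf⟩ rfl
  exact ⟨v, hv1, hv2, fun i => ⟨fun j => j.elim0, hv3 i⟩⟩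

end Rich

theorem mainTheorem6 {d : ℕ} (D : Measure (Fin d → ℝ)) [IsProbabilityMeasure D]
    (hD : IsCompact D.support) (c : ℝ) (hc : 0 < c)
    (k r : ℕ) (ε η : ℝ) (hε : 0 < ε) (hη : 0 < η) :
    HoldsAAS D c fun G =>
      G.IsRich D.support k ε η r ∧
      G.IsSimilarToFBP D c k ε η r ∧
      G.IsHomogeneous k η r := by
  exact (isAAS_isRich hD hc k r hε hη).inter
    ((isAAS_isSimilarToFBP D hc k r hε hη).inter (isAAS_isHomogeneous hc k r hη))

end
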